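/- **Setting.** For each index $n$ of a sequence (all quantities below may depend on $n$; limits, $\ll$, $O_p$ are as $n\to\infty$) there are $K\ge1$ clients; client $k$ has $n_k$ observations $(\bm x_i^{(k)},y_i^{(k)})\in\mathbb R^p\times\mathbb R$ with $x_{i1}^{(k)}\equiv1$; $N=\sum_k n_k$, and $n_k\asymp n^*:=N/K$ uniformly in $k$. All observations are independent, and i.i.d. within each client. The clients are partitioned into $M$ nonempty clusters $\mathcal G^{(1)},\dots,\mathcal G^{(M)}$; $|\mathcal G_{\max}|,|\mathcal G_{\min}|$ are the largest and smallest cluster cardinalities, $N_{\min}=\min_m\sum_{k\in\mathcal G^{(m)}}n_k$. The true coefficient matrix $\bm\theta^*\in\mathbb R^{p\times K}$ has columns $\bm\theta^{*(k)}=\bm\psi^{*(m)}$ for $k\in\mathcal G^{(m)}$, and $\bm\psi^*\in\mathbb R^{p\times M}$ has rows $\bm\psi^*_j=\bm 0$ for $j\notin\mathcal A=\{1,\dots,q\}$, $1\le q\le p$. Let $$d_1=\min_{j\in\mathcal A}\|\bm\psi^*_j\|_2,\qquad d_2=\min_{m\neq m'}\|\bm\psi_{\mathcal A}^{*(m)}-\bm\psi_{\mathcal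 A}^{*(m')}\|_2\quad(=\infty\text{ if }M=1).$$ The loss $f(a,y)$ (not depending on $n$) is measurable and twice differentiable in $a$, with derivatives $f',f''$ in $a$; $\bm\theta^{*(k)}$ solves the population score equation $\mathbb E[f'(\bm x_i^{(k)\top}\bm\theta^{*(k)},y_i^{(k)})\bm x_i^{(k)}]=\bm0$. Let $\widehat{\mathcal L}_k(\bm b)=n_k^{-1}\sum_i f(\bm x_i^{(k)\top}\bm b,y_i^{(k)})$, with gradient $\mathbf g^{(k)}(\bm b)$ and Hessian $\mathbf V^{(k)}(\bm b)$; $\mathbf V^{*(k)}=\mathbf V^{(k)}(\bm\theta^{*(k)})$. Given (measurable) local estimators $\widetilde{\bm\theta}^{(k)}$, put $\widetilde{\mathbf V}^{(k)}=\mathbf V^{(k)}(\widetilde{\bm\theta}^{(k)})$, $\widetilde{\bm\zeta}^{(k)}=\widetilde{\mathbf V}^{(k)}\widetilde{\bm\theta}^{(k)}-\mathbf g^{(k)}(\widetilde{\bm\theta}^{(k)})$, and, for $\bm\theta\in\mathbb R^{p\times K}$ with rows $\bm\theta_j$ and columns $\bm\theta^{(k)}$, $$\mathcal L^{or}(\bm\theta)=\frac1N\sum_{k=1}^K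 n_k\big(\bm\theta^{(k)\top}\widetilde{\mathbf V}^{(k)}\bm\theta^{(k)}-2\bm\theta^{(k)\top}\widetilde{\bm\zeta}^{(k)}\big),\qquad \mathcal L(\bm\theta)=\mathcal L^{or}(\bm\theta)+\sum_{j=2}^p p_\tau(\|\bm\theta_j\|_2,\lambda_1),$$ $$\widehat{\mathcal Q}_{\mathrm{ICR}}(\bm\theta)=\mathcal L(\bm\theta)+\sum_{k<k'}p_\tau(\|\bm\theta^{(k)}-\bm\theta^{(k')}\|_2,\lambda_2),$$ with $\lambda_1,\lambda_2\ge0$ and $\tau>0$ fixed. Let $\mathcal M_{\mathcal G}$ be the set of $\bm\theta$ whose columns agree within each cluster, $\varphi_{\max}=\max_k\|\mathbb E(\mathbf V^{*(k)}_{\mathcal A^c\mathcal A})[\mathbb E(\mathbf V^{*(k)}_{\mathcal A\mathcal A})]^{-1}\|_\infty$ (maximal absolute row sum), and $$r_{1N}=\sqrt{\tfrac{(K/|\mathcal G_{\min}|)q}{N_{\min}}}+\tfrac{|\mathcal G_{\max}|M^{1/2}q^{3/2}\log p}{N_{\min}},\qquad r_{2N}=\sqrt{\tfrac{(|\mathcal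 G_{\max}|/|\mathcal G_{\min}|)M\log p}{KN}}+\tfrac{(|\mathcal G_{\max}|/|\mathcal G_{\min}|^{1/2})M^{1/2}q\log p}{N}.$$ **Conditions** (constants do not depend on $n,k,i$). 1. $\|\bm x_i^{(k)}\|_\infty\le C_x$ almost surely and $\mathbb E(\bm v^\top\bm x_i^{(k)})^2\le C_x$ for $\|\bm v\|_2\le1$. 2. $\sup_{s\ge1}s^{-1/2}(\mathbb E|Z|^s)^{1/s}\le\kappa_x$ for $Z=f'(\bm x_i^{(k)\top}\bm\theta^{*(k)},y_i^{(k)})$. 3. The eigenvalues of $\mathbb E(\mathbf V^{*(k)}_{\mathcal A\mathcal A})$ lie in $[C_{\min},C_{\max}]$, with $C_{\min}>0$. 4. For every $\delta=o(1)$, $\delta\ge0$, there is $C_L$ with, for all large $n$ and almost surely, $|f''(\bm x_i^{(k)\top}\bm b,y_i^{(k)})|\le C_L$ whenever $\|\bm b-\bm\theta^{*(k)}\|_2\le\delta$; and $|f''(a,y)-f''(b,y)|\le C_L|a-b|$ for all real $a,b,y$, for some constant $C_L$. 5. $\max_k\|\widetilde{\bm\theta}^{(k)}-\bm\theta^{*(k)}\|_2$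 and $\max_k n_k^{-1/2}\|\mathbf X^{(k)}(\widetilde{\bm\theta}^{(k)}-\bm\theta^{*(k)})\|_2$ are both $O_p(\sqrt{q\log p/n^*})$, where $\mathbf X^{(k)}$ has rows $\bm x_i^{(k)\top}$. 6. For every $\lambda>0$, $p_\tau(\cdot,\lambda)$ is non-decreasing and concave on $[0,\infty)$, constant on $[\tau\lambda,\infty)$, $p_\tau(0,\lambda)=0$, its derivative exists and is continuous on $(0,\infty)$ off a finite set, and its right derivative at $0$ is $\lambda$. 7. $(|\mathcal G_{\max}|/|\mathcal G_{\min}|)^2q^4\log p\ll n^*$ and $K\ll p$. 8. $\lambda_1\gg|\mathcal G_{\max}|^{1/2}r_{1N}+\varphi_{\max}r_{2N}$, $r_{1N}=o(1)$, $\lambda_1\gg\max(1,\varphi_{\max})(\log p/N)^{1/2}$, $\lambda_2\gg|\mathcal G_{\max}|^{1/2}r_{1N}$. 9. $|\mathcal G_{\min}|^{1/2}d_1>\tau\lambda_1$ and $d_2>\tau\lambda_2$, with margins that dominate $|\mathcal G_{\max}|^{1/2}r_{1N}$: for every constant $C$, for all large $n$, $|\mathcal G_{\min}|^{1/2}d_1>\tau\lambda_1+C|\mathcal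 G_{\max}|^{1/2}r_{1N}$ and $d_2>\tau\lambda_2+C|\mathcal G_{\max}|^{1/2}r_{1N}$. **Conclusion.** There are random matrices $\widehat{\bm\theta}^{or}$ and $\widehat{\bm\theta}$ in $\mathbb R^{p\times K}$ such that, with probability tending to one, $\widehat{\bm\theta}^{or}$ is the unique minimizer of $\mathcal L^{or}$ over $\{\bm\theta\in\mathcal M_{\mathcal G}:\bm\theta_{\mathcal A^c}=\bm0\}$, and a strictly local minimizer of $\mathcal L$ over $\mathcal M_{\mathcal G}$ with $\widehat{\bm\theta}^{or}_{\mathcal A^c}=\bm0$; $\|\widehat{\bm\theta}^{or}_{\mathcal A}-\bm\theta^*_{\mathcal A}\|_F=O_p(|\mathcal G_{\max}|^{1/2}r_{1N})$; with probability tending to one, $\widehat{\bm\theta}$ is a strictly local minimizer of $\widehat{\mathcal Q}_{\mathrm{ICR}}$ over $\mathbb R^{p\times K}$; and $$P(\widehat{\bm\theta}=\widehat{\bm\theta}^{or})\to1.$$ In particular, with probability tending to one, $\{j:\widehat{\bm\theta}_j\ne\bm0\}=\mathcal A$, and $\widehat{\bm\theta}^{(k)}=\widehat{\bm\theta}^{(k')}$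 if and only if $k$ and $k'$ belong to the same cluster. -/

import Mathlib

open Filter Topology MeasureTheory ProbabilityTheory Asymptotics
open scoped Matrix ENNReal

universe u

noncomputable section

/-! ### General notions -/

/-- The Euclidean norm of a finite family of reals. -/
def l2 {ι : Type*} [Fintype ι] (v : ι → ℝ) : ℝ := ‖(WithLp.toLp 2 v : EuclideanSpace ℝ ι)‖

/-- The Frobenius norm of a matrix. -/
def frob {ι κ : Type*} [Fintype ι] [Fintype κ] (Z : Matrix ι κ ℝ) : ℝ :=
  Real.sqrt (∑ i, ∑ j, Z i j ^ 2)

/-- The maximal absolute row sum of a matrix (zero for a matrix without rows). -/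
def rowSumNorm {ι κ : Type*} [Fintype ι] [Fintype κ] (Z : Matrix ι κ ℝ) : ℝ :=
  ⨆ i, ∑ j, |Z i j|

/-- The sub-Gaussian norm `sup_{s ≥ 1} s^{-1/2} (E|X|^s)^{1/s}`. -/
def subGaussianNorm {Ω : Type*} [MeasurableSpace Ω] (X : Ω → ℝ) (μ : Measure Ω) : ℝ≥0∞ :=
  ⨆ (s : ℝ) (_ : 1 ≤ s), eLpNorm X (ENNReal.ofReal s) μ / ENNReal.ofReal (Real.sqrt s)

/-- `a` is a strictly local minimizer of `F` over `S`. -/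
def IsStrictLocalMinOver {α : Type*} [TopologicalSpace α] (F : α → ℝ) (S : Set α) (a : α) : Prop :=
  a ∈ S ∧ ∀ᶠ b in 𝓝[S \ {a}] a, F a < F b

/-- First derivative of the loss in its first argument. -/
def lossD1 (f : ℝ → ℝ → ℝ) (a y : ℝ) : ℝ := deriv (fun t => f t y) a

/-- Second derivative of the loss in its first argument. -/
def lossD2 (f : ℝ → ℝ → ℝ) (a y : ℝ) : ℝ := deriv (fun t => lossD1 f t y) a

/-- A loss function: measurable, and twice differentiable in its first argument. -/
structure IsTwiceDiffLoss (f : ℝ → ℝ → ℝ) : Prop where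
  measurable : Measurable (Function.uncurry f)
  diff : ∀ y, Differentiable ℝ (fun a => f a y)
  diff2 : ∀ y, Differentiable ℝ (fun a => lossD1 f a y)

/-- The conditions on the penalty `pen t lam`, with concavity parameter `τ`. -/
structure IsConcavePenalty (τ : ℝ) (pen : ℝ → ℝ → ℝ) : Prop where
  mono : ∀ lam, 0 < lam → MonotoneOn (fun t => pen t lam) (Set.Ici 0)
  concave : ∀ lam, 0 < lam → ConcaveOn ℝ (Set.Ici 0) (fun t => pen t lam)
  flat : ∀ lam, 0 < lam → ∀ t, τ * lam ≤ t → pen t lam = pen (τ * lam) lam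
  zero : ∀ lam, 0 < lam → pen 0 lam = 0
  smooth : ∀ lam, 0 < lam → ∃ T : Set ℝ, T.Finite ∧ ∀ t, 0 < t → t ∉ T →
    DifferentiableAt ℝ (fun t => pen t lam) t ∧ ContinuousAt (deriv (fun t => pen t lam)) t
  slope : ∀ lam, 0 < lam → HasDerivWithinAt (fun t => pen t lam) lam (Set.Ici 0) 0

/-! ### One experiment -/

/-- One experiment: `K` clients with sample sizes `size k`, `p` covariates of which the first `q`
(the first one is the intercept) have nonzero effects, `M` nonempty clusters of clients, the true
common coefficient matrix `ψstar`, the random data `(x, y)`, and the local estimators. -/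
structure Experiment where
  Ω : Type u
  mΩ : MeasurableSpace Ω
  μ : Measure Ω
  prob : IsProbabilityMeasure μ
  K : ℕ
  M : ℕ
  p : ℕ
  q : ℕ
  K_pos : 0 < K
  q_pos : 0 < q
  q_le : q ≤ p
  size : Fin K → ℕ
  cluster : Fin K → Fin M
  cluster_surj : Function.Surjective cluster
  ψstar : Matrix (Fin p) (Fin M) ℝ
  ψstar_zero : ∀ j : Fin p, q ≤ (j : ℕ) → ∀ m, ψstar j m = 0
  x : ∀ k : Fin K, Fin (size k) → Ω → Fin p → ℝ
  y : ∀ k : Fin K, Fin (size k) → Ω → ℝ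
  measurable_x : ∀ k i, Measurable (x k i)
  measurable_y : ∀ k i, Measurable (y k i)
  intercept : ∀ k i ω (j : Fin p), (j : ℕ) = 0 → x k i ω j = 1
  θlocal : Fin K → Ω → Fin p → ℝ
  measurable_θlocal : ∀ k, Measurable (θlocal k)

attribute [instance] Experiment.mΩ Experiment.prob

namespace Experiment

variable (E : Experiment.{u}) (f : ℝ → ℝ → ℝ) (pen : ℝ → ℝ → ℝ) (lam1 lam2 : ℝ)

/-- Coefficient matrices: `θ j k` is the coefficient of covariate `j` for client `k`. -/
abbrev Coef : Type := Matrix (Fin E.p) (Fin E.K) ℝ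

/-- Column `k`: the coefficient vector of client `k`. -/
def column (θ : E.Coef) (k : Fin E.K) : Fin E.p → ℝ := fun j => θ j k

/-- The true coefficient matrix. -/
def θstar : E.Coef := fun j k => E.ψstar j (E.cluster k)

/-- Total sample size. -/
def N : ℕ := ∑ k, E.size k

/-- The common order `N / K` of the local sample sizes. -/
def nstar : ℝ := (E.N : ℝ) / E.K

/-- Cardinality of cluster `m`. -/
def clusterCard (m : Fin E.M) : ℕ := (Finset.univ.filter (fun k => E.cluster k = m)).card

/-- Number of observations in cluster `m`. -/
def clusterN (m : Fin E.M) : ℕ := ∑ k ∈ Finset.univ.filter (fun k => E.cluster k = m), E.size k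

def Gmax : ℕ := ⨆ m, E.clusterCard m
def Gmin : ℕ := ⨅ m, E.clusterCard m
def Nmin : ℕ := ⨅ m, E.clusterN m

/-- Indices of the important covariates. -/
abbrev Act : Type := {j : Fin E.p // (j : ℕ) < E.q}

/-- Indices of the unimportant covariates. -/
abbrev Inact : Type := {j : Fin E.p // ¬ (j : ℕ) < E.q}

/-- The empirical loss of client `k`. -/
def localLoss (k : Fin E.K) (ω : E.Ω) (b : Fin E.p → ℝ) : ℝ :=
  (1 / (E.size k : ℝ)) * ∑ i, f (E.x k i ω ⬝ᵥ b) (E.y k i ω)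

/-- Gradient of the local empirical loss. -/
def grad (k : Fin E.K) (ω : E.Ω) (b : Fin E.p → ℝ) : Fin E.p → ℝ :=
  fun j => lineDeriv ℝ (E.localLoss f k ω) b (Pi.single j 1)

/-- Hessian of the local empirical loss. -/
def hess (k : Fin E.K) (ω : E.Ω) (b : Fin E.p → ℝ) : Matrix (Fin E.p) (Fin E.p) ℝ :=
  fun j l => lineDeriv ℝ (fun b' => E.grad f k ω b' l) b (Pi.single j 1)

/-- Hessian at the local estimator. -/
def Vlocal (k : Fin E.K) (ω : E.Ω) : Matrix (Fin E.p) (Fin E.p) ℝ :=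
  E.hess f k ω (E.θlocal k ω)

/-- The vector `V θ - g` at the local estimator. -/
def ζlocal (k : Fin E.K) (ω : E.Ω) : Fin E.p → ℝ :=
  E.Vlocal f k ω *ᵥ E.θlocal k ω - E.grad f k ω (E.θlocal k ω)

/-- Expectation of the Hessian at the true coefficients. -/
def EV (k : Fin E.K) : Matrix (Fin E.p) (Fin E.p) ℝ :=
  fun j l => ∫ ω, E.hess f k ω (E.column E.θstar k) j l ∂E.μ

def EVAA (k : Fin E.K) : Matrix E.Act E.Act ℝ :=
  (E.EV f k).submatrix Subtype.val Subtype.val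

def EVAcA (k : Fin E.K) : Matrix E.Inact E.Act ℝ :=
  (E.EV f k).submatrix Subtype.val Subtype.val

def φmax : ℝ := ⨆ k, rowSumNorm (E.EVAcA f k * (E.EVAA f k)⁻¹)

/-- The least-squares type lack of fit built from the summary statistics. -/
def fit (ω : E.Ω) (θ : E.Coef) : ℝ :=
  (1 / (E.N : ℝ)) * ∑ k, (E.size k : ℝ) *
    (E.column θ k ⬝ᵥ (E.Vlocal f k ω *ᵥ E.column θ k)
      - 2 * (E.column θ k ⬝ᵥ E.ζlocal f k ω))

/-- The group penalty; the intercept (index zero) is not penalized. -/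
def groupPen (θ : E.Coef) : ℝ :=
  ∑ j ∈ Finset.univ.filter (fun j : Fin E.p => (j : ℕ) ≠ 0), pen (l2 (θ j)) lam1

/-- The pairwise fusion penalty. -/
def fusionPen (θ : E.Coef) : ℝ :=
  ∑ k, ∑ k' ∈ Finset.univ.filter (fun k' => k < k'),
    pen (l2 (E.column θ k - E.column θ k')) lam2

/-- The full objective function. -/
def objICR (ω : E.Ω) (θ : E.Coef) : ℝ :=
  E.fit f ω θ + E.groupPen pen lam1 θ + E.fusionPen pen lam2 θ

/-- The cluster-oracle objective function, to be considered over `clusterSpace`. -/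
def objOracle (ω : E.Ω) (θ : E.Coef) : ℝ :=
  E.fit f ω θ + E.groupPen pen lam1 θ

/-- Coefficient matrices that are constant on every true cluster. -/
def clusterSpace : Set E.Coef :=
  {θ | ∀ k k', E.cluster k = E.cluster k' → E.column θ k = E.column θ k'}

/-- All rows of unimportant covariates vanish. -/
def ZeroOffActive (θ : E.Coef) : Prop := ∀ j : Fin E.p, E.q ≤ (j : ℕ) → θ j = 0

/-- `θ` is the unique minimizer of the unpenalized lack of fit when both the clusters and the
important covariates are known. -/
def IsOracleFit (ω : E.Ω) (θ : E.Coef) : Prop :=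
  (θ ∈ E.clusterSpace ∧ E.ZeroOffActive θ) ∧
    ∀ θ' ∈ E.clusterSpace, E.ZeroOffActive θ' → θ' ≠ θ → E.fit f ω θ < E.fit f ω θ'

/-- The rows of the important covariates. -/
def actRows (θ : E.Coef) : Matrix E.Act (Fin E.K) ℝ := θ.submatrix Subtype.val id

def r1 : ℝ :=
  Real.sqrt (((E.K : ℝ) / E.Gmin) * E.q / E.Nmin)
    + (E.Gmax : ℝ) * Real.sqrt E.M * (E.q : ℝ) ^ (3 / 2 : ℝ) * Real.log E.p / E.Nmin

def r2 : ℝ :=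
  Real.sqrt (((E.Gmax : ℝ) / E.Gmin) * E.M * Real.log E.p / (E.K * E.N))
    + ((E.Gmax : ℝ) / Real.sqrt E.Gmin) * Real.sqrt E.M * E.q * Real.log E.p / E.N

/-- The rate of the local estimators. -/
def localRate : ℝ := Real.sqrt (E.q * Real.log E.p / E.nstar)

end Experiment

/-! ### Sequences of experiments -/

/-- The event `P n` has probability tending to one (the complement has outer measure tending to
zero, so that no measurability is presupposed). -/
def WithProbTendingToOne (S : ℕ → Experiment.{u}) (P : ∀ n, (S n).Ω → Prop) : Prop :=
  Tendsto (fun n => (S n).μ {ω | ¬ P n ω}) atTop (𝓝 0)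

/-- `X n = O_p(a n)`. -/
def IsBigOInProb (S : ℕ → Experiment.{u}) (X : ∀ n, (S n).Ω → ℝ) (a : ℕ → ℝ) : Prop :=
  ∀ ε : ℝ, 0 < ε → ∃ C : ℝ, 0 < C ∧
    ∀ᶠ n in atTop, (S n).μ {ω | C * a n < |X n ω|} ≤ ENNReal.ofReal ε

/-- `n_k ≍ N / K`, uniformly in `k`. -/
def BalancedSizes (S : ℕ → Experiment.{u}) : Prop :=
  ∃ c C : ℝ, 0 < c ∧ 0 < C ∧ ∀ n k,
    c * (S n).nstar ≤ (S n).size k ∧ ((S n).size k : ℝ) ≤ C * (S n).nstar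

/-- The observations of every client are i.i.d., and all observations of all clients are
independent. -/
def IndependentClients (S : ℕ → Experiment.{u}) : Prop :=
  ∀ n,
    iIndepFun (fun (s : Σ k : Fin (S n).K, Fin ((S n).size k)) ω =>
      ((S n).x s.1 s.2 ω, (S n).y s.1 s.2 ω)) (S n).μ ∧
    ∀ k i i', IdentDistrib (fun ω => ((S n).x k i ω, (S n).y k i ω))
      (fun ω => ((S n).x k i' ω, (S n).y k i' ω)) (S n).μ (S n).μ

/-- Uniformly bounded covariates with uniformly bounded second moments in all directions. -/
def BoundedDesign (S : ℕ → Experiment.{u}) : Prop :=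
  ∃ Cx : ℝ, 0 < Cx ∧ ∀ n k i,
    (∀ᵐ ω ∂(S n).μ, ∀ j, |(S n).x k i ω j| ≤ Cx) ∧
    ∀ v : Fin (S n).p → ℝ, l2 v ≤ 1 → ∫ ω, (v ⬝ᵥ (S n).x k i ω) ^ 2 ∂(S n).μ ≤ Cx

/-- `θstar` consists of the true coefficients: it solves the population score equations. -/
def TrueCoefficients (S : ℕ → Experiment.{u}) (f : ℝ → ℝ → ℝ) : Prop :=
  ∀ n k i j, ∫ ω, lossD1 f ((S n).x k i ω ⬝ᵥ (S n).column (S n).θstar k) ((S n).y k i ω)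
    * (S n).x k i ω j ∂(S n).μ = 0

/-- Uniformly sub-Gaussian first derivatives at the truth. -/
def SubGaussianScore (S : ℕ → Experiment.{u}) (f : ℝ → ℝ → ℝ) : Prop :=
  ∃ κ : ℝ, 0 < κ ∧ ∀ n k i,
    subGaussianNorm (fun ω =>
      lossD1 f ((S n).x k i ω ⬝ᵥ (S n).column (S n).θstar k) ((S n).y k i ω)) (S n).μ
      ≤ ENNReal.ofReal κ

/-- The eigenvalues of the expected Hessians on the important covariates lie between two positive
constants. -/
def BoundedEigenvalues (S : ℕ → Experiment.{u}) (f : ℝ → ℝ → ℝ) : Prop :=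
  ∃ Cmin Cmax : ℝ, 0 < Cmin ∧ ∀ n k,
    ((S n).EVAA f k - Cmin • (1 : Matrix (S n).Act (S n).Act ℝ)).PosSemidef ∧
    (Cmax • (1 : Matrix (S n).Act (S n).Act ℝ) - (S n).EVAA f k).PosSemidef

/-- Second derivatives of the loss are bounded near the truth, and Lipschitz. -/
def SmoothLoss (S : ℕ → Experiment.{u}) (f : ℝ → ℝ → ℝ) : Prop :=
  (∀ δ : ℕ → ℝ, (∀ n, 0 ≤ δ n) → Tendsto δ atTop (𝓝 0) → ∃ CL : ℝ, 0 < CL ∧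
    ∀ᶠ n in atTop, ∀ k i, ∀ᵐ ω ∂(S n).μ, ∀ b : Fin (S n).p → ℝ,
      l2 (b - (S n).column (S n).θstar k) ≤ δ n →
      |lossD2 f ((S n).x k i ω ⬝ᵥ b) ((S n).y k i ω)| ≤ CL) ∧
  ∃ CL : ℝ, 0 < CL ∧ ∀ a b y : ℝ, |lossD2 f a y - lossD2 f b y| ≤ CL * |a - b|

/-- Estimation and prediction error rates of the local estimators. -/
def LocalEstimatorRates (S : ℕ → Experiment.{u}) : Prop :=
  IsBigOInProb S (fun n ω => ⨆ k, l2 ((S n).θlocal k ω - (S n).column (S n).θstar k))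
    (fun n => (S n).localRate) ∧
  IsBigOInProb S (fun n ω => ⨆ k, (1 / Real.sqrt ((S n).size k)) *
      l2 (fun i => (S n).x k i ω ⬝ᵥ ((S n).θlocal k ω - (S n).column (S n).θstar k)))
    (fun n => (S n).localRate)

/-- Growth conditions; as `K ≥ 1` and `q ≥ 1` they force `p → ∞` and `N → ∞`. -/
def GrowthConditions (S : ℕ → Experiment.{u}) : Prop :=
  (fun n => (((S n).Gmax : ℝ) / (S n).Gmin) ^ 2 * ((S n).q : ℝ) ^ 4 * Real.log (S n).p)
    =o[atTop] (fun n => (S n).nstar) ∧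
  (fun n => ((S n).K : ℝ)) =o[atTop] (fun n => ((S n).p : ℝ))

end

/-! The estimator is explicit. In each cluster, `oracleCoef` solves the normal equations of the
pooled quadratic surrogate restricted to the important covariates. The resulting matrix `oracle`
serves both as θ̂ᵒʳ and as θ̂, so their equality is immediate; what has to be shown is that, outside
events of small probability, this matrix is close to the truth and is a strictly local minimizer of
the penalized objectives.

Local minimality is deterministic. Around the oracle `fit` is exactly quadratic. Important rows and
differences between clusters lie strictly inside the flat region of the penalties, so those terms
are locally constant. At a vanishing row, or a vanishing difference within a cluster, the penalty
has a kink of slope λ, and it suffices that this slope beats the gradient of `fit`. For unimportant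
rows this means a row gradient below λ₁. For important rows the normal equations make the gradient
sum to zero over every cluster, so that it only sees differences within clusters, and a client
gradient below λ₂/2 is enough. The remaining directions are handled by definiteness of the Hessians
on the important covariates. These requirements form `OracleConditions`, and
`isStrictLocalMin_objICR` is the conclusion.

To verify them, note that the surrogate gradient at the truth is the score at the truth up to the
mean squared prediction error of the local estimator (`abs_surrogateGrad_sub_le`), and that the
Hessian at the local estimator is close, as a form on important vectors, to the Hessian at the truth
(`abs_form_sub_le`). Both comparisons hold pointwise in ω, so the dependence of the local estimators
on the data does no harm. Testing the normal equations against the error bounds it by the pooled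
score plus the linearization remainder. Summed over clients, the first term of `r1` pays for the
score and the second for the remainder. The same Hessian bounds control the gradients at the oracle
by the rate and √(log p / N), which the penalty levels dominate (`Controlled.oracleConditions`).

The randomness is confined to `GoodEvent`. Hessian entries and scores at the truth are sums of
independent bounded or sub-Gaussian variables, handled by exponential tails and unions over
polynomially many (in p) indices. Squared norms of scores are instead handled by second moments and
Markov's inequality, so that no factor log p is lost in the leading term of the rate. -/

noncomputable section

/-! ### The Euclidean norm of a family -/

section EuclideanNorm

variable {ι κ : Type*} [Fintype ι] [Fintype κ]

lemma l2_eq_sqrt (v : ι → ℝ) : l2 v = Real.sqrt (∑ i, v i ^ 2) := by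
  simp [l2, EuclideanSpace.norm_eq]

lemma l2_nonneg (v : ι → ℝ) : 0 ≤ l2 v := norm_nonneg _

lemma l2_sq (v : ι → ℝ) : l2 v ^ 2 = ∑ i, v i ^ 2 := by
  rw [l2_eq_sqrt, Real.sq_sqrt (Finset.sum_nonneg fun i _ => sq_nonneg _)]

@[simp] lemma l2_zero : l2 (0 : ι → ℝ) = 0 := by simp [l2]

lemma l2_eq_zero_iff {v : ι → ℝ} : l2 v = 0 ↔ v = 0 := by
  simp [l2, norm_eq_zero]

lemma l2_add_le (v w : ι → ℝ) : l2 (v + w) ≤ l2 v + l2 w := norm_add_le _ _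

lemma l2_neg (v : ι → ℝ) : l2 (-v) = l2 v := norm_neg (WithLp.toLp 2 v : EuclideanSpace ℝ ι)

lemma l2_sub_le (v w : ι → ℝ) : l2 (v - w) ≤ l2 v + l2 w := norm_sub_le _ _

lemma l2_sub_comm (v w : ι → ℝ) : l2 (v - w) = l2 (w - v) := by
  rw [← l2_neg, neg_sub]

lemma l2_smul (c : ℝ) (v : ι → ℝ) : l2 (c • v) = |c| * l2 v := by
  simp [l2, WithLp.toLp_smul, norm_smul]

lemma continuous_l2 : Continuous (l2 : (ι → ℝ) → ℝ) :=
  continuous_norm.comp (PiLp.continuous_toLp 2 fun _ : ι => ℝ)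

lemma abs_dotProduct_le_l2 (v w : ι → ℝ) : |v ⬝ᵥ w| ≤ l2 v * l2 w := by
  rw [← abs_of_nonneg (mul_nonneg (l2_nonneg v) (l2_nonneg w)), ← sq_le_sq, mul_pow, l2_sq, l2_sq]
  exact Finset.sum_mul_sq_le_sq_mul_sq _ _ _

lemma l2_le_of_sq_le {v : ι → ℝ} {c : ℝ} (hc : 0 ≤ c) (h : ∑ i, v i ^ 2 ≤ c ^ 2) : l2 v ≤ c := by
  rw [← l2_sq] at h
  exact abs_le_of_sq_le_sq' h hc |>.2

lemma abs_apply_le_l2 (v : ι → ℝ) (i : ι) : |v i| ≤ l2 v := by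
  have := PiLp.norm_apply_le (WithLp.toLp 2 v : EuclideanSpace ℝ ι) i
  simpa [l2] using this

lemma sum_subtype_eq_ite {M : Type*} [AddCommMonoid M] (P : ι → Prop) [DecidablePred P]
    (g : ι → M) : ∑ i : {i // P i}, g i = ∑ i, if P i then g i else 0 := by
  rw [← Finset.sum_filter]
  exact (Finset.sum_subtype _ (by simp) g).symm

lemma l2_subtype_le (P : ι → Prop) [DecidablePred P] (v : ι → ℝ) :
    l2 (fun i : {i // P i} => v i) ≤ l2 v := by
  refine l2_le_of_sq_le (l2_nonneg v) ?_
  rw [l2_sq, sum_subtype_eq_ite P (fun i => v i ^ 2)]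
  refine Finset.sum_le_sum fun i _ => ?_
  split_ifs
  · exact le_rfl
  · positivity

end EuclideanNorm

/-- The fusion penalty runs over unordered pairs, whereas gradients are charged client by client;
passing to ordered pairs gives each client its own term in every pair. -/
lemma sum_sum_eq_sum_lt {n : ℕ} (F : Fin n → Fin n → ℝ) (hF : ∀ k, F k k = 0) :
    ∑ k, ∑ k', F k k' = ∑ k, ∑ k' ∈ Finset.univ.filter (fun k' => k < k'), (F k k' + F k' k) := by
  simp only [Finset.sum_filter]
  have h : ∀ k k', F k k' = (if k < k' then F k k' else 0) + if k' < k then F k k' else 0 := by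
    intro k k'
    rcases lt_trichotomy k k' with hk | rfl | hk
    · simp [hk, hk.not_gt]
    · simp [hF]
    · simp [hk, hk.not_gt]
  calc ∑ k, ∑ k', F k k'
      = ∑ k, ∑ k', (if k < k' then F k k' else 0) + ∑ k, ∑ k', if k' < k then F k k' else 0 := by
        simp only [← Finset.sum_add_distrib, ← h]
    _ = ∑ k, ∑ k', (if k < k' then F k k' else 0) + ∑ k, ∑ k', if k < k' then F k' k else 0 := by
        congr 1
        rw [Finset.sum_comm]
    _ = _ := by
        simp only [← Finset.sum_add_distrib]
        refine Finset.sum_congr rfl fun k _ => Finset.sum_congr rfl fun k' _ => ?_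
        split_ifs <;> simp


/-! ### Concave penalties -/

/-- The kink at zero: the right derivative there is λ > a, so the secant slopes from the origin
eventually exceed a. -/
lemma IsConcavePenalty.eventually_mul_le {τ : ℝ} {pen : ℝ → ℝ → ℝ} (hpen : IsConcavePenalty τ pen)
    {lam a : ℝ} (hlam : 0 < lam) (ha : a < lam) : ∀ᶠ t in 𝓝[≥] (0 : ℝ), a * t ≤ pen t lam := by
  have h := hasDerivWithinAt_iff_tendsto_slope.1 (hpen.slope lam hlam)
  have h1 := h.eventually (lt_mem_nhds ha)
  rw [eventually_nhdsWithin_iff] at h1 ⊢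
  filter_upwards [h1] with t ht ht0
  rcases eq_or_lt_of_le (Set.mem_Ici.1 ht0) with rfl | hpos
  · simp [hpen.zero lam hlam]
  · have := ht ⟨ht0, by simpa using hpos.ne'⟩
    rw [slope_def_field, hpen.zero lam hlam, sub_zero, sub_zero, lt_div_iff₀ hpos] at this
    exact this.le

lemma IsConcavePenalty.eq_of_lt {τ : ℝ} {pen : ℝ → ℝ → ℝ} (hpen : IsConcavePenalty τ pen)
    {lam s t : ℝ} (hlam : 0 < lam) (hs : τ * lam < s) (ht : τ * lam < t) :
    pen s lam = pen t lam := by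
  rw [hpen.flat lam hlam s hs.le, hpen.flat lam hlam t ht.le]

/-! ### Local minimality of the oracle -/

namespace Experiment

variable (E : Experiment.{u}) (f : ℝ → ℝ → ℝ) (pen : ℝ → ℝ → ℝ) (lam1 lam2 : ℝ)

/-- The part of a vector supported on the important covariates. -/
def actPart (v : Fin E.p → ℝ) : Fin E.p → ℝ := fun j => if (j : ℕ) < E.q then v j else 0

/-- The gradient of `fit`. -/
def fitGrad (ω : E.Ω) (θ : E.Coef) : E.Coef := fun j k =>
  2 * (E.size k : ℝ) / E.N * ((E.Vlocal f k ω *ᵥ E.column θ k) j - E.ζlocal f k ω j)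

/-- The coefficients of the unimportant covariates in the second-order part of `fit`. -/
def crossTerm (ω : E.Ω) (Δ : E.Coef) : E.Coef := fun j k =>
  (E.size k : ℝ) / E.N * (E.Vlocal f k ω *ᵥ (E.column Δ k + E.actPart (E.column Δ k))) j

variable {E f pen lam1 lam2}

lemma continuous_column (k : Fin E.K) : Continuous fun θ : E.Coef => E.column θ k :=
  continuous_pi fun j => continuous_apply_apply j k

lemma continuous_actPart : Continuous E.actPart := by
  refine continuous_pi fun j => ?_
  unfold actPart
  split_ifs
  · exact continuous_apply j
  · exact continuous_const

lemma continuous_crossTerm (ω : E.Ω) (j : Fin E.p) :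
    Continuous fun Δ : E.Coef => E.crossTerm f ω Δ j := by
  refine continuous_pi fun k => ?_
  unfold crossTerm
  refine continuous_const.mul ?_
  have : Continuous fun Δ : E.Coef => E.column Δ k + E.actPart (E.column Δ k) :=
    (continuous_column k).add (continuous_actPart.comp (continuous_column k))
  exact (continuous_apply j).comp (continuous_const.matrix_mulVec this)

lemma crossTerm_zero (ω : E.Ω) (j : Fin E.p) : E.crossTerm f ω 0 j = 0 := by
  ext k
  have h1 : E.column (0 : E.Coef) k = 0 := rfl
  have h2 : E.actPart (0 : Fin E.p → ℝ) = 0 := by ext j; simp [actPart]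
  simp [crossTerm, h1, h2]

/-- For symmetric W and a the important part of v, vᵀWv − aᵀWa = (v − a)ᵀW(v + a), and v − a lives
on the unimportant rows. All second-order terms touching those rows thus become a small perturbation
of their gradient, which the kink absorbs; no definiteness outside the important block is needed. -/
lemma dotProduct_quad_split (W : Matrix (Fin E.p) (Fin E.p) ℝ) (hW : Wᵀ = W) (v : Fin E.p → ℝ) :
    v ⬝ᵥ (W *ᵥ v) = E.actPart v ⬝ᵥ (W *ᵥ E.actPart v)
      + ∑ j : Fin E.p, if (j : ℕ) < E.q then 0 else v j * (W *ᵥ (v + E.actPart v)) j := by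
  set a := E.actPart v with ha
  have hsum : (∑ j : Fin E.p, if (j : ℕ) < E.q then 0 else v j * (W *ᵥ (v + a)) j)
      = (v - a) ⬝ᵥ (W *ᵥ (v + a)) := by
    refine Finset.sum_congr rfl fun j _ => ?_
    simp only [ha, actPart, Pi.sub_apply]
    split_ifs <;> simp
  have hsymm : a ⬝ᵥ (W *ᵥ v) = v ⬝ᵥ (W *ᵥ a) := by
    rw [Matrix.dotProduct_mulVec, ← Matrix.mulVec_transpose, hW, dotProduct_comm]
  rw [hsum, Matrix.mulVec_add, sub_dotProduct, dotProduct_add, dotProduct_add, hsymm]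
  ring

lemma fit_expand {ω : E.Ω} (hW : ∀ k, (E.Vlocal f k ω)ᵀ = E.Vlocal f k ω) (θ₀ Δ : E.Coef) :
    E.fit f ω (θ₀ + Δ) = E.fit f ω θ₀ + ∑ k, ∑ j, E.fitGrad f ω θ₀ j k * Δ j k
      + ∑ k, (E.size k : ℝ) / E.N * (E.column Δ k ⬝ᵥ (E.Vlocal f k ω *ᵥ E.column Δ k)) := by
  unfold fit
  rw [Finset.mul_sum, Finset.mul_sum, ← Finset.sum_add_distrib, ← Finset.sum_add_distrib]
  refine Finset.sum_congr rfl fun k _ => ?_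
  have hc : E.column (θ₀ + Δ) k = E.column θ₀ k + E.column Δ k := rfl
  have hg : ∑ j, E.fitGrad f ω θ₀ j k * Δ j k = 2 * (E.size k : ℝ) / E.N *
      (E.column Δ k ⬝ᵥ (E.Vlocal f k ω *ᵥ E.column θ₀ k) - E.column Δ k ⬝ᵥ E.ζlocal f k ω) := by
    rw [← dotProduct_sub, dotProduct, Finset.mul_sum]
    refine Finset.sum_congr rfl fun j _ => ?_
    simp only [fitGrad, column, Pi.sub_apply]
    ring
  have hsymm : E.column θ₀ k ⬝ᵥ (E.Vlocal f k ω *ᵥ E.column Δ k)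
      = E.column Δ k ⬝ᵥ (E.Vlocal f k ω *ᵥ E.column θ₀ k) := by
    rw [Matrix.dotProduct_mulVec, ← Matrix.mulVec_transpose, hW, dotProduct_comm]
  rw [hg, hc, Matrix.mulVec_add, add_dotProduct, add_dotProduct, dotProduct_add, dotProduct_add,
    hsymm]
  ring

/-- First- and second-order behaviour of `fit`, separated into important and unimportant rows. -/
lemma fit_expand_split {ω : E.Ω} (hW : ∀ k, (E.Vlocal f k ω)ᵀ = E.Vlocal f k ω) (θ₀ Δ : E.Coef) :
    E.fit f ω (θ₀ + Δ) = E.fit f ω θ₀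
      + ∑ k, (E.size k : ℝ) / E.N * (E.actPart (E.column Δ k) ⬝ᵥ
          (E.Vlocal f k ω *ᵥ E.actPart (E.column Δ k)))
      + ∑ k, (fun j : E.Act => E.fitGrad f ω θ₀ j k) ⬝ᵥ (fun j : E.Act => Δ j k)
      + ∑ j : Fin E.p, (if (j : ℕ) < E.q then 0 else
          (E.fitGrad f ω θ₀ j + E.crossTerm f ω Δ j) ⬝ᵥ Δ j) := by
  rw [fit_expand hW]
  have h1 : ∀ k, (fun j : E.Act => E.fitGrad f ω θ₀ j k) ⬝ᵥ (fun j : E.Act => Δ j k)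
      = ∑ j : Fin E.p, if (j : ℕ) < E.q then E.fitGrad f ω θ₀ j k * Δ j k else 0 := fun k =>
    sum_subtype_eq_ite (fun j : Fin E.p => (j : ℕ) < E.q)
      (fun j => E.fitGrad f ω θ₀ j k * Δ j k)
  have h2 : (∑ j : Fin E.p, (if (j : ℕ) < E.q then 0 else
          (E.fitGrad f ω θ₀ j + E.crossTerm f ω Δ j) ⬝ᵥ Δ j))
      = ∑ k, ∑ j : Fin E.p, (if (j : ℕ) < E.q then 0 else
          (E.fitGrad f ω θ₀ j k + E.crossTerm f ω Δ j k) * Δ j k) := by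
    rw [Finset.sum_comm]
    refine Finset.sum_congr rfl fun j _ => ?_
    split_ifs
    · simp
    · rfl
  rw [h2, add_assoc, add_assoc, add_assoc, ← Finset.sum_add_distrib, ← Finset.sum_add_distrib,
    ← Finset.sum_add_distrib]
  congr 1
  refine Finset.sum_congr rfl fun k _ => ?_
  rw [h1, dotProduct_quad_split _ (hW k), mul_add, Finset.mul_sum, add_left_comm,
    ← Finset.sum_add_distrib, ← Finset.sum_add_distrib]
  congr 1
  refine Finset.sum_congr rfl fun j _ => ?_
  split_ifs
  · ring
  · simp only [crossTerm, column]
    ring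

variable (E f) in
/-- The deterministic properties of the lack of fit and its minimizer that make `θ₀` the oracle
estimator and a local minimizer of the penalized objectives. -/
structure OracleConditions (τ lam1 lam2 : ℝ) (ω : E.Ω) (θ₀ : E.Coef) : Prop where
  size_pos : ∀ k, 0 < E.size k
  symm : ∀ k, (E.Vlocal f k ω)ᵀ = E.Vlocal f k ω
  posDef : ∀ k, ∀ v : Fin E.p → ℝ, E.actPart v ≠ 0 →
    0 < E.actPart v ⬝ᵥ (E.Vlocal f k ω *ᵥ E.actPart v)
  mem : θ₀ ∈ E.clusterSpace
  zeroOff : E.ZeroOffActive θ₀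
  normal : ∀ m, ∀ j : Fin E.p, (j : ℕ) < E.q →
    ∑ k, (if E.cluster k = m then E.fitGrad f ω θ₀ j k else 0) = 0
  grad_off : ∀ j : Fin E.p, ¬ (j : ℕ) < E.q → l2 (E.fitGrad f ω θ₀ j) < lam1
  grad_act : ∀ k, 2 * l2 (fun j : E.Act => E.fitGrad f ω θ₀ j k) < lam2
  signal : ∀ j : Fin E.p, (j : ℕ) < E.q → τ * lam1 < l2 (θ₀ j)
  separation : ∀ k k', E.cluster k ≠ E.cluster k' →
    τ * lam2 < l2 (E.column θ₀ k - E.column θ₀ k')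

namespace OracleConditions

variable {τ : ℝ} {ω : E.Ω} {θ₀ : E.Coef}

lemma N_pos (h : E.OracleConditions f τ lam1 lam2 ω θ₀) : 0 < E.N :=
  lt_of_lt_of_le (h.size_pos ⟨0, E.K_pos⟩)
    (Finset.single_le_sum (f := E.size) (fun _ _ => Nat.zero_le _) (Finset.mem_univ _))

lemma quad_nonneg (h : E.OracleConditions f τ lam1 lam2 ω θ₀) (v : Fin E.p → ℝ) (k : Fin E.K) :
    0 ≤ (E.size k : ℝ) / E.N * (E.actPart v ⬝ᵥ (E.Vlocal f k ω *ᵥ E.actPart v)) := by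
  refine mul_nonneg (by positivity) ?_
  by_cases hv : E.actPart v = 0
  · simp [hv]
  · exact (h.posDef k v hv).le

lemma quad_pos (h : E.OracleConditions f τ lam1 lam2 ω θ₀) {v : Fin E.p → ℝ}
    (hv : E.actPart v ≠ 0) (k : Fin E.K) :
    0 < (E.size k : ℝ) / E.N * (E.actPart v ⬝ᵥ (E.Vlocal f k ω *ᵥ E.actPart v)) := by
  have h1 : (0 : ℝ) < E.size k := by exact_mod_cast h.size_pos k
  have h2 : (0 : ℝ) < E.N := by exact_mod_cast h.N_pos
  exact mul_pos (div_pos h1 h2) (h.posDef k v hv)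

lemma sum_quad_pos (h : E.OracleConditions f τ lam1 lam2 ω θ₀) {Δ : E.Coef}
    (hΔ : ∃ (j : Fin E.p) (k : Fin E.K), (j : ℕ) < E.q ∧ Δ j k ≠ 0) :
    0 < ∑ k, (E.size k : ℝ) / E.N * (E.actPart (E.column Δ k) ⬝ᵥ
          (E.Vlocal f k ω *ᵥ E.actPart (E.column Δ k))) := by
  obtain ⟨j, k, hj, hjk⟩ := hΔ
  refine Finset.sum_pos' (fun k _ => h.quad_nonneg _ k) ⟨k, Finset.mem_univ _, h.quad_pos ?_ k⟩
  intro h0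
  have := congrFun h0 j
  simp only [actPart, hj, if_true, Pi.zero_apply] at this
  exact hjk this

/-- The linear term vanishes on differences from cluster representatives. -/
lemma sum_linear_eq (h : E.OracleConditions f τ lam1 lam2 ω θ₀) (Δ : E.Coef)
    (rep : Fin E.M → Fin E.K) :
    ∑ k, (fun j : E.Act => E.fitGrad f ω θ₀ j k) ⬝ᵥ (fun j : E.Act => Δ j k)
      = ∑ k, (fun j : E.Act => E.fitGrad f ω θ₀ j k) ⬝ᵥ
        (fun j : E.Act => Δ j k - Δ j (rep (E.cluster k))) := by
  -- Values at representatives depend on the cluster only, so they factor out of each cluster sum,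
  -- which the normal equations annihilate.
  have h0 : ∑ k, (fun j : E.Act => E.fitGrad f ω θ₀ j k) ⬝ᵥ
        (fun j : E.Act => Δ j (rep (E.cluster k))) = 0 := by
    simp only [dotProduct]
    rw [Finset.sum_comm]
    refine Finset.sum_eq_zero fun j _ => ?_
    have h1 : ∀ k, E.fitGrad f ω θ₀ j k * Δ j (rep (E.cluster k))
        = ∑ m, (if E.cluster k = m then E.fitGrad f ω θ₀ j k else 0) * Δ j (rep m) := by
      intro k
      simp
    simp only [h1]
    rw [Finset.sum_comm]
    refine Finset.sum_eq_zero fun m _ => ?_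
    rw [← Finset.sum_mul, h.normal m j j.2, zero_mul]
  rw [← sub_eq_zero, ← Finset.sum_sub_distrib]
  rw [← h0]
  refine Finset.sum_congr rfl fun k _ => ?_
  rw [← dotProduct_sub]
  congr 1
  ext j
  simp

lemma isOracleFit (h : E.OracleConditions f τ lam1 lam2 ω θ₀) : E.IsOracleFit f ω θ₀ := by
  refine ⟨⟨h.mem, h.zeroOff⟩, fun θ hθ hθ0 hne => ?_⟩
  obtain ⟨Δ, rfl⟩ : ∃ Δ, θ = θ₀ + Δ := ⟨θ - θ₀, by simp⟩
  have hoff : ∀ j : Fin E.p, ¬ (j : ℕ) < E.q → Δ j = 0 := fun j hj => by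
    have h1 := hθ0 j (not_lt.1 hj)
    have h2 := h.zeroOff j (not_lt.1 hj)
    have h3 : θ₀ j + Δ j = 0 := h1
    rwa [h2, zero_add] at h3
  have hconst : ∀ k k', E.cluster k = E.cluster k' → ∀ j, Δ j k = Δ j k' := by
    intro k k' hk j
    have h1 := congrFun (hθ k k' hk) j
    have h2 := congrFun (h.mem k k' hk) j
    have h3 : θ₀ j k + Δ j k = θ₀ j k' + Δ j k' := h1
    have h4 : θ₀ j k = θ₀ j k' := h2
    linarith
  rw [fit_expand_split h.symm]
  have hrep := Function.rightInverse_surjInv E.cluster_surj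
  rw [h.sum_linear_eq Δ (Function.surjInv E.cluster_surj)]
  have h1 : ∑ k, (fun j : E.Act => E.fitGrad f ω θ₀ j k) ⬝ᵥ
      (fun j : E.Act => Δ j k - Δ j (Function.surjInv E.cluster_surj (E.cluster k))) = 0 := by
    refine Finset.sum_eq_zero fun k _ => ?_
    have : (fun j : E.Act => Δ j k - Δ j (Function.surjInv E.cluster_surj (E.cluster k))) = 0 := by
      ext j
      rw [hconst k _ (hrep (E.cluster k)).symm]
      simp
    rw [this, dotProduct_zero]
  have h2 : (∑ j : Fin E.p, (if (j : ℕ) < E.q then 0 else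
          (E.fitGrad f ω θ₀ j + E.crossTerm f ω Δ j) ⬝ᵥ Δ j)) = 0 := by
    refine Finset.sum_eq_zero fun j _ => ?_
    split_ifs with hj
    · rfl
    · rw [hoff j hj, dotProduct_zero]
  rw [h1, h2, add_zero, add_zero]
  refine lt_add_of_pos_right _ (h.sum_quad_pos ?_)
  by_contra! hcon
  refine hne (by
    have : Δ = 0 := by
      ext j k
      by_cases hj : (j : ℕ) < E.q
      · exact hcon j k hj
      · rw [hoff j hj]; rfl
    simp [this])

/-- Near `θ₀` the group penalty grows at least linearly in the unimportant rows. -/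
lemma eventually_groupPen_ge (h : E.OracleConditions f τ lam1 lam2 ω θ₀)
    (hpen : IsConcavePenalty τ pen) (hlam1 : 0 < lam1) (a : Fin E.p → ℝ)
    (ha : ∀ j : Fin E.p, ¬ (j : ℕ) < E.q → a j < lam1) :
    ∀ᶠ θ in 𝓝 θ₀, E.groupPen pen lam1 θ₀
      + ∑ j : Fin E.p, (if (j : ℕ) < E.q then 0 else a j * l2 (θ j)) ≤ E.groupPen pen lam1 θ := by
  have hcont : ∀ j : Fin E.p, Continuous fun θ : E.Coef => l2 (θ j) := fun j =>
    continuous_l2.comp (continuous_apply j)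
  have h1 : ∀ᶠ θ in 𝓝 θ₀, ∀ j : Fin E.p, (j : ℕ) < E.q → τ * lam1 < l2 (θ j) := by
    rw [eventually_all]
    intro j
    by_cases hj : (j : ℕ) < E.q
    · filter_upwards [(hcont j).continuousAt.eventually (lt_mem_nhds (h.signal j hj))] with θ hθ _
      exact hθ
    · simp [hj]
  have h2 : ∀ᶠ θ in 𝓝 θ₀, ∀ j : Fin E.p, ¬ (j : ℕ) < E.q →
      a j * l2 (θ j) ≤ pen (l2 (θ j)) lam1 := by
    rw [eventually_all]
    intro j
    by_cases hj : (j : ℕ) < E.q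
    · simp [hj]
    · have ht : Tendsto (fun θ : E.Coef => l2 (θ j)) (𝓝 θ₀) (𝓝[≥] 0) := by
        refine tendsto_nhdsWithin_iff.2 ⟨?_, Eventually.of_forall fun θ => l2_nonneg _⟩
        have := (hcont j).tendsto θ₀
        rwa [h.zeroOff j (not_lt.1 hj), l2_zero] at this
      filter_upwards [ht.eventually (hpen.eventually_mul_le hlam1 (ha j hj))] with θ hθ _
      exact hθ
  filter_upwards [h1, h2] with θ hθ1 hθ2
  have hsum : (∑ j : Fin E.p, (if (j : ℕ) < E.q then 0 else a j * l2 (θ j)))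
      = ∑ j ∈ Finset.univ.filter (fun j : Fin E.p => (j : ℕ) ≠ 0),
        (if (j : ℕ) < E.q then 0 else a j * l2 (θ j)) := by
    symm
    refine Finset.sum_subset (Finset.subset_univ _) fun j _ hj => ?_
    -- The only unpenalized row is the intercept; it is important because q > 0, so its summand is
    -- zero anyway.
    have hj0 : (j : ℕ) = 0 := by simpa using hj
    rw [if_pos (hj0 ▸ E.q_pos)]
  unfold groupPen
  rw [hsum, ← Finset.sum_add_distrib]
  refine Finset.sum_le_sum fun j _ => ?_
  split_ifs with hj
  · rw [add_zero, hpen.eq_of_lt hlam1 (h.signal j hj) (hθ1 j hj)]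
  · rw [h.zeroOff j (not_lt.1 hj), l2_zero, hpen.zero lam1 hlam1, zero_add]
    exact hθ2 j hj

/-- Near `θ₀` the fusion penalty grows at least linearly in the differences within clusters. -/
lemma eventually_fusionPen_ge (h : E.OracleConditions f τ lam1 lam2 ω θ₀)
    (hpen : IsConcavePenalty τ pen) (hlam2 : 0 < lam2) (b : Fin E.K → Fin E.K → ℝ)
    (hb : ∀ k k', b k k' < lam2) :
    ∀ᶠ θ in 𝓝 θ₀, E.fusionPen pen lam2 θ₀
      + ∑ k, ∑ k' ∈ Finset.univ.filter (fun k' => k < k'), (if E.cluster k = E.cluster k' then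
          b k k' * l2 (E.column θ k - E.column θ k') else 0) ≤ E.fusionPen pen lam2 θ := by
  have hcont : ∀ k k', Continuous fun θ : E.Coef => l2 (E.column θ k - E.column θ k') :=
    fun k k' => continuous_l2.comp ((continuous_column k).sub (continuous_column k'))
  have h1 : ∀ᶠ θ in 𝓝 θ₀, ∀ k k', E.cluster k ≠ E.cluster k' →
      τ * lam2 < l2 (E.column θ k - E.column θ k') := by
    simp only [eventually_all]
    intro k k' hk
    exact (hcont k k').continuousAt.eventually (lt_mem_nhds (h.separation k k' hk))
  have h2 : ∀ᶠ θ in 𝓝 θ₀, ∀ k k', E.cluster k = E.cluster k' →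
      b k k' * l2 (E.column θ k - E.column θ k')
        ≤ pen (l2 (E.column θ k - E.column θ k')) lam2 := by
    simp only [eventually_all]
    intro k k' hk
    have ht : Tendsto (fun θ : E.Coef => l2 (E.column θ k - E.column θ k')) (𝓝 θ₀) (𝓝[≥] 0) := by
      refine tendsto_nhdsWithin_iff.2 ⟨?_, Eventually.of_forall fun θ => l2_nonneg _⟩
      have := (hcont k k').tendsto θ₀
      rwa [h.mem k k' hk, sub_self, l2_zero] at this
    exact ht.eventually (hpen.eventually_mul_le hlam2 (hb k k'))
  filter_upwards [h1, h2] with θ hθ1 hθ2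
  unfold fusionPen
  rw [← Finset.sum_add_distrib]
  refine Finset.sum_le_sum fun k _ => ?_
  rw [← Finset.sum_add_distrib]
  refine Finset.sum_le_sum fun k' _ => ?_
  split_ifs with hk
  · rw [h.mem k k' hk, sub_self, l2_zero, hpen.zero lam2 hlam2, zero_add]
    exact hθ2 k k' hk
  · rw [add_zero, hpen.eq_of_lt hlam2 (h.separation k k' hk) (hθ1 k k' hk)]

/-- Subtracting the representative of each cluster leaves the linear term unchanged, so by
Cauchy–Schwarz it is bounded by client gradients times differences within clusters, which is the
form in which the fusion penalty can absorb it. -/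
lemma sum_linear_ge (h : E.OracleConditions f τ lam1 lam2 ω θ₀) (θ : E.Coef) :
    -(∑ k, ∑ k' ∈ Finset.univ.filter (fun k' => k < k'), (if E.cluster k = E.cluster k' then
        (l2 (fun j : E.Act => E.fitGrad f ω θ₀ j k) + l2 (fun j : E.Act => E.fitGrad f ω θ₀ j k'))
          * l2 (E.column θ k - E.column θ k') else 0))
      ≤ ∑ k, (fun j : E.Act => E.fitGrad f ω θ₀ j k) ⬝ᵥ
          (fun j : E.Act => (θ - θ₀) j k) := by
  set b : Fin E.K → ℝ := fun k => l2 (fun j : E.Act => E.fitGrad f ω θ₀ j k) with hbdef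
  have hb : ∀ k, 0 ≤ b k := fun k => l2_nonneg _
  have hrep := Function.rightInverse_surjInv E.cluster_surj
  set rep := Function.surjInv E.cluster_surj
  rw [h.sum_linear_eq (θ - θ₀) rep]
  set F : Fin E.K → Fin E.K → ℝ := fun k k' => if E.cluster k = E.cluster k' then
    b k * l2 (E.column θ k - E.column θ k') else 0 with hF
  have hF0 : ∀ k k', 0 ≤ F k k' := fun k k' => by
    simp only [hF]
    split_ifs
    · exact mul_nonneg (hb k) (l2_nonneg _)
    · exact le_rfl
  have h1 : (∑ k, ∑ k' ∈ Finset.univ.filter (fun k' => k < k'), (if E.cluster k = E.cluster k' then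
        (b k + b k') * l2 (E.column θ k - E.column θ k') else 0)) = ∑ k, ∑ k', F k k' := by
    rw [sum_sum_eq_sum_lt F (fun k => by simp [hF])]
    refine Finset.sum_congr rfl fun k _ => Finset.sum_congr rfl fun k' _ => ?_
    simp only [hF]
    by_cases hk : E.cluster k = E.cluster k'
    · rw [if_pos hk, if_pos hk, if_pos hk.symm, l2_sub_comm (E.column θ k') (E.column θ k)]
      ring
    · rw [if_neg hk, if_neg hk, if_neg (Ne.symm hk), add_zero]
  rw [h1, ← Finset.sum_neg_distrib]
  refine Finset.sum_le_sum fun k _ => ?_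
  refine (abs_le.1 ((abs_dotProduct_le_l2 _ _).trans ?_)).1
  -- Among all pairs containing k, the pair with its representative already suffices.
  refine le_trans ?_ (Finset.single_le_sum (fun k' _ => hF0 k k')
    (Finset.mem_univ (rep (E.cluster k))))
  have hk : E.cluster k = E.cluster (rep (E.cluster k)) := (hrep (E.cluster k)).symm
  simp only [hF]
  rw [if_pos hk]
  refine mul_le_mul_of_nonneg_left ?_ (hb k)
  have h2 : (fun j : E.Act => (θ - θ₀) j k - (θ - θ₀) j (rep (E.cluster k)))
      = fun j : E.Act => (E.column θ k - E.column θ (rep (E.cluster k))) j := by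
    ext j
    have := congrFun (h.mem k _ hk) j
    have h3 : θ₀ j k = θ₀ j (rep (E.cluster k)) := this
    simp only [Matrix.sub_apply, Pi.sub_apply, column, h3]
    ring
  rw [h2]
  exact l2_subtype_le (fun j : Fin E.p => (j : ℕ) < E.q) _

/-- The oracle is a strictly local minimizer of the full objective. -/
theorem isStrictLocalMin_objICR (h : E.OracleConditions f τ lam1 lam2 ω θ₀)
    (hpen : IsConcavePenalty τ pen) (hlam1 : 0 < lam1) (hlam2 : 0 < lam2) :
    IsStrictLocalMinOver (E.objICR f pen lam1 lam2 ω) Set.univ θ₀ := by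
  refine ⟨Set.mem_univ _, ?_⟩
  set g : Fin E.p → ℝ := fun j => l2 (E.fitGrad f ω θ₀ j) with hg
  -- The gap between λ₁ and the gradient is split in three: one third keeps the penalty slope g + 2δ
  -- strictly below λ₁, one absorbs the cross term, and one is left over for strictness.
  set δ : Fin E.p → ℝ := fun j => (lam1 - g j) / 3 with hδ
  have hδpos : ∀ j : Fin E.p, ¬ (j : ℕ) < E.q → 0 < δ j := fun j hj => by
    have := h.grad_off j hj
    simp only [hδ]
    linarith
  set b : Fin E.K → ℝ := fun k => l2 (fun j : E.Act => E.fitGrad f ω θ₀ j k) with hb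
  have hgroup := h.eventually_groupPen_ge hpen hlam1 (fun j => g j + 2 * δ j) (fun j hj => by
    have := hδpos j hj
    simp only [hδ] at this ⊢
    linarith)
  have hfusion := h.eventually_fusionPen_ge hpen hlam2 (fun k k' => b k + b k') (fun k k' => by
    have h1 := h.grad_act k
    have h2 := h.grad_act k'
    simp only [hb]
    linarith)
  have hcross : ∀ᶠ θ in 𝓝 θ₀, ∀ j : Fin E.p, ¬ (j : ℕ) < E.q →
      l2 (E.crossTerm f ω (θ - θ₀) j) < δ j := by
    rw [eventually_all]
    intro j
    by_cases hj : (j : ℕ) < E.q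
    · simp [hj]
    · have hc : Continuous fun θ : E.Coef => l2 (E.crossTerm f ω (θ - θ₀) j) :=
        continuous_l2.comp ((continuous_crossTerm ω j).comp (continuous_id.sub continuous_const))
      have ht := hc.tendsto θ₀
      rw [sub_self, crossTerm_zero, l2_zero] at ht
      filter_upwards [ht.eventually (gt_mem_nhds (hδpos j hj))] with θ hθ _
      exact hθ
  rw [eventually_nhdsWithin_iff]
  filter_upwards [hgroup, hfusion, hcross] with θ h1 h2 h3 hθ
  have hne : θ ≠ θ₀ := hθ.2
  have hexp := fit_expand_split (f := f) (ω := ω) h.symm θ₀ (θ - θ₀)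
  rw [add_sub_cancel] at hexp
  have hlin := h.sum_linear_ge θ
  have hoff : ∀ j : Fin E.p, ¬ (j : ℕ) < E.q → (θ - θ₀) j = θ j := fun j hj => by
    have h4 := h.zeroOff j (not_lt.1 hj)
    have h5 : (θ - θ₀) j = θ j - θ₀ j := rfl
    rw [h5, h4, sub_zero]
  have hrow : ∑ j : Fin E.p, (if (j : ℕ) < E.q then 0 else δ j * l2 (θ j))
      ≤ (∑ j : Fin E.p, (if (j : ℕ) < E.q then 0 else
          (E.fitGrad f ω θ₀ j + E.crossTerm f ω (θ - θ₀) j) ⬝ᵥ (θ - θ₀) j))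
        + ∑ j : Fin E.p, (if (j : ℕ) < E.q then 0 else (g j + 2 * δ j) * l2 (θ j)) := by
    rw [← Finset.sum_add_distrib]
    refine Finset.sum_le_sum fun j _ => ?_
    split_ifs with hj
    · simp
    · have h4 := abs_le.1 (abs_dotProduct_le_l2
        (E.fitGrad f ω θ₀ j + E.crossTerm f ω (θ - θ₀) j) ((θ - θ₀) j))
      have h5 := l2_add_le (E.fitGrad f ω θ₀ j) (E.crossTerm f ω (θ - θ₀) j)
      have h6 := h3 j hj
      have h7 : l2 (E.fitGrad f ω θ₀ j + E.crossTerm f ω (θ - θ₀) j) * l2 ((θ - θ₀) j)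
          ≤ (g j + δ j) * l2 ((θ - θ₀) j) :=
        mul_le_mul_of_nonneg_right (by simp only [hg]; linarith) (l2_nonneg _)
      rw [hoff j hj] at h4 h7 ⊢
      linarith [h4.1]
  -- A change in an important row is detected by the definite form; if there is none, some
  -- unimportant row moves and the spare slope δ detects it.
  have hpos : 0 < ∑ k, (E.size k : ℝ) / E.N * (E.actPart (E.column (θ - θ₀) k) ⬝ᵥ
          (E.Vlocal f k ω *ᵥ E.actPart (E.column (θ - θ₀) k)))
      + ∑ j : Fin E.p, (if (j : ℕ) < E.q then 0 else δ j * l2 (θ j)) := by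
    have hq : 0 ≤ ∑ k, (E.size k : ℝ) / E.N * (E.actPart (E.column (θ - θ₀) k) ⬝ᵥ
          (E.Vlocal f k ω *ᵥ E.actPart (E.column (θ - θ₀) k))) :=
      Finset.sum_nonneg fun k _ => h.quad_nonneg _ k
    have hnn : ∀ j ∈ (Finset.univ : Finset (Fin E.p)),
        0 ≤ if (j : ℕ) < E.q then 0 else δ j * l2 (θ j) := fun j _ => by
      split_ifs with hj
      · exact le_rfl
      · exact mul_nonneg (hδpos j hj).le (l2_nonneg _)
    by_cases hA : ∃ (j : Fin E.p) (k : Fin E.K), (j : ℕ) < E.q ∧ (θ - θ₀) j k ≠ 0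
    · exact add_pos_of_pos_of_nonneg (h.sum_quad_pos hA) (Finset.sum_nonneg hnn)
    · push Not at hA
      refine add_pos_of_nonneg_of_pos hq ?_
      obtain ⟨j, hj⟩ : ∃ j, (θ - θ₀) j ≠ 0 := by
        by_contra! hcon
        exact hne (sub_eq_zero.1 (by ext j k; exact congrFun (hcon j) k))
      have hjq : ¬ (j : ℕ) < E.q := fun hjq => hj (by ext k; exact hA j k hjq)
      refine Finset.sum_pos' hnn ⟨j, Finset.mem_univ _, ?_⟩
      rw [if_neg hjq]
      refine mul_pos (hδpos j hjq) (lt_of_le_of_ne (l2_nonneg _) (Ne.symm ?_))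
      rw [hoff j hjq] at hj
      exact fun h0 => hj (l2_eq_zero_iff.1 h0)
  unfold objICR
  rw [hexp]
  linarith

/-- The oracle is a strictly local minimizer of the oracle objective over `clusterSpace`. -/
theorem isStrictLocalMin_objOracle (h : E.OracleConditions f τ lam1 lam2 ω θ₀)
    (hpen : IsConcavePenalty τ pen) (hlam1 : 0 < lam1) (hlam2 : 0 < lam2) :
    IsStrictLocalMinOver (E.objOracle f pen lam1 ω) E.clusterSpace θ₀ := by
  refine ⟨h.mem, ?_⟩
  -- The two objectives differ by the fusion penalty, which is constant on `clusterSpace` near θ₀,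
  -- so strict minimality is inherited by restriction.
  have hmin := (h.isStrictLocalMin_objICR hpen hlam1 hlam2).2
  rw [eventually_nhdsWithin_iff] at hmin ⊢
  have h1 : ∀ᶠ θ in 𝓝 θ₀, ∀ k k', E.cluster k ≠ E.cluster k' →
      τ * lam2 < l2 (E.column θ k - E.column θ k') := by
    simp only [eventually_all]
    intro k k' hk
    exact (continuous_l2.comp ((continuous_column k).sub
      (continuous_column k'))).continuousAt.eventually (lt_mem_nhds (h.separation k k' hk))
  filter_upwards [hmin, h1] with θ hθ hsep hmem
  have hlt := hθ ⟨Set.mem_univ _, hmem.2⟩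
  have heq : E.fusionPen pen lam2 θ = E.fusionPen pen lam2 θ₀ := by
    refine Finset.sum_congr rfl fun k _ => Finset.sum_congr rfl fun k' _ => ?_
    by_cases hk : E.cluster k = E.cluster k'
    · rw [h.mem k k' hk, hmem.1 k k' hk, sub_self, sub_self]
    · exact hpen.eq_of_lt hlam2 (hsep k k' hk) (h.separation k k' hk)
  unfold objICR at hlt
  unfold objOracle
  linarith

end OracleConditions

end Experiment

/-! ### Derivatives of the loss -/

/-- Joint measurability in point and parameter follows because the derivative is a pointwise limit
of difference quotients along the steps 1/(n+1). -/
lemma measurable_deriv_fst {g : ℝ → ℝ → ℝ} (hg : Measurable (Function.uncurry g))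
    (hd : ∀ y, Differentiable ℝ fun a => g a y) :
    Measurable (Function.uncurry fun a y => deriv (fun t => g t y) a) := by
  have hu : Tendsto (fun n : ℕ => (1 : ℝ) / ((n : ℝ) + 1)) atTop (𝓝[≠] 0) :=
    tendsto_nhdsWithin_iff.2 ⟨tendsto_one_div_add_atTop_nhds_zero_nat,
      Eventually.of_forall fun n => by
        have : (0 : ℝ) < 1 / ((n : ℝ) + 1) := by positivity
        exact this.ne'⟩
  refine measurable_of_tendsto_metrizable (f := fun (n : ℕ) (z : ℝ × ℝ) =>
    (1 / ((n : ℝ) + 1))⁻¹ • (g (z.1 + 1 / ((n : ℝ) + 1)) z.2 - g z.1 z.2)) (fun n => ?_) ?_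
  · have h1 : Measurable fun z : ℝ × ℝ => g (z.1 + 1 / ((n : ℝ) + 1)) z.2 :=
      hg.comp ((measurable_fst.add_const _).prodMk measurable_snd)
    simp only [smul_eq_mul]
    exact (h1.sub hg).const_mul _
  · rw [tendsto_pi_nhds]
    rintro ⟨a, y⟩
    exact (hasDerivAt_iff_tendsto_slope_zero.1 (hd y a).hasDerivAt).comp hu

namespace IsTwiceDiffLoss

variable {f : ℝ → ℝ → ℝ}

lemma measurable_lossD1 (hf : IsTwiceDiffLoss f) : Measurable (Function.uncurry (lossD1 f)) :=
  measurable_deriv_fst hf.measurable hf.diff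

lemma measurable_lossD2 (hf : IsTwiceDiffLoss f) : Measurable (Function.uncurry (lossD2 f)) :=
  measurable_deriv_fst hf.measurable_lossD1 hf.diff2

lemma hasDerivAt (hf : IsTwiceDiffLoss f) (a y : ℝ) : HasDerivAt (fun t => f t y) (lossD1 f a y) a :=
  (hf.diff y a).hasDerivAt

lemma hasDerivAt_lossD1 (hf : IsTwiceDiffLoss f) (a y : ℝ) : HasDerivAt (fun t => lossD1 f t y) (lossD2 f a y) a :=
  (hf.diff2 y a).hasDerivAt

/-- First-order Taylor bound for the score. -/
lemma abs_lossD1_taylor_le (hf : IsTwiceDiffLoss f) {CL : ℝ}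
    (hCL : ∀ a b y : ℝ, |lossD2 f a y - lossD2 f b y| ≤ CL * |a - b|)
    (a b y : ℝ) :
    |lossD1 f b y + lossD2 f b y * (a - b) - lossD1 f a y| ≤ CL * (a - b) ^ 2 := by
  have hCL0 : 0 ≤ CL := by
    have := (abs_nonneg _).trans (hCL 1 0 0)
    simpa using this
  -- Mean value inequality on the segment from b to a for t ↦ f′(t) − f″(b)t, whose derivative is at
  -- most CL|a − b| there.
  have hbound := Convex.norm_image_sub_le_of_norm_hasDerivWithin_le (𝕜 := ℝ)
    (f := fun t => lossD1 f t y - lossD2 f b y * t) (f' := fun t => lossD2 f t y - lossD2 f b y)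
    (C := CL * |a - b|) (s := Set.uIcc b a) (x := b) (y := a) (fun t _ => by
      have h1 := (hf.hasDerivAt_lossD1 t y).fun_sub ((hasDerivAt_id t).const_mul (lossD2 f b y))
      simpa using h1.hasDerivWithinAt) (fun t ht => by
      refine (hCL t b y).trans (mul_le_mul_of_nonneg_left ?_ hCL0)
      exact Set.abs_sub_left_of_mem_uIcc ht) (convex_uIcc b a) Set.left_mem_uIcc Set.right_mem_uIcc
  rw [Real.norm_eq_abs, Real.norm_eq_abs, mul_assoc, abs_mul_abs_self] at hbound
  rw [abs_sub_comm, sq]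
  refine le_trans (le_of_eq ?_) hbound
  congr 1
  ring

end IsTwiceDiffLoss

/-! ### Gradients, Hessians and linearization of the local losses -/

namespace Experiment

variable {E : Experiment.{u}} {f : ℝ → ℝ → ℝ}

lemma dotProduct_add_smul_single (x b : Fin E.p → ℝ) (j : Fin E.p) (t : ℝ) :
    x ⬝ᵥ (b + t • Pi.single j 1) = x ⬝ᵥ b + t * x j := by
  rw [dotProduct_add, dotProduct_smul, dotProduct_single, mul_one, smul_eq_mul]

lemma grad_apply (hf : IsTwiceDiffLoss f) (k : Fin E.K) (ω : E.Ω) (b : Fin E.p → ℝ) (j : Fin E.p) :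
    E.grad f k ω b j =
      (1 / (E.size k : ℝ)) * ∑ i, lossD1 f (E.x k i ω ⬝ᵥ b) (E.y k i ω) * E.x k i ω j := by
  unfold grad lineDeriv localLoss
  refine HasDerivAt.deriv (HasDerivAt.const_mul _ (HasDerivAt.fun_sum fun i _ => ?_))
  simp only [dotProduct_add_smul_single]
  have h1 : HasDerivAt (fun t : ℝ => E.x k i ω ⬝ᵥ b + t * E.x k i ω j) (E.x k i ω j) 0 := by
    simpa using ((hasDerivAt_id (0 : ℝ)).mul_const (E.x k i ω j)).const_add (E.x k i ω ⬝ᵥ b)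
  have h2 := hf.hasDerivAt (E.x k i ω ⬝ᵥ b + 0 * E.x k i ω j) (E.y k i ω)
  have h3 := HasDerivAt.comp (0 : ℝ) h2 h1
  simpa [Function.comp_def] using h3

lemma hess_apply (hf : IsTwiceDiffLoss f) (k : Fin E.K) (ω : E.Ω) (b : Fin E.p → ℝ)
    (j l : Fin E.p) :
    E.hess f k ω b j l = (1 / (E.size k : ℝ)) *
      ∑ i, lossD2 f (E.x k i ω ⬝ᵥ b) (E.y k i ω) * E.x k i ω j * E.x k i ω l := by
  unfold hess lineDeriv
  simp only [grad_apply hf]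
  refine HasDerivAt.deriv (HasDerivAt.const_mul _ (HasDerivAt.fun_sum fun i _ => ?_))
  refine HasDerivAt.mul_const ?_ _
  simp only [dotProduct_add_smul_single]
  have h1 : HasDerivAt (fun t : ℝ => E.x k i ω ⬝ᵥ b + t * E.x k i ω j) (E.x k i ω j) 0 := by
    simpa using ((hasDerivAt_id (0 : ℝ)).mul_const (E.x k i ω j)).const_add (E.x k i ω ⬝ᵥ b)
  have h2 := hf.hasDerivAt_lossD1 (E.x k i ω ⬝ᵥ b + 0 * E.x k i ω j) (E.y k i ω)
  have h3 := HasDerivAt.comp (0 : ℝ) h2 h1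
  simpa [Function.comp_def] using h3

lemma Vlocal_transpose (hf : IsTwiceDiffLoss f) (k : Fin E.K) (ω : E.Ω) :
    (E.Vlocal f k ω)ᵀ = E.Vlocal f k ω := by
  ext j l
  simp only [Matrix.transpose_apply, Vlocal, hess_apply hf]
  congr 1
  exact Finset.sum_congr rfl fun i _ => by ring

/-- The bilinear form of a Hessian. -/
lemma dotProduct_hess_mulVec (hf : IsTwiceDiffLoss f) (k : Fin E.K) (ω : E.Ω)
    (b v w : Fin E.p → ℝ) :
    v ⬝ᵥ (E.hess f k ω b *ᵥ w) = (1 / (E.size k : ℝ)) *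
      ∑ i, lossD2 f (E.x k i ω ⬝ᵥ b) (E.y k i ω) * (E.x k i ω ⬝ᵥ v) * (E.x k i ω ⬝ᵥ w) := by
  simp only [dotProduct, Matrix.mulVec, hess_apply hf]
  simp only [Finset.mul_sum, Finset.sum_mul]
  rw [Finset.sum_comm]
  refine (Finset.sum_congr rfl fun j _ => Finset.sum_comm).trans ?_
  rw [Finset.sum_comm]
  refine Finset.sum_congr rfl fun i _ => ?_
  refine Finset.sum_congr rfl fun j _ => Finset.sum_congr rfl fun l _ => ?_
  ring

lemma hess_mulVec_apply (hf : IsTwiceDiffLoss f) (k : Fin E.K) (ω : E.Ω)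
    (b w : Fin E.p → ℝ) (j : Fin E.p) :
    (E.hess f k ω b *ᵥ w) j = (1 / (E.size k : ℝ)) *
      ∑ i, lossD2 f (E.x k i ω ⬝ᵥ b) (E.y k i ω) * (E.x k i ω ⬝ᵥ w) * E.x k i ω j := by
  have h := dotProduct_hess_mulVec hf k ω b (Pi.single j 1) w
  rw [single_dotProduct, one_mul] at h
  rw [h]
  congr 1
  refine Finset.sum_congr rfl fun i _ => ?_
  rw [dotProduct_single, mul_one]
  ring

/-- The linear predictor at the truth. -/
def predictor (k : Fin E.K) (i : Fin (E.size k)) (ω : E.Ω) : ℝ :=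
  E.x k i ω ⬝ᵥ E.column E.θstar k

/-- The error of the local predictor. -/
def predError (k : Fin E.K) (i : Fin (E.size k)) (ω : E.Ω) : ℝ :=
  E.x k i ω ⬝ᵥ (E.θlocal k ω - E.column E.θstar k)

/-- The score of client `k`, summed over its observations, at the truth. -/
def scoreSum (f : ℝ → ℝ → ℝ) (k : Fin E.K) (ω : E.Ω) (j : Fin E.p) : ℝ :=
  ∑ i, lossD1 f (E.predictor k i ω) (E.y k i ω) * E.x k i ω j

/-- The vector `V θ⋆ - ζ`, the gradient of the quadratic surrogate at the truth. -/
def surrogateGrad (f : ℝ → ℝ → ℝ) (k : Fin E.K) (ω : E.Ω) : Fin E.p → ℝ :=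
  E.Vlocal f k ω *ᵥ E.column E.θstar k - E.ζlocal f k ω

/-- Since ζ = Vθ̃ − g(θ̃), the surrogate gradient is g(θ̃) + V(θ⋆ − θ̃): the first-order expansion
of the score at the local estimator, evaluated at the truth, one observation at a time. -/
lemma surrogateGrad_apply (hf : IsTwiceDiffLoss f) (k : Fin E.K) (ω : E.Ω) (j : Fin E.p) :
    E.surrogateGrad f k ω j = (1 / (E.size k : ℝ)) * ∑ i,
      (lossD1 f (E.x k i ω ⬝ᵥ E.θlocal k ω) (E.y k i ω)
        + lossD2 f (E.x k i ω ⬝ᵥ E.θlocal k ω) (E.y k i ω)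
          * (E.predictor k i ω - E.x k i ω ⬝ᵥ E.θlocal k ω)) * E.x k i ω j := by
  have h1 : E.surrogateGrad f k ω = E.hess f k ω (E.θlocal k ω) *ᵥ
      (E.column E.θstar k - E.θlocal k ω) + E.grad f k ω (E.θlocal k ω) := by
    rw [surrogateGrad, ζlocal, Vlocal, Matrix.mulVec_sub]
    abel
  rw [h1, Pi.add_apply, hess_mulVec_apply hf, grad_apply hf, ← mul_add, ← Finset.sum_add_distrib]
  congr 1
  refine Finset.sum_congr rfl fun i _ => ?_
  rw [dotProduct_sub, predictor]
  ring

/-- The surrogate gradient at the truth differs from the score by a quadratic remainder. -/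
lemma abs_surrogateGrad_sub_le (hf : IsTwiceDiffLoss f) {CL Cx : ℝ}
    (hCL : ∀ a b y : ℝ, |lossD2 f a y - lossD2 f b y| ≤ CL * |a - b|)
    (k : Fin E.K) (ω : E.Ω) (j : Fin E.p) (hx : ∀ i, |E.x k i ω j| ≤ Cx) :
    |E.surrogateGrad f k ω j - (1 / (E.size k : ℝ)) * E.scoreSum f k ω j|
      ≤ CL * Cx * ((1 / (E.size k : ℝ)) * ∑ i, E.predError k i ω ^ 2) := by
  have hCL0 : 0 ≤ CL := by
    have := (abs_nonneg _).trans (hCL 1 0 0)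
    simpa using this
  rw [surrogateGrad_apply hf, scoreSum, ← mul_sub, ← Finset.sum_sub_distrib, abs_mul,
    abs_of_nonneg (by positivity : (0 : ℝ) ≤ 1 / (E.size k : ℝ)), mul_left_comm]
  refine mul_le_mul_of_nonneg_left ((Finset.abs_sum_le_sum_abs _ _).trans ?_) (by positivity)
  rw [Finset.mul_sum]
  refine Finset.sum_le_sum fun i _ => ?_
  rw [← sub_mul, abs_mul]
  have h1 := hf.abs_lossD1_taylor_le hCL (E.predictor k i ω) (E.x k i ω ⬝ᵥ E.θlocal k ω) (E.y k i ω)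
  have h2 : (E.predictor k i ω - E.x k i ω ⬝ᵥ E.θlocal k ω) ^ 2 = E.predError k i ω ^ 2 := by
    rw [predError, dotProduct_sub, predictor]
    ring
  rw [h2] at h1
  calc _ ≤ CL * E.predError k i ω ^ 2 * Cx :=
        mul_le_mul h1 (hx i) (abs_nonneg _) (by positivity)
    _ = _ := by ring

/-! ### Measurability -/

lemma measurable_x_apply (k : Fin E.K) (i : Fin (E.size k)) (j : Fin E.p) :
    Measurable fun ω => E.x k i ω j := (measurable_pi_apply j).comp (E.measurable_x k i)

lemma measurable_x_dotProduct (k : Fin E.K) (i : Fin (E.size k)) {b : E.Ω → Fin E.p → ℝ}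
    (hb : Measurable b) : Measurable fun ω => E.x k i ω ⬝ᵥ b ω :=
  Finset.measurable_sum _ fun j _ =>
    (measurable_x_apply k i j).mul ((measurable_pi_apply j).comp hb)

lemma measurable_lossD1_comp (hf : IsTwiceDiffLoss f) (k : Fin E.K) (i : Fin (E.size k))
    {b : E.Ω → Fin E.p → ℝ} (hb : Measurable b) :
    Measurable fun ω => lossD1 f (E.x k i ω ⬝ᵥ b ω) (E.y k i ω) :=
  hf.measurable_lossD1.comp ((measurable_x_dotProduct k i hb).prodMk (E.measurable_y k i))

lemma measurable_lossD2_comp (hf : IsTwiceDiffLoss f) (k : Fin E.K) (i : Fin (E.size k))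
    {b : E.Ω → Fin E.p → ℝ} (hb : Measurable b) :
    Measurable fun ω => lossD2 f (E.x k i ω ⬝ᵥ b ω) (E.y k i ω) :=
  hf.measurable_lossD2.comp ((measurable_x_dotProduct k i hb).prodMk (E.measurable_y k i))

lemma measurable_Vlocal (hf : IsTwiceDiffLoss f) (k : Fin E.K) (j l : Fin E.p) :
    Measurable fun ω => E.Vlocal f k ω j l := by
  simp only [Vlocal, hess_apply hf]
  exact (Finset.measurable_sum _ fun i _ =>
    ((measurable_lossD2_comp hf k i (E.measurable_θlocal k)).mul
      (measurable_x_apply k i j)).mul (measurable_x_apply k i l)).const_mul _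

lemma measurable_ζlocal (hf : IsTwiceDiffLoss f) (k : Fin E.K) (j : Fin E.p) :
    Measurable fun ω => E.ζlocal f k ω j := by
  simp only [ζlocal, Pi.sub_apply, Matrix.mulVec, dotProduct, grad_apply hf]
  refine Measurable.sub (Finset.measurable_sum _ fun l _ => (measurable_Vlocal hf k j l).mul
    ((measurable_pi_apply l).comp (E.measurable_θlocal k))) ?_
  exact (Finset.measurable_sum _ fun i _ =>
    (measurable_lossD1_comp hf k i (E.measurable_θlocal k)).mul
      (measurable_x_apply k i j)).const_mul _

end Experiment

/-! ### Sub-Gaussian random variables -/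

section SubGaussian

variable {Ω : Type*} [MeasurableSpace Ω] {μ : Measure Ω}

lemma eLpNorm_le_of_subGaussianNorm_le {X : Ω → ℝ} {κ : ℝ}
    (h : subGaussianNorm X μ ≤ ENNReal.ofReal κ) {s : ℝ} (hs : 1 ≤ s) :
    eLpNorm X (ENNReal.ofReal s) μ ≤ ENNReal.ofReal κ * ENNReal.ofReal (Real.sqrt s) := by
  have h1 : eLpNorm X (ENNReal.ofReal s) μ / ENNReal.ofReal (Real.sqrt s) ≤ ENNReal.ofReal κ :=
    (le_iSup₂ (f := fun (s : ℝ) (_ : 1 ≤ s) =>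
      eLpNorm X (ENNReal.ofReal s) μ / ENNReal.ofReal (Real.sqrt s)) s hs).trans h
  refine (ENNReal.div_le_iff_le_mul (Or.inl ?_) (Or.inl ENNReal.ofReal_ne_top)).1 h1
  have : 0 < Real.sqrt s := Real.sqrt_pos.2 (by linarith)
  simpa using this

lemma subGaussianNorm_mul_le {X Y : Ω → ℝ} {κ C : ℝ} (hC : 0 ≤ C)
    (h : subGaussianNorm X μ ≤ ENNReal.ofReal κ) (hY : ∀ᵐ ω ∂μ, |Y ω| ≤ C) :
    subGaussianNorm (fun ω => X ω * Y ω) μ ≤ ENNReal.ofReal (C * κ) := by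
  refine iSup₂_le fun s hs => ?_
  have h1 : eLpNorm (fun ω => X ω * Y ω) (ENNReal.ofReal s) μ
      ≤ ENNReal.ofReal C * eLpNorm X (ENNReal.ofReal s) μ := by
    refine eLpNorm_le_mul_eLpNorm_of_ae_le_mul ?_ _
    filter_upwards [hY] with ω hω
    rw [norm_mul, mul_comm]
    exact mul_le_mul_of_nonneg_right hω (norm_nonneg _)
  have hs0 : 0 < Real.sqrt s := Real.sqrt_pos.2 (by linarith)
  refine (ENNReal.div_le_iff_le_mul (Or.inl (by simpa using hs0))
    (Or.inl ENNReal.ofReal_ne_top)).2 (h1.trans ?_)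
  rw [ENNReal.ofReal_mul hC, mul_assoc]
  gcongr
  exact eLpNorm_le_of_subGaussianNorm_le h hs

lemma lintegral_pow_le_of_subGaussianNorm_le {X : Ω → ℝ} {κ : ℝ} (hκ : 0 ≤ κ)
    (h : subGaussianNorm X μ ≤ ENNReal.ofReal κ) {r : ℕ} (hr : 1 ≤ r) :
    ∫⁻ ω, ENNReal.ofReal ((X ω ^ 2) ^ r) ∂μ ≤ ENNReal.ofReal ((κ ^ 2 * (2 * r)) ^ r) := by
  have hr' : (1 : ℝ) ≤ r := by exact_mod_cast hr
  have h1 := eLpNorm_le_of_subGaussianNorm_le h (s := 2 * r) (by linarith)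
  have hpos : (0 : ℝ) < 2 * r := by linarith
  rw [eLpNorm_eq_eLpNorm' (ENNReal.ofReal_pos.2 hpos).ne' ENNReal.ofReal_ne_top,
    ENNReal.toReal_ofReal hpos.le] at h1
  have h2 := lintegral_rpow_enorm_eq_rpow_eLpNorm' (μ := μ) (f := X) hpos
  have h3 : ∀ ω, ENNReal.ofReal ((X ω ^ 2) ^ r) = ‖X ω‖ₑ ^ (2 * r : ℝ) := by
    intro ω
    rw [Real.enorm_eq_ofReal_abs, ENNReal.ofReal_rpow_of_nonneg (abs_nonneg _) hpos.le]
    congr 1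
    rw [← sq_abs, ← pow_mul, ← Real.rpow_natCast]
    push_cast
    rfl
  simp only [h3]
  rw [h2]
  refine (ENNReal.rpow_le_rpow h1 hpos.le).trans (le_of_eq ?_)
  rw [← ENNReal.ofReal_mul hκ, ENNReal.ofReal_rpow_of_nonneg (by positivity) hpos.le]
  congr 1
  have h4 : (2 * r : ℝ) = ((2 * r : ℕ) : ℝ) := by push_cast; rfl
  rw [show (κ * √(2 * (r : ℝ))) ^ (2 * r : ℝ) = (κ * √(2 * (r : ℝ))) ^ ((2 * r : ℕ) : ℝ) by
    rw [← h4], Real.rpow_natCast, pow_mul, mul_pow, Real.sq_sqrt hpos.le]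

lemma natCast_pow_self_div_factorial_le (r : ℕ) : (r : ℝ) ^ r / r.factorial ≤ Real.exp 1 ^ r := by
  rw [← Real.exp_nat_mul, mul_one]
  exact Real.pow_div_factorial_le_exp _ (Nat.cast_nonneg r) r

/-- Exponential integrability of the square of a sub-Gaussian variable. -/
lemma lintegral_exp_sq_le [IsProbabilityMeasure μ] {X : Ω → ℝ} (hX : Measurable X) {κ : ℝ}
    (hκ : 0 < κ) (h : subGaussianNorm X μ ≤ ENNReal.ofReal κ) :
    ∫⁻ ω, ENNReal.ofReal (Real.exp (1 / (4 * Real.exp 1 * κ ^ 2) * X ω ^ 2)) ∂μ ≤ 2 := by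
  -- With r^r ≤ eʳ r! the r-th term of the exponential series has expectation at most (2eκ²λ)ʳ; this
  -- λ makes it 2⁻ʳ, and the series sums to 2.
  set lam : ℝ := 1 / (4 * Real.exp 1 * κ ^ 2) with hlam
  have hlam0 : 0 < lam := by positivity
  have h1 : ∀ ω, ENNReal.ofReal (Real.exp (lam * X ω ^ 2))
      = ∑' r : ℕ, ENNReal.ofReal (lam ^ r / r.factorial) * ENNReal.ofReal ((X ω ^ 2) ^ r) := by
    intro ω
    have hnn : ∀ r : ℕ, 0 ≤ (lam * X ω ^ 2) ^ r / r.factorial := fun r => by positivity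
    rw [Real.exp_eq_exp_ℝ, NormedSpace.exp_eq_tsum_div,
      ENNReal.ofReal_tsum_of_nonneg hnn (Real.summable_pow_div_factorial _)]
    refine tsum_congr fun r => ?_
    rw [← ENNReal.ofReal_mul (by positivity)]
    congr 1
    rw [mul_pow]
    ring
  simp only [h1]
  rw [lintegral_tsum fun r =>
    ((((hX.pow_const 2).pow_const r).ennreal_ofReal).const_mul _).aemeasurable]
  have h2 : ∀ r : ℕ, ∫⁻ ω, ENNReal.ofReal (lam ^ r / r.factorial)
      * ENNReal.ofReal ((X ω ^ 2) ^ r) ∂μ ≤ ENNReal.ofReal ((1 / 2 : ℝ) ^ r) := by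
    intro r
    rw [lintegral_const_mul _ ((hX.pow_const 2).pow_const r).ennreal_ofReal]
    rcases Nat.eq_zero_or_pos r with rfl | hr
    · simp
    refine (mul_le_mul_right (lintegral_pow_le_of_subGaussianNorm_le hκ.le h hr) _).trans ?_
    rw [← ENNReal.ofReal_mul (by positivity)]
    refine ENNReal.ofReal_le_ofReal ?_
    have h3 := natCast_pow_self_div_factorial_le r
    have he : (0 : ℝ) < Real.exp 1 := Real.exp_pos 1
    calc lam ^ r / r.factorial * (κ ^ 2 * (2 * r)) ^ r
        = (lam * κ ^ 2 * 2) ^ r * ((r : ℝ) ^ r / r.factorial) := by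
          rw [mul_pow, mul_pow, mul_pow, mul_pow]; ring
      _ ≤ (lam * κ ^ 2 * 2) ^ r * Real.exp 1 ^ r := by gcongr
      _ = (1 / 2 : ℝ) ^ r := by
          rw [← mul_pow]
          congr 1
          rw [hlam]
          field_simp
          norm_num
  refine (ENNReal.tsum_le_tsum h2).trans ?_
  rw [← ENNReal.ofReal_tsum_of_nonneg (fun r => by positivity) summable_geometric_two,
    tsum_geometric_two]
  simp

/-- The Taylor remainder keeps the linear term explicit, so that centering can remove it after
integration. -/
lemma exp_le_one_add_add_sq_mul_exp_abs (x : ℝ) :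
    Real.exp x ≤ 1 + x + x ^ 2 * Real.exp |x| := by
  have h := Complex.norm_exp_sub_sum_le_norm_mul_exp (x : ℂ) 2
  simp only [Finset.sum_range_succ, Finset.sum_range_zero, pow_zero, pow_one, Nat.factorial,
    Nat.cast_one, div_one, zero_add, mul_one, Complex.norm_real, Real.norm_eq_abs, sq_abs] at h
  have h2 : ‖Complex.exp x - (1 + (x : ℂ))‖ = |Real.exp x - (1 + x)| := by
    rw [← Complex.ofReal_exp, ← Complex.ofReal_one, ← Complex.ofReal_add, ← Complex.ofReal_sub,
      Complex.norm_real, Real.norm_eq_abs]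
  rw [h2] at h
  have := (abs_le.1 h).2
  linarith

/-- A centered variable with sub-Gaussian moments has a sub-Gaussian moment generating function. -/
theorem hasSubgaussianMGF_of_subGaussianNorm_le [IsProbabilityMeasure μ] {X : Ω → ℝ}
    (hX : Measurable X) {κ : ℝ} (hκ : 0 < κ) (h : subGaussianNorm X μ ≤ ENNReal.ofReal κ)
    (hmean : ∫ ω, X ω ∂μ = 0) :
    HasSubgaussianMGF X (Real.toNNReal (64 * Real.exp 1 * κ ^ 2)) μ := by
  set lam : ℝ := 1 / (4 * Real.exp 1 * κ ^ 2) with hlam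
  have hlam0 : 0 < lam := by positivity
  have hlin := lintegral_exp_sq_le hX hκ h
  rw [← hlam] at hlin
  have hmeas : Measurable fun ω => Real.exp (lam * X ω ^ 2) :=
    ((hX.pow_const 2).const_mul lam).exp
  have hint : Integrable (fun ω => Real.exp (lam * X ω ^ 2)) μ := by
    refine ⟨hmeas.aestronglyMeasurable, ?_⟩
    rw [hasFiniteIntegral_iff_ofReal (Eventually.of_forall fun ω => (Real.exp_pos _).le)]
    exact hlin.trans_lt (by simp)
  have hle2 : ∫ ω, Real.exp (lam * X ω ^ 2) ∂μ ≤ 2 := by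
    rw [integral_eq_lintegral_of_nonneg_ae (Eventually.of_forall fun ω => (Real.exp_pos _).le)
      hmeas.aestronglyMeasurable]
    exact ENNReal.toReal_le_of_le_ofReal (by norm_num) (by simpa using hlin)
  -- Completing the square; this gives exponential moments of every order from that of λX².
  have hlamx : ∀ t x : ℝ, t * x ≤ lam * x ^ 2 + t ^ 2 / (4 * lam) := by
    intro t x
    have : lam * x ^ 2 + t ^ 2 / (4 * lam) - t * x = lam * (x - t / (2 * lam)) ^ 2 := by
      field_simp
      ring
    have h2 : 0 ≤ lam * (x - t / (2 * lam)) ^ 2 := by positivity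
    linarith
  have hint2 : ∀ t, Integrable (fun ω => Real.exp (t * X ω)) μ := by
    intro t
    refine (hint.mul_const (Real.exp (t ^ 2 / (4 * lam)))).mono'
      (hX.const_mul t).exp.aestronglyMeasurable (Eventually.of_forall fun ω => ?_)
    rw [Real.norm_eq_abs, abs_of_pos (Real.exp_pos _), ← Real.exp_add]
    exact Real.exp_le_exp.2 (hlamx t (X ω))
  have hXint : Integrable X μ := by
    refine ((hint2 1).add (hint2 (-1))).mono' hX.aestronglyMeasurable
      (Eventually.of_forall fun ω => ?_)
    simp only [Pi.add_apply, one_mul, neg_mul, Real.norm_eq_abs]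
    have h1 := Real.add_one_le_exp (X ω)
    have h2 := Real.add_one_le_exp (-X ω)
    have h3 := Real.exp_pos (X ω)
    have h4 := Real.exp_pos (-X ω)
    exact abs_le.2 ⟨by linarith, by linarith⟩
  refine ⟨hint2, fun t => ?_⟩
  -- The target exponent is 8t²/λ, with 1/λ = 4eκ²; hence the variance proxy 2 · 8 · 4eκ² = 64eκ².
  have hc : ((Real.toNNReal (64 * Real.exp 1 * κ ^ 2) : NNReal) : ℝ) * t ^ 2 / 2
      = 8 * t ^ 2 / lam := by
    rw [Real.coe_toNNReal _ (by positivity), hlam]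
    field_simp
    ring
  rw [hc, mgf]
  -- For t² ≤ λ the mean-zero Taylor bound applies: half of λX² dominates X² and the other half
  -- dominates e^|tX|. For t² > λ the completed square suffices, as the factor 2 ≤ e is absorbed by
  -- t²/λ > 1.
  rcases le_or_gt (t ^ 2) lam with ht | ht
  · have hpt : ∀ ω, Real.exp (t * X ω)
        ≤ 1 + t * X ω + 4 * t ^ 2 / lam * Real.exp (lam * X ω ^ 2) := by
      intro ω
      refine (exp_le_one_add_add_sq_mul_exp_abs (t * X ω)).trans ?_
      have h1 : |t * X ω| ≤ lam * X ω ^ 2 / 2 + 1 / 2 := by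
        have h2 : ∀ s : ℝ, s ^ 2 = t ^ 2 → s * X ω ≤ lam * X ω ^ 2 / 2 + 1 / 2 := by
          intro s hs
          have h3 : 0 ≤ (lam * X ω - s) ^ 2 := sq_nonneg _
          have h4 : s * X ω * lam ≤ (lam * X ω ^ 2 / 2 + 1 / 2) * lam := by nlinarith
          exact le_of_mul_le_mul_right h4 hlam0
        refine abs_le.2 ⟨?_, h2 t rfl⟩
        have := h2 (-t) (neg_sq t)
        linarith
      have h2 : lam * X ω ^ 2 / 2 ≤ Real.exp (lam * X ω ^ 2 / 2) := by
        have := Real.add_one_le_exp (lam * X ω ^ 2 / 2)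
        linarith
      have h3 : X ω ^ 2 ≤ 2 / lam * Real.exp (lam * X ω ^ 2 / 2) := by
        rw [div_mul_eq_mul_div, le_div_iff₀ hlam0]
        linarith
      have h4 : Real.exp (1 / 2) ≤ 2 := by
        have h5 : Real.exp (1 / 2) ^ 2 = Real.exp 1 := by
          rw [← Real.exp_nat_mul]; norm_num
        have h6 := Real.exp_one_lt_d9
        nlinarith [Real.exp_pos (1 / 2)]
      have h5 : (t * X ω) ^ 2 * Real.exp |t * X ω| ≤ 4 * t ^ 2 / lam * Real.exp (lam * X ω ^ 2) := by
        calc (t * X ω) ^ 2 * Real.exp |t * X ω|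
            ≤ (t ^ 2 * (2 / lam * Real.exp (lam * X ω ^ 2 / 2)))
              * Real.exp (lam * X ω ^ 2 / 2 + 1 / 2) := by
              rw [mul_pow]
              gcongr
          _ = 2 * t ^ 2 / lam * Real.exp (1 / 2) * Real.exp (lam * X ω ^ 2) := by
              rw [Real.exp_add, show Real.exp (lam * X ω ^ 2)
                = Real.exp (lam * X ω ^ 2 / 2) * Real.exp (lam * X ω ^ 2 / 2) by
                  rw [← Real.exp_add]; ring_nf]
              ring
          _ ≤ 2 * t ^ 2 / lam * 2 * Real.exp (lam * X ω ^ 2) := by gcongr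
          _ = _ := by ring
      linarith
    calc ∫ ω, Real.exp (t * X ω) ∂μ
        ≤ ∫ ω, (1 + t * X ω + 4 * t ^ 2 / lam * Real.exp (lam * X ω ^ 2)) ∂μ :=
          integral_mono (hint2 t) (((integrable_const 1).add (hXint.const_mul t)).add
            (hint.const_mul _)) hpt
      _ = 1 + 4 * t ^ 2 / lam * ∫ ω, Real.exp (lam * X ω ^ 2) ∂μ := by
          rw [integral_add (f := fun ω => 1 + t * X ω)
              ((integrable_const 1).add (hXint.const_mul t)) (hint.const_mul _),
            integral_add (integrable_const 1) (hXint.const_mul t), integral_const_mul,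
            integral_const_mul, hmean]
          simp
      _ ≤ 1 + 4 * t ^ 2 / lam * 2 := by gcongr
      _ = 8 * t ^ 2 / lam + 1 := by ring
      _ ≤ _ := Real.add_one_le_exp _
  · calc ∫ ω, Real.exp (t * X ω) ∂μ
        ≤ ∫ ω, Real.exp (lam * X ω ^ 2) * Real.exp (t ^ 2 / (4 * lam)) ∂μ := by
          refine integral_mono (hint2 t) (hint.mul_const _) fun ω => ?_
          simp only
          rw [← Real.exp_add]
          exact Real.exp_le_exp.2 (hlamx t (X ω))
      _ = (∫ ω, Real.exp (lam * X ω ^ 2) ∂μ) * Real.exp (t ^ 2 / (4 * lam)) :=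
          integral_mul_const _ _
      _ ≤ Real.exp 1 * Real.exp (t ^ 2 / (4 * lam)) := by
          have := Real.add_one_le_exp (1 : ℝ)
          gcongr
          linarith
      _ ≤ _ := by
          rw [← Real.exp_add]
          refine Real.exp_le_exp.2 ?_
          have h1 : 1 ≤ t ^ 2 / lam := (one_le_div hlam0).2 ht.le
          have h2 : t ^ 2 / (4 * lam) = t ^ 2 / lam / 4 := by field_simp
          have h3 : 8 * t ^ 2 / lam = 8 * (t ^ 2 / lam) := by ring
          rw [h2, h3]
          linarith

lemma ProbabilityTheory.HasSubgaussianMGF.measure_abs_ge_le [IsProbabilityMeasure μ] {X : Ω → ℝ} {c : NNReal}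
    (h : HasSubgaussianMGF X c μ) {t : ℝ} (ht : 0 ≤ t) :
    μ {ω | t ≤ |X ω|} ≤ ENNReal.ofReal (2 * Real.exp (-t ^ 2 / (2 * c))) := by
  have h1 := h.measure_ge_le ht
  have h2 := h.neg.measure_ge_le ht
  have h3 : {ω | t ≤ |X ω|} ⊆ {ω | t ≤ X ω} ∪ {ω | t ≤ (-X) ω} := fun ω (hω : t ≤ |X ω|) => le_abs.1 hω
  rw [two_mul, ENNReal.ofReal_add (Real.exp_pos _).le (Real.exp_pos _).le]
  refine (measure_mono h3).trans ((measure_union_le _ _).trans (add_le_add ?_ ?_))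
  · exact (ENNReal.le_ofReal_iff_toReal_le (measure_ne_top _ _) (Real.exp_pos _).le).2 h1
  · exact (ENNReal.le_ofReal_iff_toReal_le (measure_ne_top _ _) (Real.exp_pos _).le).2 h2

/-- With s = c^(-1/2), (sX)²/2 ≤ e^(sX) + e^(−sX), and each exponential has mean at most e^(1/2) ≤
2. The constant 8 is not sharp; only linearity in c matters. -/
lemma ProbabilityTheory.HasSubgaussianMGF.integral_sq_le [IsProbabilityMeasure μ] {X : Ω → ℝ} {c : NNReal}
    (h : HasSubgaussianMGF X c μ) (hc : 0 < c) : ∫ ω, X ω ^ 2 ∂μ ≤ 8 * c := by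
  have hc' : (0 : ℝ) < c := by exact_mod_cast hc
  set s : ℝ := 1 / Real.sqrt c with hs
  have hs2 : s ^ 2 = 1 / c := by rw [hs, div_pow, one_pow, Real.sq_sqrt hc'.le]
  have hint : ∀ t, Integrable (fun ω => Real.exp (t * X ω)) μ := h.integrable_exp_mul
  have hsq : Integrable (fun ω => X ω ^ 2) μ := (h.memLp 2).integrable_sq
  have hm : ∀ t, t ^ 2 = s ^ 2 → ∫ ω, Real.exp (t * X ω) ∂μ ≤ 2 := by
    intro t ht
    refine (h.mgf_le t).trans ?_
    rw [ht, hs2, mul_one_div_cancel hc'.ne']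
    have h5 : Real.exp (1 / 2) ^ 2 = Real.exp 1 := by
      rw [← Real.exp_nat_mul]; norm_num
    have h6 := Real.exp_one_lt_d9
    nlinarith [Real.exp_pos (1 / 2)]
  have hpt : ∀ ω, X ω ^ 2 ≤ 2 * c * (Real.exp (s * X ω) + Real.exp (-s * X ω)) := by
    intro ω
    have h1 := Real.quadratic_le_exp_of_nonneg (abs_nonneg (s * X ω))
    rw [sq_abs] at h1
    have h2 : Real.exp |s * X ω| ≤ Real.exp (s * X ω) + Real.exp (-s * X ω) := by
      rcases abs_cases (s * X ω) with h | h
      · rw [h.1]; linarith [Real.exp_pos (-s * X ω)]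
      · rw [h.1, ← neg_mul]; linarith [Real.exp_pos (s * X ω)]
    have h3 : (s * X ω) ^ 2 / 2 ≤ Real.exp (s * X ω) + Real.exp (-s * X ω) := by
      linarith [abs_nonneg (s * X ω)]
    have h4 : X ω ^ 2 = 2 * c * ((s * X ω) ^ 2 / 2) := by
      rw [mul_pow, hs2]
      field_simp
    rw [h4]
    gcongr
  calc ∫ ω, X ω ^ 2 ∂μ
      ≤ ∫ ω, 2 * c * (Real.exp (s * X ω) + Real.exp (-s * X ω)) ∂μ :=
        integral_mono hsq (((hint s).add (hint (-s))).const_mul _) hpt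
    _ = 2 * c * (∫ ω, Real.exp (s * X ω) ∂μ + ∫ ω, Real.exp (-s * X ω) ∂μ) := by
        rw [integral_const_mul, integral_add (hint s) (hint (-s))]
    _ ≤ 2 * c * (2 + 2) := by
        have h1 := hm s rfl
        have h2 := hm (-s) (neg_sq s)
        gcongr
    _ = _ := by ring

lemma measure_lt_le_of_integral_le [IsProbabilityMeasure μ] {Y : Ω → ℝ} (hY : Integrable Y μ)
    (hY0 : ∀ ω, 0 ≤ Y ω) {A C : ℝ} (hA : 0 < A) (hC : 0 < C) (h : ∫ ω, Y ω ∂μ ≤ A) :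
    μ {ω | C * A < Y ω} ≤ ENNReal.ofReal (1 / C) := by
  have h1 := mul_meas_ge_le_integral_of_nonneg (Eventually.of_forall hY0) hY (C * A)
  have h2 : μ {ω | C * A < Y ω} ≤ μ {ω | C * A ≤ Y ω} :=
    measure_mono fun ω (hω : C * A < Y ω) => hω.le
  refine h2.trans ((ENNReal.le_ofReal_iff_toReal_le (measure_ne_top _ _) (by positivity)).2 ?_)
  rw [le_div_iff₀ hC]
  have h3 := h1.trans h
  rw [mul_right_comm, mul_comm C] at h3
  have h4 : μ.real {ω | C * A ≤ Y ω} * C * A ≤ 1 * A := by linarith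
  exact le_of_mul_le_mul_right h4 hA

end SubGaussian

namespace Experiment

variable {E : Experiment.{u}} {f : ℝ → ℝ → ℝ}

/-! ### Cluster sizes -/

lemma K_pos_real : (0 : ℝ) < E.K := by exact_mod_cast E.K_pos

lemma one_le_K : (1 : ℝ) ≤ E.K := by exact_mod_cast E.K_pos

lemma one_le_q : (1 : ℝ) ≤ E.q := by exact_mod_cast E.q_pos

lemma q_le_p : (E.q : ℝ) ≤ E.p := by exact_mod_cast E.q_le

lemma one_le_p : (1 : ℝ) ≤ E.p := one_le_q.trans q_le_p

lemma log_p_nonneg : 0 ≤ Real.log E.p := Real.log_nonneg one_le_p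

instance : Nonempty (Fin E.M) := ⟨E.cluster ⟨0, E.K_pos⟩⟩

lemma card_act : Fintype.card E.Act = E.q := by
  rw [Fintype.card_subtype, Fin.card_filter_val_lt, min_eq_right E.q_le]

lemma clusterCard_pos (m : Fin E.M) : 0 < E.clusterCard m := by
  obtain ⟨k, hk⟩ := E.cluster_surj m
  exact Finset.card_pos.2 ⟨k, by simp [hk]⟩

lemma clusterCard_le_Gmax (m : Fin E.M) : E.clusterCard m ≤ E.Gmax :=
  le_ciSup (Set.finite_range _).bddAbove m

lemma Gmin_le_clusterCard (m : Fin E.M) : E.Gmin ≤ E.clusterCard m :=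
  ciInf_le (OrderBot.bddBelow _) m

lemma Nmin_le_clusterN (m : Fin E.M) : E.Nmin ≤ E.clusterN m :=
  ciInf_le (OrderBot.bddBelow _) m

lemma exists_clusterCard_eq_Gmin : ∃ m, E.clusterCard m = E.Gmin :=
  exists_eq_ciInf_of_finite

lemma exists_clusterN_eq_Nmin : ∃ m, E.clusterN m = E.Nmin :=
  exists_eq_ciInf_of_finite

lemma one_le_Gmin : (1 : ℝ) ≤ E.Gmin := by
  obtain ⟨m, hm⟩ := E.exists_clusterCard_eq_Gmin
  rw [← hm]
  exact_mod_cast clusterCard_pos m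

lemma Gmin_le_Gmax : (E.Gmin : ℝ) ≤ E.Gmax := by
  have m : Fin E.M := Classical.arbitrary _
  exact_mod_cast (Gmin_le_clusterCard m).trans (clusterCard_le_Gmax m)

lemma sum_clusterCard : ∑ m, E.clusterCard m = E.K := by
  have h := Finset.card_eq_sum_card_fiberwise (f := E.cluster) (s := Finset.univ)
    (t := Finset.univ) (fun _ _ => Finset.mem_coe.2 (Finset.mem_univ _))
  rw [Finset.card_univ, Fintype.card_fin] at h
  exact h.symm

lemma K_le_Gmax_mul_M : (E.K : ℝ) ≤ E.Gmax * E.M := by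
  have h : E.K ≤ E.M * E.Gmax := by
    rw [← sum_clusterCard]
    refine (Finset.sum_le_card_nsmul _ _ E.Gmax fun m _ => clusterCard_le_Gmax m).trans ?_
    simp
  rw [mul_comm]
  exact_mod_cast h

lemma Gmin_le_K : (E.Gmin : ℝ) ≤ E.K := by
  have m : Fin E.M := Classical.arbitrary _
  have h : E.clusterCard m ≤ E.K := by
    rw [← sum_clusterCard]
    exact Finset.single_le_sum (f := E.clusterCard) (fun _ _ => Nat.zero_le _) (Finset.mem_univ m)
  exact_mod_cast (Gmin_le_clusterCard m).trans h

lemma N_eq : (E.N : ℝ) = E.K * E.nstar := by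
  rw [nstar, mul_div_cancel₀ _ K_pos_real.ne']

lemma clusterN_pos (hn : ∀ k, 0 < E.size k) (m : Fin E.M) : 0 < E.clusterN m := by
  obtain ⟨k, hk⟩ := E.cluster_surj m
  exact (hn k).trans_le (Finset.single_le_sum (f := E.size) (fun _ _ => Nat.zero_le _)
    (by simp [hk]))

lemma Nmin_pos (hn : ∀ k, 0 < E.size k) : (0 : ℝ) < E.Nmin := by
  obtain ⟨m, hm⟩ := E.exists_clusterN_eq_Nmin
  rw [← hm]
  exact_mod_cast clusterN_pos hn m

/-- A cluster of least cardinality, even if another has fewer observations, gives an upper bound for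
the least number of observations. -/
lemma Nmin_le {C : ℝ} (hn : ∀ k, (E.size k : ℝ) ≤ C * E.nstar) :
    (E.Nmin : ℝ) ≤ C * E.Gmin * E.nstar := by
  obtain ⟨m, hm⟩ := E.exists_clusterCard_eq_Gmin
  have h1 : (E.Nmin : ℝ) ≤ E.clusterN m := by exact_mod_cast Nmin_le_clusterN m
  refine h1.trans ?_
  rw [← hm, clusterN, Nat.cast_sum]
  refine (Finset.sum_le_card_nsmul _ _ _ fun k _ => hn k).trans (le_of_eq ?_)
  rw [nsmul_eq_mul, clusterCard]
  ring

/-! ### Tail bounds for one experiment -/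

/-- One summand of the score. -/
def scoreTerm (f : ℝ → ℝ → ℝ) (s : Σ k : Fin E.K, Fin (E.size k)) (ω : E.Ω) (j : Fin E.p) : ℝ :=
  lossD1 f (E.predictor s.1 s.2 ω) (E.y s.1 s.2 ω) * E.x s.1 s.2 ω j

variable (E) in
/-- All observations are independent. -/
def Indep : Prop := iIndepFun (fun (s : Σ k : Fin E.K, Fin (E.size k)) ω =>
  (E.x s.1 s.2 ω, E.y s.1 s.2 ω)) E.μ

lemma measurable_dotProduct_const {ι : Type*} [Fintype ι] (b : ι → ℝ) :
    Measurable fun z : (ι → ℝ) × ℝ => z.1 ⬝ᵥ b :=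
  Finset.measurable_sum _ fun j _ => ((measurable_pi_apply j).comp measurable_fst).mul_const _

lemma measurable_scoreTerm (hf : IsTwiceDiffLoss f) (s : Σ k : Fin E.K, Fin (E.size k))
    (j : Fin E.p) : Measurable fun ω => E.scoreTerm f s ω j :=
  (measurable_lossD1_comp hf s.1 s.2 measurable_const).mul (measurable_x_apply s.1 s.2 j)

lemma iIndepFun_scoreTerm (hf : IsTwiceDiffLoss f) (hindep : E.Indep) (j : Fin E.p) :
    iIndepFun (fun s ω => E.scoreTerm f s ω j) E.μ := by
  refine iIndepFun.comp hindep
    (fun s z => lossD1 f (z.1 ⬝ᵥ E.column E.θstar s.1) z.2 * z.1 j) fun s => ?_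
  exact (hf.measurable_lossD1.comp ((measurable_dotProduct_const _).prodMk measurable_snd)).mul
    ((measurable_pi_apply j).comp measurable_fst)

lemma hasSubgaussianMGF_scoreTerm (hf : IsTwiceDiffLoss f) {Cx κ : ℝ} (hCx : 0 < Cx) (hκ : 0 < κ)
    (hx : ∀ k i, ∀ᵐ ω ∂E.μ, ∀ j, |E.x k i ω j| ≤ Cx)
    (htrue : ∀ k i j, ∫ ω, lossD1 f (E.predictor k i ω) (E.y k i ω) * E.x k i ω j ∂E.μ = 0)
    (hscore : ∀ k i, subGaussianNorm (fun ω => lossD1 f (E.predictor k i ω) (E.y k i ω)) E.μ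
      ≤ ENNReal.ofReal κ) (s : Σ k : Fin E.K, Fin (E.size k)) (j : Fin E.p) :
    HasSubgaussianMGF (fun ω => E.scoreTerm f s ω j)
      (Real.toNNReal (64 * Real.exp 1 * (Cx * κ) ^ 2)) E.μ := by
  refine hasSubgaussianMGF_of_subGaussianNorm_le (measurable_scoreTerm hf s j) (mul_pos hCx hκ) ?_
    (htrue s.1 s.2 j)
  refine subGaussianNorm_mul_le hCx.le (hscore s.1 s.2) ?_
  filter_upwards [hx s.1 s.2] with ω hω
  exact hω j

/-- Sums of scores over a set of clients are sub-Gaussian, with the total number of observations as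
variance proxy. -/
lemma hasSubgaussianMGF_sum_scoreSum (hf : IsTwiceDiffLoss f) (hindep : E.Indep) {c : NNReal}
    (hsub : ∀ (s : Σ k : Fin E.K, Fin (E.size k)) (j : Fin E.p),
      HasSubgaussianMGF (fun ω => E.scoreTerm f s ω j) c E.μ)
    (A : Finset (Fin E.K)) (j : Fin E.p) :
    HasSubgaussianMGF (fun ω => ∑ k ∈ A, E.scoreSum f k ω j)
      (((∑ k ∈ A, E.size k : ℕ) : NNReal) * c) E.μ := by
  -- The double sum is read as one sum over pairs (client, observation), because independence holds
  -- jointly across clients.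
  have h := HasSubgaussianMGF.sum_of_iIndepFun (iIndepFun_scoreTerm hf hindep j)
    (c := fun _ => c) (s := A.sigma fun _ => Finset.univ) fun s _ => hsub s j
  convert h using 1
  · ext ω
    rw [Finset.sum_sigma]
    rfl
  · rw [Finset.sum_const, Finset.card_sigma, nsmul_eq_mul]
    simp

lemma hasSubgaussianMGF_scoreSum (hf : IsTwiceDiffLoss f) (hindep : E.Indep) {c : NNReal}
    (hsub : ∀ (s : Σ k : Fin E.K, Fin (E.size k)) (j : Fin E.p),
      HasSubgaussianMGF (fun ω => E.scoreTerm f s ω j) c E.μ)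
    (k : Fin E.K) (j : Fin E.p) :
    HasSubgaussianMGF (fun ω => E.scoreSum f k ω j) ((E.size k : NNReal) * c) E.μ := by
  simpa using hasSubgaussianMGF_sum_scoreSum hf hindep hsub {k} j

/-- Hoeffding's inequality for the observations of one client. -/
lemma measure_abs_sum_sub_integral_ge_le (hindep : E.Indep) (k : Fin E.K)
    {h : (Fin E.p → ℝ) × ℝ → ℝ} (hh : Measurable h) {B : ℝ} (hB : 0 ≤ B)
    (hbound : ∀ i, ∀ᵐ ω ∂E.μ, |h (E.x k i ω, E.y k i ω)| ≤ B) {t : ℝ} (ht : 0 ≤ t) :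
    E.μ {ω | t ≤ |∑ i, (h (E.x k i ω, E.y k i ω) - ∫ ω', h (E.x k i ω', E.y k i ω') ∂E.μ)|}
      ≤ ENNReal.ofReal (2 * Real.exp (-t ^ 2 / (2 * (E.size k * B ^ 2)))) := by
  have h1 : iIndepFun (fun (i : Fin (E.size k)) ω => (E.x k i ω, E.y k i ω)) E.μ :=
    iIndepFun.precomp (g := fun i : Fin (E.size k) => (⟨k, i⟩ : Σ k : Fin E.K, Fin (E.size k)))
      (fun i i' hi => by simpa using hi) hindep
  have h2 := h1.comp (fun i z => h z - ∫ ω', h (E.x k i ω', E.y k i ω') ∂E.μ)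
    (fun i => hh.sub_const _)
  have h3 : ∀ i, HasSubgaussianMGF (fun ω => h (E.x k i ω, E.y k i ω)
      - ∫ ω', h (E.x k i ω', E.y k i ω') ∂E.μ) ((‖B - -B‖₊ / 2) ^ 2) E.μ := fun i => by
    refine hasSubgaussianMGF_of_mem_Icc
      (hh.comp ((E.measurable_x k i).prodMk (E.measurable_y k i))).aemeasurable ?_
    filter_upwards [hbound i] with ω hω
    exact abs_le.1 hω
  have h4 := HasSubgaussianMGF.sum_of_iIndepFun h2 (s := Finset.univ) fun i _ => h3 i
  refine (h4.measure_abs_ge_le ht).trans (le_of_eq ?_)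
  congr 5
  have h5 : ((‖B - -B‖₊ / 2 : NNReal) : ℝ) = B := by
    rw [NNReal.coe_div, coe_nnnorm, Real.norm_eq_abs, sub_neg_eq_add, ← two_mul, abs_mul,
      abs_of_nonneg hB]
    simp
  simp [-sub_neg_eq_add, h5]

end Experiment

namespace Experiment

variable {E : Experiment.{u}} {f : ℝ → ℝ → ℝ}

/-! ### Vectors supported on the important covariates -/

lemma sum_actPart_sq (v : Fin E.p → ℝ) : ∑ j, E.actPart v j ^ 2 = ∑ j : E.Act, v j ^ 2 := by
  rw [sum_subtype_eq_ite (fun j : Fin E.p => (j : ℕ) < E.q) (fun j => v j ^ 2)]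
  refine Finset.sum_congr rfl fun j _ => ?_
  unfold actPart
  split_ifs <;> simp

lemma l2_actPart (v : Fin E.p → ℝ) : l2 (E.actPart v) = l2 (fun j : E.Act => v j) := by
  rw [l2_eq_sqrt, sum_actPart_sq, ← l2_eq_sqrt]

/-- Cauchy–Schwarz over the q important coordinates; this is where the factors q and √q in the
Hessian estimates come from. -/
lemma sum_abs_actPart_le (v : Fin E.p → ℝ) :
    (∑ j, |E.actPart v j|) ^ 2 ≤ E.q * l2 (E.actPart v) ^ 2 := by
  have h1 : ∑ j, |E.actPart v j| = ∑ j : E.Act, |v j| := by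
    rw [sum_subtype_eq_ite (fun j : Fin E.p => (j : ℕ) < E.q) (fun j => |v j|)]
    refine Finset.sum_congr rfl fun j _ => ?_
    unfold actPart
    split_ifs <;> simp
  rw [h1, l2_sq, sum_actPart_sq]
  refine (sq_sum_le_card_mul_sum_sq (s := Finset.univ) (f := fun j : E.Act => |v j|)).trans ?_
  rw [Finset.card_univ, card_act]
  simp

lemma abs_dotProduct_actPart_le {x : Fin E.p → ℝ} {Cx : ℝ} (hCx : 0 ≤ Cx) (hx : ∀ j, |x j| ≤ Cx)
    (v : Fin E.p → ℝ) : |x ⬝ᵥ E.actPart v| ≤ Cx * Real.sqrt E.q * l2 (E.actPart v) := by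
  have h1 : |x ⬝ᵥ E.actPart v| ≤ Cx * ∑ j, |E.actPart v j| := by
    rw [Finset.mul_sum]
    refine (Finset.abs_sum_le_sum_abs _ _).trans (Finset.sum_le_sum fun j _ => ?_)
    rw [abs_mul]
    exact mul_le_mul_of_nonneg_right (hx j) (abs_nonneg _)
  rw [mul_assoc]
  refine h1.trans (mul_le_mul_of_nonneg_left ?_ hCx)
  refine abs_le_of_sq_le_sq' ?_ (by have := l2_nonneg (E.actPart v); positivity) |>.2
  rw [mul_pow, Real.sq_sqrt (Nat.cast_nonneg _)]
  exact sum_abs_actPart_le v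

/-! ### Weighted second moments of the covariates -/

/-- A weight, times the product of two covariates. -/
def weightTerm (h : (Fin E.p → ℝ) × ℝ → ℝ) (j l : Fin E.p) (z : (Fin E.p → ℝ) × ℝ) : ℝ :=
  h z * z.1 j * z.1 l

lemma measurable_weightTerm {h : (Fin E.p → ℝ) × ℝ → ℝ} (hh : Measurable h) (j l : Fin E.p) :
    Measurable (E.weightTerm h j l) :=
  (hh.mul ((measurable_pi_apply j).comp measurable_fst)).mul
    ((measurable_pi_apply l).comp measurable_fst)

lemma abs_weightTerm_le {h : (Fin E.p → ℝ) × ℝ → ℝ} {B Cx : ℝ} (hB : 0 ≤ B) (hCx : 0 ≤ Cx)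
    {z : (Fin E.p → ℝ) × ℝ} (hz : |h z| ≤ B) (hx : ∀ j, |z.1 j| ≤ Cx) (j l : Fin E.p) :
    |E.weightTerm h j l z| ≤ B * Cx * Cx := by
  unfold weightTerm
  rw [abs_mul, abs_mul]
  have h1 := hx j
  have h2 := hx l
  gcongr

lemma weight_quad_eq (h : (Fin E.p → ℝ) × ℝ → ℝ) (a : Fin E.p → ℝ) (z : (Fin E.p → ℝ) × ℝ) :
    h z * (z.1 ⬝ᵥ a) ^ 2 = ∑ j, ∑ l, a j * a l * E.weightTerm h j l z := by
  rw [sq, dotProduct, Finset.sum_mul_sum, Finset.mul_sum]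
  refine Finset.sum_congr rfl fun j _ => ?_
  rw [Finset.mul_sum]
  refine Finset.sum_congr rfl fun l _ => ?_
  unfold weightTerm
  ring

/-- Boundedness of a weight and of the covariates at the observations of one client. -/
def BoundedWeight (k : Fin E.K) (h : (Fin E.p → ℝ) × ℝ → ℝ) (B Cx : ℝ) : Prop :=
  Measurable h ∧ ∀ i, ∀ᵐ ω ∂E.μ, |h (E.x k i ω, E.y k i ω)| ≤ B ∧ ∀ j, |E.x k i ω j| ≤ Cx

namespace BoundedWeight

variable {k : Fin E.K} {h : (Fin E.p → ℝ) × ℝ → ℝ} {B Cx : ℝ}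

lemma ae_abs_le (hw : BoundedWeight k h B Cx) (hB : 0 ≤ B) (hCx : 0 ≤ Cx) (j l : Fin E.p)
    (i : Fin (E.size k)) :
    ∀ᵐ ω ∂E.μ, |E.weightTerm h j l (E.x k i ω, E.y k i ω)| ≤ B * Cx * Cx := by
  filter_upwards [hw.2 i] with ω hω
  exact abs_weightTerm_le hB hCx hω.1 hω.2 j l

lemma integrable (hw : BoundedWeight k h B Cx) (hB : 0 ≤ B) (hCx : 0 ≤ Cx) (j l : Fin E.p)
    (i : Fin (E.size k)) :
    Integrable (fun ω => E.weightTerm h j l (E.x k i ω, E.y k i ω)) E.μ :=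
  Integrable.of_bound ((measurable_weightTerm hw.1 j l).comp
    ((E.measurable_x k i).prodMk (E.measurable_y k i))).aestronglyMeasurable (B * Cx * Cx)
    (hw.ae_abs_le hB hCx j l i)

lemma integral_quad (hw : BoundedWeight k h B Cx) (hB : 0 ≤ B) (hCx : 0 ≤ Cx) (a : Fin E.p → ℝ)
    (i : Fin (E.size k)) :
    ∫ ω, h (E.x k i ω, E.y k i ω) * (E.x k i ω ⬝ᵥ a) ^ 2 ∂E.μ
      = ∑ j, ∑ l, a j * a l * ∫ ω, E.weightTerm h j l (E.x k i ω, E.y k i ω) ∂E.μ := by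
  have h1 : ∀ ω, h (E.x k i ω, E.y k i ω) * (E.x k i ω ⬝ᵥ a) ^ 2
      = ∑ j, ∑ l, a j * a l * E.weightTerm h j l (E.x k i ω, E.y k i ω) :=
    fun ω => weight_quad_eq h a (E.x k i ω, E.y k i ω)
  simp only [h1]
  have hint := hw.integrable hB hCx
  rw [integral_finsetSum _ fun j _ => integrable_finsetSum _ fun l _ =>
    (hint j l i).const_mul _]
  refine Finset.sum_congr rfl fun j _ => ?_
  rw [integral_finsetSum _ fun l _ => (hint j l i).const_mul _]
  exact Finset.sum_congr rfl fun l _ => integral_const_mul _ _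

/-- Entrywise closeness to the mean bounds the deviation of the quadratic form. -/
lemma abs_quad_sub_le (hw : BoundedWeight k h B Cx) (hB : 0 ≤ B) (hCx : 0 ≤ Cx) {η : ℝ} {ω : E.Ω}
    (hclose : ∀ j l : E.Act, |(1 / (E.size k : ℝ)) * ∑ i,
      (E.weightTerm h j l (E.x k i ω, E.y k i ω)
        - ∫ ω', E.weightTerm h j l (E.x k i ω', E.y k i ω') ∂E.μ)| ≤ η / E.q)
    (v : Fin E.p → ℝ) :
    |(1 / (E.size k : ℝ)) * ∑ i, h (E.x k i ω, E.y k i ω) * (E.x k i ω ⬝ᵥ E.actPart v) ^ 2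
      - (1 / (E.size k : ℝ)) * ∑ i, ∫ ω', h (E.x k i ω', E.y k i ω')
          * (E.x k i ω' ⬝ᵥ E.actPart v) ^ 2 ∂E.μ| ≤ η * l2 (E.actPart v) ^ 2 := by
  set a := E.actPart v with ha
  set D : Fin E.p → Fin E.p → ℝ := fun j l => (1 / (E.size k : ℝ)) * ∑ i,
      (E.weightTerm h j l (E.x k i ω, E.y k i ω)
        - ∫ ω', E.weightTerm h j l (E.x k i ω', E.y k i ω') ∂E.μ) with hD
  have h1 : (1 / (E.size k : ℝ)) * ∑ i, h (E.x k i ω, E.y k i ω) * (E.x k i ω ⬝ᵥ a) ^ 2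
      - (1 / (E.size k : ℝ)) * ∑ i, ∫ ω', h (E.x k i ω', E.y k i ω')
          * (E.x k i ω' ⬝ᵥ a) ^ 2 ∂E.μ = ∑ j, ∑ l, a j * a l * D j l := by
    rw [← mul_sub, ← Finset.sum_sub_distrib]
    have h2 : ∀ i, h (E.x k i ω, E.y k i ω) * (E.x k i ω ⬝ᵥ a) ^ 2
        - ∫ ω', h (E.x k i ω', E.y k i ω') * (E.x k i ω' ⬝ᵥ a) ^ 2 ∂E.μ
        = ∑ j, ∑ l, a j * a l * (E.weightTerm h j l (E.x k i ω, E.y k i ω)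
        - ∫ ω', E.weightTerm h j l (E.x k i ω', E.y k i ω') ∂E.μ) := by
      intro i
      rw [hw.integral_quad hB hCx, weight_quad_eq h a (E.x k i ω, E.y k i ω)]
      simp only [mul_sub, Finset.sum_sub_distrib]
    simp only [h2]
    rw [Finset.sum_comm, Finset.mul_sum]
    refine Finset.sum_congr rfl fun j _ => ?_
    rw [Finset.sum_comm, Finset.mul_sum]
    refine Finset.sum_congr rfl fun l _ => ?_
    rw [← Finset.mul_sum]
    simp only [hD]
    ring
  rw [h1]
  have hq : (0 : ℝ) < E.q := by exact_mod_cast E.q_pos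
  have hη : 0 ≤ η := by
    have j : E.Act := ⟨⟨0, E.q_pos.trans_le E.q_le⟩, E.q_pos⟩
    have h3 := (abs_nonneg _).trans (hclose j j)
    by_contra hneg
    exact absurd h3 (not_le.2 (div_neg_of_neg_of_pos (not_le.1 hneg) hq))
  have h2 : ∀ j l, |a j * a l * D j l| ≤ |a j| * |a l| * (η / E.q) := by
    intro j l
    rw [abs_mul, abs_mul]
    by_cases hj : (j : ℕ) < E.q
    · by_cases hl : (l : ℕ) < E.q
      · exact mul_le_mul_of_nonneg_left (hclose ⟨j, hj⟩ ⟨l, hl⟩) (by positivity)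
      · simp [ha, actPart, hl]
    · simp [ha, actPart, hj]
  -- The ℓ¹ norm squared is at most q times the ℓ² norm squared, which cancels the 1/q in the
  -- entrywise accuracy.
  calc |∑ j, ∑ l, a j * a l * D j l|
      ≤ ∑ j, ∑ l, |a j| * |a l| * (η / E.q) := by
        refine (Finset.abs_sum_le_sum_abs _ _).trans (Finset.sum_le_sum fun j _ => ?_)
        exact (Finset.abs_sum_le_sum_abs _ _).trans (Finset.sum_le_sum fun l _ => h2 j l)
    _ = (∑ j, |a j|) ^ 2 * (η / E.q) := by
        rw [sq, Finset.sum_mul_sum, Finset.sum_mul]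
        exact Finset.sum_congr rfl fun j _ => (Finset.sum_mul _ _ _).symm
    _ ≤ (E.q * l2 a ^ 2) * (η / E.q) :=
        mul_le_mul_of_nonneg_right (sum_abs_actPart_le v) (by positivity)
    _ = _ := by field_simp

end BoundedWeight

/-! ### Regularity of one experiment -/

variable (E f) in
/-- The conditions on the data of one experiment, with explicit constants. -/
structure Regular (c Cb Cx κ CL Cmin : ℝ) : Prop where
  indep : E.Indep
  size_ge : ∀ k, c * E.nstar ≤ E.size k
  size_le : ∀ k, (E.size k : ℝ) ≤ Cb * E.nstar
  x_le : ∀ k i, ∀ᵐ ω ∂E.μ, ∀ j, |E.x k i ω j| ≤ Cx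
  x_sq : ∀ k i, ∀ v : Fin E.p → ℝ, l2 v ≤ 1 → ∫ ω, (v ⬝ᵥ E.x k i ω) ^ 2 ∂E.μ ≤ Cx
  score_mean : ∀ k i j,
    ∫ ω, lossD1 f (E.predictor k i ω) (E.y k i ω) * E.x k i ω j ∂E.μ = 0
  score_tail : ∀ k i, subGaussianNorm (fun ω => lossD1 f (E.predictor k i ω) (E.y k i ω)) E.μ
    ≤ ENNReal.ofReal κ
  curv_le : ∀ k i, ∀ᵐ ω ∂E.μ, |lossD2 f (E.predictor k i ω) (E.y k i ω)| ≤ CL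
  eigen : ∀ k, (E.EVAA f k - Cmin • (1 : Matrix E.Act E.Act ℝ)).PosSemidef

variable (E) in
/-- The growth conditions for one experiment, with an explicit constant. -/
structure LargeSample (L : ℝ) : Prop where
  K_le_p : (E.K : ℝ) ≤ E.p
  le_log : L ≤ Real.log E.p
  le_nstar : L * ((E.q : ℝ) ^ 4 * Real.log E.p) ≤ E.nstar

lemma LargeSample.mono {L L' : ℝ} (h : E.LargeSample L) (hL : L' ≤ L) : E.LargeSample L' :=
  ⟨h.K_le_p, hL.trans h.le_log,
    (mul_le_mul_of_nonneg_right hL (mul_nonneg (by positivity) log_p_nonneg)).trans h.le_nstar⟩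

lemma LargeSample.log_pos {L : ℝ} (h : E.LargeSample L) (hL : 1 ≤ L) : 0 < Real.log E.p := by
  linarith [h.le_log]

lemma LargeSample.nstar_pos {L : ℝ} (h : E.LargeSample L) (hL : 1 ≤ L) : 0 < E.nstar := by
  refine lt_of_lt_of_le ?_ h.le_nstar
  have h1 := h.log_pos hL
  have h2 : (0 : ℝ) < E.q := by exact_mod_cast E.q_pos
  positivity

lemma LargeSample.le_p {L : ℝ} (h : E.LargeSample L) : L ≤ E.p := by
  have h1 := Real.log_le_sub_one_of_pos (lt_of_lt_of_le one_pos (E.one_le_p))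
  linarith [h.le_log]

lemma LargeSample.size_ge {L c : ℝ} (h : E.LargeSample L) (hc : 0 ≤ c)
    (hsize : ∀ k, c * E.nstar ≤ E.size k) (k : Fin E.K) :
    c * L * ((E.q : ℝ) ^ 4 * Real.log E.p) ≤ E.size k := by
  refine le_trans ?_ (hsize k)
  rw [mul_assoc]
  exact mul_le_mul_of_nonneg_left h.le_nstar hc

lemma LargeSample.size_pos {L c : ℝ} (h : E.LargeSample L) (hL : 1 ≤ L) (hc : 0 < c)
    (hsize : ∀ k, c * E.nstar ≤ E.size k) (k : Fin E.K) : 0 < E.size k := by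
  have h1 := (mul_pos hc (h.nstar_pos hL)).trans_le (hsize k)
  exact_mod_cast h1

lemma measure_exists_le {ι : Type*} [Fintype ι] {P : ι → E.Ω → Prop} {b : ℝ}
    (h : ∀ a, E.μ {ω | P a ω} ≤ ENNReal.ofReal b) :
    E.μ {ω | ∃ a, P a ω} ≤ ENNReal.ofReal (Fintype.card ι * b) := by
  have h1 : {ω | ∃ a, P a ω} = ⋃ a, {ω | P a ω} := by ext; simp
  rw [h1]
  refine (measure_iUnion_fintype_le _ _).trans ((Finset.sum_le_card_nsmul _ _ _
    fun a _ => h a).trans (le_of_eq ?_))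
  rw [nsmul_eq_mul, Finset.card_univ, ENNReal.ofReal_mul (Nat.cast_nonneg _),
    ENNReal.ofReal_natCast]

/-- Uniform entrywise concentration over all clients. -/
lemma measure_exists_entry_le {c Cb Cx κ CL Cmin : ℝ} (hreg : E.Regular f c Cb Cx κ CL Cmin)
    (hc : 0 < c) {B η ε L : ℝ} (hCx : 0 < Cx) (hB : 0 < B) (hη : 0 < η) (hε : 0 < ε)
    (hL : 1 ≤ L) (hL1 : 8 * (B * Cx * Cx) ^ 2 / (c * η ^ 2) ≤ L) (hL2 : 2 / ε ≤ L)
    (hlarge : E.LargeSample L) (h : Fin E.K → (Fin E.p → ℝ) × ℝ → ℝ)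
    (hw : ∀ k, BoundedWeight k (h k) B Cx) :
    E.μ {ω | ∃ a : Fin E.K × E.Act × E.Act, η / E.q < |(1 / (E.size a.1 : ℝ)) * ∑ i,
      (E.weightTerm (h a.1) a.2.1 a.2.2 (E.x a.1 i ω, E.y a.1 i ω)
        - ∫ ω', E.weightTerm (h a.1) a.2.1 a.2.2 (E.x a.1 i ω', E.y a.1 i ω') ∂E.μ)|}
      ≤ ENNReal.ofReal ε := by
  have hp : (0 : ℝ) < E.p := lt_of_lt_of_le one_pos one_le_p
  have hq : (0 : ℝ) < E.q := lt_of_lt_of_le one_pos one_le_q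
  have hlog := hlarge.log_pos hL
  -- Each entry fails with probability at most 2p⁻⁴, and there are Kq² ≤ p³ entries, which leaves
  -- 2/p ≤ ε.
  refine (measure_exists_le (b := 2 * Real.exp (-(4 * Real.log E.p))) ?_).trans
    (ENNReal.ofReal_le_ofReal ?_)
  · rintro ⟨k, j, l⟩
    have hn : (0 : ℝ) < E.size k := by exact_mod_cast hlarge.size_pos hL hc hreg.size_ge k
    have h1 := measure_abs_sum_sub_integral_ge_le hreg.indep k (measurable_weightTerm (hw k).1 j.1 l.1)
      (B := B * Cx * Cx) (by positivity) ((hw k).ae_abs_le hB.le hCx.le j l)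
      (t := E.size k * (η / E.q)) (by positivity)
    refine (measure_mono ?_).trans (h1.trans (ENNReal.ofReal_le_ofReal ?_))
    · intro ω hω
      simp only [Set.mem_ofPred_eq] at hω ⊢
      rw [abs_mul, abs_of_nonneg (by positivity : (0 : ℝ) ≤ 1 / (E.size k : ℝ)),
        one_div_mul_eq_div, lt_div_iff₀ hn] at hω
      rw [mul_comm]
      exact hω.le
    · refine mul_le_mul_of_nonneg_left (Real.exp_le_exp.2 ?_) (by norm_num)
      have hBC : 0 < B * Cx * Cx := by positivity
      have h2 : -(E.size k * (η / E.q)) ^ 2 / (2 * (E.size k * (B * Cx * Cx) ^ 2))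
          = -(E.size k * (η ^ 2 / (2 * (B * Cx * Cx) ^ 2 * (E.q : ℝ) ^ 2))) := by
        field_simp
      rw [h2, neg_le_neg_iff]
      have h3 := hlarge.size_ge hc.le hreg.size_ge k
      have h4 : 8 * (B * Cx * Cx) ^ 2 ≤ L * (c * η ^ 2) := (div_le_iff₀ (by positivity)).1 hL1
      have h5 : (1 : ℝ) ≤ (E.q : ℝ) ^ 2 := one_le_pow₀ one_le_q
      rw [← mul_div_assoc, le_div_iff₀ (by positivity)]
      calc 4 * Real.log E.p * (2 * (B * Cx * Cx) ^ 2 * (E.q : ℝ) ^ 2)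
          = 8 * (B * Cx * Cx) ^ 2 * (Real.log E.p * (E.q : ℝ) ^ 2) := by ring
        _ ≤ L * (c * η ^ 2) * (Real.log E.p * (E.q : ℝ) ^ 2) := by gcongr
        _ ≤ L * (c * η ^ 2) * (Real.log E.p * (E.q : ℝ) ^ 2) * (E.q : ℝ) ^ 2 :=
            le_mul_of_one_le_right (by positivity) h5
        _ = c * L * ((E.q : ℝ) ^ 4 * Real.log E.p) * η ^ 2 := by ring
        _ ≤ E.size k * η ^ 2 := by gcongr
  · rw [Fintype.card_prod, Fintype.card_prod, card_act, Fintype.card_fin]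
    push_cast
    have h1 : Real.exp (-(4 * Real.log E.p)) = 1 / (E.p : ℝ) ^ 4 := by
      rw [Real.exp_neg, show 4 * Real.log (E.p : ℝ) = ((4 : ℕ) : ℝ) * Real.log E.p by norm_num,
        Real.exp_nat_mul, Real.exp_log hp, one_div]
    have h2 : (E.K : ℝ) * (E.q * E.q) ≤ E.p * (E.p * E.p) := by
      have h3 := hlarge.K_le_p
      have h4 := E.q_le_p
      gcongr
    rw [h1]
    calc (E.K : ℝ) * (E.q * E.q) * (2 * (1 / (E.p : ℝ) ^ 4))
        ≤ (E.p : ℝ) * (E.p * E.p) * (2 * (1 / (E.p : ℝ) ^ 4)) := by gcongr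
      _ = 2 / (E.p : ℝ) := by field_simp
      _ ≤ ε := by
          rw [div_le_iff₀ hp, mul_comm, ← div_le_iff₀ hε]
          exact hL2.trans hlarge.le_p

end Experiment

namespace Experiment

variable {E : Experiment.{u}} {f : ℝ → ℝ → ℝ}

/-! ### Quadratic forms at the truth -/

lemma boundedWeight_curv {c Cb Cx κ CL Cmin : ℝ} (hf : IsTwiceDiffLoss f)
    (hreg : E.Regular f c Cb Cx κ CL Cmin) (k : Fin E.K) :
    BoundedWeight k (fun z => lossD2 f (z.1 ⬝ᵥ E.column E.θstar k) z.2) CL Cx := by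
  refine ⟨hf.measurable_lossD2.comp
    ((measurable_dotProduct_const _).prodMk measurable_snd), fun i => ?_⟩
  filter_upwards [hreg.curv_le k i, hreg.x_le k i] with ω h1 h2
  exact ⟨h1, h2⟩

lemma boundedWeight_one {c Cb Cx κ CL Cmin : ℝ}
    (hreg : E.Regular f c Cb Cx κ CL Cmin) (k : Fin E.K) :
    BoundedWeight k (fun _ => (1 : ℝ)) 1 Cx := by
  refine ⟨measurable_const, fun i => ?_⟩
  filter_upwards [hreg.x_le k i] with ω h2
  exact ⟨by simp, h2⟩

lemma EV_apply {c Cb Cx κ CL Cmin : ℝ} (hf : IsTwiceDiffLoss f)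
    (hreg : E.Regular f c Cb Cx κ CL Cmin) (hCx : 0 ≤ Cx) (hCL : 0 ≤ CL) (k : Fin E.K)
    (j l : Fin E.p) :
    E.EV f k j l = (1 / (E.size k : ℝ)) * ∑ i, ∫ ω,
      E.weightTerm (fun z => lossD2 f (z.1 ⬝ᵥ E.column E.θstar k) z.2) j l
        (E.x k i ω, E.y k i ω) ∂E.μ := by
  unfold EV
  simp only [hess_apply hf]
  rw [integral_const_mul]
  congr 1
  exact integral_finsetSum _ fun i _ =>
    (boundedWeight_curv hf hreg k).integrable hCL hCx j l i

lemma actPart_dotProduct_EV {c Cb Cx κ CL Cmin : ℝ} (hf : IsTwiceDiffLoss f)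
    (hreg : E.Regular f c Cb Cx κ CL Cmin) (hCx : 0 ≤ Cx) (hCL : 0 ≤ CL) (k : Fin E.K)
    (v : Fin E.p → ℝ) :
    (1 / (E.size k : ℝ)) * ∑ i, ∫ ω, lossD2 f (E.x k i ω ⬝ᵥ E.column E.θstar k) (E.y k i ω)
          * (E.x k i ω ⬝ᵥ v) ^ 2 ∂E.μ = v ⬝ᵥ (E.EV f k *ᵥ v) := by
  have h1 : ∀ i, ∫ ω, lossD2 f (E.x k i ω ⬝ᵥ E.column E.θstar k) (E.y k i ω)
      * (E.x k i ω ⬝ᵥ v) ^ 2 ∂E.μ = ∑ j, ∑ l, v j * v l * ∫ ω, E.weightTerm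
        (fun z => lossD2 f (z.1 ⬝ᵥ E.column E.θstar k) z.2) j l (E.x k i ω, E.y k i ω) ∂E.μ :=
    (boundedWeight_curv hf hreg k).integral_quad hCL hCx v
  have h2 : v ⬝ᵥ (E.EV f k *ᵥ v) = ∑ j, v j * ∑ l, E.EV f k j l * v l := rfl
  rw [h2]
  simp only [h1, EV_apply hf hreg hCx hCL, Finset.mul_sum, Finset.sum_mul]
  rw [Finset.sum_comm]
  refine Finset.sum_congr rfl fun j _ => ?_
  rw [Finset.sum_comm]
  refine Finset.sum_congr rfl fun l _ => Finset.sum_congr rfl fun i _ => ?_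
  ring

lemma le_actPart_dotProduct_EV {c Cb Cx κ CL Cmin : ℝ}
    (hreg : E.Regular f c Cb Cx κ CL Cmin) (k : Fin E.K) (v : Fin E.p → ℝ) :
    Cmin * l2 (E.actPart v) ^ 2 ≤ E.actPart v ⬝ᵥ (E.EV f k *ᵥ E.actPart v) := by
  have h1 := (hreg.eigen k).dotProduct_mulVec_nonneg (fun j : E.Act => v j)
  rw [star_trivial, Matrix.sub_mulVec, dotProduct_sub, Matrix.smul_mulVec, Matrix.one_mulVec,
    dotProduct_smul, smul_eq_mul] at h1
  have h2 : (fun j : E.Act => v j) ⬝ᵥ (fun j : E.Act => v j) = l2 (E.actPart v) ^ 2 := by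
    rw [l2_sq, sum_actPart_sq]
    exact Finset.sum_congr rfl fun j _ => (sq _).symm
  have h3 : (fun j : E.Act => v j) ⬝ᵥ (E.EVAA f k *ᵥ fun j : E.Act => v j)
      = E.actPart v ⬝ᵥ (E.EV f k *ᵥ E.actPart v) := by
    refine (sum_subtype_eq_ite (fun j : Fin E.p => (j : ℕ) < E.q)
      (fun j => v j * ∑ l : E.Act, E.EV f k j l * v l)).trans ?_
    simp only [dotProduct, Matrix.mulVec]
    refine Finset.sum_congr rfl fun j _ => ?_
    rw [sum_subtype_eq_ite (fun l : Fin E.p => (l : ℕ) < E.q) (fun l => E.EV f k j l * v l)]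
    unfold actPart
    split_ifs with hj
    · congr 1
      refine Finset.sum_congr rfl fun l _ => ?_
      split_ifs <;> simp
    · simp
  rw [h2, h3] at h1
  linarith

/-- Homogeneity extends the bound from the unit ball to all directions. -/
lemma integral_sq_dotProduct_le {c Cb Cx κ CL Cmin : ℝ}
    (hreg : E.Regular f c Cb Cx κ CL Cmin) (k : Fin E.K) (i : Fin (E.size k)) (v : Fin E.p → ℝ) :
    ∫ ω, (E.x k i ω ⬝ᵥ v) ^ 2 ∂E.μ ≤ Cx * l2 v ^ 2 := by
  by_cases hv : v = 0
  · simp [hv]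
  have hpos : 0 < l2 v := lt_of_le_of_ne (l2_nonneg v) fun h => hv (l2_eq_zero_iff.1 h.symm)
  have h1 := hreg.x_sq k i ((l2 v)⁻¹ • v) (by
    rw [l2_smul, abs_of_pos (inv_pos.2 hpos), inv_mul_cancel₀ hpos.ne'])
  have h2 : ∀ ω, ((l2 v)⁻¹ • v ⬝ᵥ E.x k i ω) ^ 2 = ((l2 v)⁻¹) ^ 2 * (E.x k i ω ⬝ᵥ v) ^ 2 := by
    intro ω
    rw [smul_dotProduct, smul_eq_mul, mul_pow, dotProduct_comm]
  simp only [h2] at h1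
  rw [integral_const_mul, inv_pow, inv_mul_le_iff₀ (by positivity)] at h1
  linarith

/-! ### The event on which the deterministic analysis applies -/

variable (E f) in
/-- The event on which the local quadratic surrogates behave well. -/
structure GoodEvent (Cx CL Cmin C : ℝ) (ω : E.Ω) : Prop where
  x_le : ∀ k i j, |E.x k i ω j| ≤ Cx
  curv_le : ∀ k i, |lossD2 f (E.predictor k i ω) (E.y k i ω)| ≤ CL
  pred_le : ∀ k, 1 / Real.sqrt (E.size k) * l2 (fun i => E.predError k i ω) ≤ C * E.localRate
  hess_ge : ∀ k v, Cmin / 2 * l2 (E.actPart v) ^ 2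
    ≤ E.actPart v ⬝ᵥ (E.hess f k ω (E.column E.θstar k) *ᵥ E.actPart v)
  gram_le : ∀ k v, 1 / (E.size k : ℝ) * ∑ i, (E.x k i ω ⬝ᵥ E.actPart v) ^ 2
    ≤ (Cx + 1) * l2 (E.actPart v) ^ 2
  score_le : ∀ k j, |E.scoreSum f k ω j| ≤ C * (E.size k * Real.sqrt (Real.log E.p / E.nstar))
  score_cluster_le : ∑ m, (E.clusterCard m : ℝ) / (E.clusterN m : ℝ) ^ 2 * ∑ j : E.Act,
    (∑ k ∈ Finset.univ.filter (fun k => E.cluster k = m), E.scoreSum f k ω j) ^ 2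
      ≤ C * (E.K * E.q / E.Nmin)
  score_client_le : ∑ k, ∑ j : E.Act, (1 / (E.size k : ℝ) * E.scoreSum f k ω j) ^ 2
      ≤ C * (E.K * E.q / E.nstar)

/-! ### Probabilities of the components of the good event -/

section Probability

variable {c Cb Cx κ CL Cmin : ℝ}

lemma ae_x_le_and_curv_le (hreg : E.Regular f c Cb Cx κ CL Cmin) :
    E.μ {ω | ¬ ((∀ k i j, |E.x k i ω j| ≤ Cx) ∧
      ∀ k i, |lossD2 f (E.predictor k i ω) (E.y k i ω)| ≤ CL)} = 0 := by
  have h1 : ∀ᵐ ω ∂E.μ, ∀ k i j, |E.x k i ω j| ≤ Cx := by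
    simp only [ae_all_iff]
    intro k i j
    filter_upwards [hreg.x_le k i] with ω hω
    exact hω j
  have h2 : ∀ᵐ ω ∂E.μ, ∀ k i, |lossD2 f (E.predictor k i ω) (E.y k i ω)| ≤ CL := by
    simp only [ae_all_iff]
    exact hreg.curv_le
  exact ae_iff.1 (h1.and h2)

/-- At the truth the Hessian entries average independent bounded variables, which need not hold at
the data-dependent local estimator. Entrywise accuracy Cmin/(2q) costs half of the least eigenvalue.
-/
lemma measure_not_hess_ge_le (hf : IsTwiceDiffLoss f) (hreg : E.Regular f c Cb Cx κ CL Cmin)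
    (hc : 0 < c) (hCx : 0 < Cx) (hCL : 0 < CL) (hCmin : 0 < Cmin) {ε L : ℝ} (hε : 0 < ε)
    (hL : 1 ≤ L) (hL1 : 8 * (CL * Cx * Cx) ^ 2 / (c * (Cmin / 2) ^ 2) ≤ L) (hL2 : 2 / ε ≤ L)
    (hlarge : E.LargeSample L) :
    E.μ {ω | ¬ ∀ k v, Cmin / 2 * l2 (E.actPart v) ^ 2
      ≤ E.actPart v ⬝ᵥ (E.hess f k ω (E.column E.θstar k) *ᵥ E.actPart v)}
      ≤ ENNReal.ofReal ε := by
  refine (measure_mono ?_).trans (measure_exists_entry_le hreg hc hCx hCL (half_pos hCmin) hε hL hL1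
    hL2 hlarge _ (boundedWeight_curv hf hreg))
  intro ω hω
  by_contra hcon
  refine hω fun k v => ?_
  simp only [Set.mem_ofPred_eq, not_exists, not_lt] at hcon
  have h1 := (boundedWeight_curv hf hreg k).abs_quad_sub_le hCL.le hCx.le (η := Cmin / 2) (ω := ω)
    (fun j l => hcon (k, j, l)) v
  simp only at h1
  rw [actPart_dotProduct_EV hf hreg hCx.le hCL.le] at h1
  have h2 := le_actPart_dotProduct_EV hreg k v
  rw [dotProduct_hess_mulVec hf]
  simp only [mul_assoc, ← sq] at h1 ⊢
  linarith [(abs_le.1 h1).1]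

/-- The same concentration with weight one and η = 1, which is the 1 added to the second-moment
bound Cx. -/
lemma measure_not_gram_le_le (hreg : E.Regular f c Cb Cx κ CL Cmin)
    (hc : 0 < c) (hCx : 0 < Cx) {ε L : ℝ} (hε : 0 < ε)
    (hL : 1 ≤ L) (hL1 : 8 * (1 * Cx * Cx) ^ 2 / (c * 1 ^ 2) ≤ L) (hL2 : 2 / ε ≤ L)
    (hlarge : E.LargeSample L) :
    E.μ {ω | ¬ ∀ k v, 1 / (E.size k : ℝ) * ∑ i, (E.x k i ω ⬝ᵥ E.actPart v) ^ 2
      ≤ (Cx + 1) * l2 (E.actPart v) ^ 2} ≤ ENNReal.ofReal ε := by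
  refine (measure_mono ?_).trans (measure_exists_entry_le hreg hc hCx one_pos one_pos hε hL hL1
    hL2 hlarge _ (boundedWeight_one hreg))
  intro ω hω
  by_contra hcon
  refine hω fun k v => ?_
  simp only [Set.mem_ofPred_eq, not_exists, not_lt] at hcon
  have h1 := (boundedWeight_one hreg k).abs_quad_sub_le zero_le_one hCx.le (η := 1) (ω := ω)
    (fun j l => hcon (k, j, l)) v
  simp only [one_mul] at h1
  have hn : (0 : ℝ) < E.size k := by exact_mod_cast hlarge.size_pos hL hc hreg.size_ge k
  have h2 : (1 / (E.size k : ℝ)) * ∑ i, ∫ ω', (E.x k i ω' ⬝ᵥ E.actPart v) ^ 2 ∂E.μ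
      ≤ Cx * l2 (E.actPart v) ^ 2 := by
    rw [one_div_mul_eq_div, div_le_iff₀ hn]
    refine (Finset.sum_le_card_nsmul _ _ _ fun i _ =>
      integral_sq_dotProduct_le hreg k i (E.actPart v)).trans (le_of_eq ?_)
    simp
    ring
  linarith [(abs_le.1 h1).2]

/-- The condition 6σ ≤ C²c makes the tail exponent at least 3 log p, so the union over Kp ≤ p²
scores leaves 2/p. -/
lemma measure_not_score_le_le (hf : IsTwiceDiffLoss f) (hreg : E.Regular f c Cb Cx κ CL Cmin)
    (hc : 0 < c) {σ : NNReal} (hσ : 0 < σ)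
    (hsub : ∀ (s : Σ k : Fin E.K, Fin (E.size k)) (j : Fin E.p),
      HasSubgaussianMGF (fun ω => E.scoreTerm f s ω j) σ E.μ)
    {C ε L : ℝ} (hC : 0 < C) (hC2 : 6 * σ ≤ C ^ 2 * c) (hε : 0 < ε) (hL : 1 ≤ L) (hL2 : 2 / ε ≤ L)
    (hlarge : E.LargeSample L) :
    E.μ {ω | ¬ ∀ k j, |E.scoreSum f k ω j|
      ≤ C * (E.size k * Real.sqrt (Real.log E.p / E.nstar))} ≤ ENNReal.ofReal ε := by
  have hp : (0 : ℝ) < E.p := lt_of_lt_of_le one_pos one_le_p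
  have hlog := hlarge.log_pos hL
  have hstar := hlarge.nstar_pos hL
  have hσ' : (0 : ℝ) < σ := by exact_mod_cast hσ
  have hset : {ω | ¬ ∀ k j, |E.scoreSum f k ω j|
      ≤ C * (E.size k * Real.sqrt (Real.log E.p / E.nstar))}
      = {ω | ∃ a : Fin E.K × Fin E.p, C * (E.size a.1 * Real.sqrt (Real.log E.p / E.nstar))
          < |E.scoreSum f a.1 ω a.2|} := by
    ext ω
    simp
  rw [hset]
  refine (measure_exists_le (b := 2 * Real.exp (-(3 * Real.log E.p))) ?_).trans
    (ENNReal.ofReal_le_ofReal ?_)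
  · rintro ⟨k, j⟩
    have hn : (0 : ℝ) < E.size k := by exact_mod_cast hlarge.size_pos hL hc hreg.size_ge k
    have h1 := (hasSubgaussianMGF_scoreSum hf hreg.indep hsub k j).measure_abs_ge_le
      (t := C * (E.size k * Real.sqrt (Real.log E.p / E.nstar))) (by positivity)
    refine (measure_mono fun ω hω => ?_).trans (h1.trans (ENNReal.ofReal_le_ofReal ?_))
    · have h2 : C * (E.size k * Real.sqrt (Real.log E.p / E.nstar)) < |E.scoreSum f k ω j| := hω
      exact h2.le
    · refine mul_le_mul_of_nonneg_left (Real.exp_le_exp.2 ?_) (by norm_num)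
      rw [mul_pow, mul_pow, Real.sq_sqrt (by positivity), neg_div, neg_le_neg_iff]
      push_cast
      have h3 := hreg.size_ge k
      rw [le_div_iff₀ (by positivity)]
      calc 3 * Real.log E.p * (2 * (E.size k * σ))
          = 6 * σ * (E.size k * Real.log E.p) := by ring
        _ ≤ C ^ 2 * c * (E.size k * Real.log E.p) := by gcongr
        _ = C ^ 2 * (c * E.nstar * E.size k * (Real.log E.p / E.nstar)) := by field_simp
        _ ≤ C ^ 2 * (E.size k * E.size k * (Real.log E.p / E.nstar)) := by gcongr
        _ = _ := by ring
  · rw [Fintype.card_prod, Fintype.card_fin, Fintype.card_fin]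
    push_cast
    have h1 : Real.exp (-(3 * Real.log E.p)) = 1 / (E.p : ℝ) ^ 3 := by
      rw [Real.exp_neg, show 3 * Real.log (E.p : ℝ) = ((3 : ℕ) : ℝ) * Real.log E.p by norm_num,
        Real.exp_nat_mul, Real.exp_log hp, one_div]
    rw [h1]
    have h3 := hlarge.K_le_p
    calc (E.K : ℝ) * E.p * (2 * (1 / (E.p : ℝ) ^ 3))
        ≤ (E.p : ℝ) * E.p * (2 * (1 / (E.p : ℝ) ^ 3)) := by gcongr
      _ = 2 / (E.p : ℝ) := by field_simp
      _ ≤ ε := by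
          rw [div_le_iff₀ hp, mul_comm, ← div_le_iff₀ hε]
          exact hL2.trans hlarge.le_p

/-- Markov's inequality. The pooled score of cluster m has second moment at most 8σ times its number
of observations in each coordinate; weighting by |G_m|/N_m², as in the oracle error summed over
clients, gives at most 8σqΣ|G_m|/N_m ≤ 8σKq/N_min. -/
lemma measure_not_score_cluster_le_le (hf : IsTwiceDiffLoss f)
    (hindep : E.Indep) (hsize : ∀ k, 0 < E.size k) {σ : NNReal} (hσ : 0 < σ)
    (hsub : ∀ (s : Σ k : Fin E.K, Fin (E.size k)) (j : Fin E.p),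
      HasSubgaussianMGF (fun ω => E.scoreTerm f s ω j) σ E.μ)
    {C ε : ℝ} (hε : 0 < ε) (hC : 8 * σ / ε ≤ C) :
    E.μ {ω | ¬ ∑ m, (E.clusterCard m : ℝ) / (E.clusterN m : ℝ) ^ 2 * ∑ j : E.Act,
      (∑ k ∈ Finset.univ.filter (fun k => E.cluster k = m), E.scoreSum f k ω j) ^ 2
        ≤ C * (E.K * E.q / E.Nmin)} ≤ ENNReal.ofReal ε := by
  have hσ' : (0 : ℝ) < σ := by exact_mod_cast hσ
  have hN := E.Nmin_pos hsize
  have hK := E.K_pos_real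
  have hq : (0 : ℝ) < E.q := lt_of_lt_of_le one_pos one_le_q
  have hsubG : ∀ (m : Fin E.M) (j : E.Act), HasSubgaussianMGF (fun ω =>
      ∑ k ∈ Finset.univ.filter (fun k => E.cluster k = m), E.scoreSum f k ω j)
      ((E.clusterN m : NNReal) * σ) E.μ := fun m j =>
    hasSubgaussianMGF_sum_scoreSum hf hindep hsub _ j
  have hint : ∀ (m : Fin E.M) (j : E.Act), Integrable (fun ω =>
      (∑ k ∈ Finset.univ.filter (fun k => E.cluster k = m), E.scoreSum f k ω j) ^ 2) E.μ :=
    fun m j => ((hsubG m j).memLp 2).integrable_sq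
  have hsq : ∀ (m : Fin E.M) (j : E.Act), ∫ ω,
      (∑ k ∈ Finset.univ.filter (fun k => E.cluster k = m), E.scoreSum f k ω j) ^ 2 ∂E.μ
        ≤ 8 * (E.clusterN m * σ) := by
    intro m j
    have hm : (0 : NNReal) < E.clusterN m := by exact_mod_cast clusterN_pos hsize m
    have := (hsubG m j).integral_sq_le (mul_pos hm hσ)
    simpa using this
  have hintA : ∀ m : Fin E.M, Integrable (fun ω => (E.clusterCard m : ℝ) / (E.clusterN m : ℝ) ^ 2 *
      ∑ j : E.Act, (∑ k ∈ Finset.univ.filter (fun k => E.cluster k = m),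
        E.scoreSum f k ω j) ^ 2) E.μ :=
    fun m => (integrable_finsetSum _ fun j _ => hint m j).const_mul _
  have hA : 0 < 8 * σ * (E.K * E.q / E.Nmin : ℝ) := by positivity
  have h1 := measure_lt_le_of_integral_le (integrable_finsetSum Finset.univ fun m _ => hintA m)
    (fun ω => Finset.sum_nonneg fun m _ => by positivity) hA (C := 1 / ε) (by positivity) (by
      rw [integral_finsetSum _ fun m _ => hintA m]
      calc ∑ m, ∫ ω, (E.clusterCard m : ℝ) / (E.clusterN m : ℝ) ^ 2 * ∑ j : E.Act,
            (∑ k ∈ Finset.univ.filter (fun k => E.cluster k = m), E.scoreSum f k ω j) ^ 2 ∂E.μ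
          ≤ ∑ m, (E.clusterCard m : ℝ) * (8 * σ * E.q / E.Nmin) := by
            refine Finset.sum_le_sum fun m _ => ?_
            have hm : (0 : ℝ) < E.clusterN m := by exact_mod_cast clusterN_pos hsize m
            have hmN : (E.Nmin : ℝ) ≤ E.clusterN m := by exact_mod_cast Nmin_le_clusterN m
            rw [integral_const_mul, integral_finsetSum _ fun j _ => hint m j]
            have h2 : ∑ j : E.Act, ∫ ω, (∑ k ∈ Finset.univ.filter (fun k => E.cluster k = m),
                E.scoreSum f k ω j) ^ 2 ∂E.μ ≤ E.q * (8 * (E.clusterN m * σ)) := by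
              refine (Finset.sum_le_card_nsmul _ _ _ fun j _ => hsq m j).trans (le_of_eq ?_)
              rw [Finset.card_univ, card_act, nsmul_eq_mul]
            calc _ ≤ (E.clusterCard m : ℝ) / (E.clusterN m : ℝ) ^ 2
                  * (E.q * (8 * (E.clusterN m * σ))) := by gcongr
              _ = (E.clusterCard m : ℝ) * (8 * σ * E.q / E.clusterN m) := by field_simp
              _ ≤ _ := by gcongr
        _ = 8 * σ * (E.K * E.q / E.Nmin) := by
            rw [← Finset.sum_mul, ← Nat.cast_sum, sum_clusterCard]
            ring)
  rw [one_div_one_div] at h1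
  refine (measure_mono fun ω hω => ?_).trans h1
  simp only [Set.mem_ofPred_eq, not_le] at hω ⊢
  refine lt_of_le_of_lt ?_ hω
  calc 1 / ε * (8 * σ * (E.K * E.q / E.Nmin)) = 8 * σ / ε * (E.K * E.q / E.Nmin : ℝ) := by ring
    _ ≤ _ := by gcongr

/-- Markov's inequality for all clients at once. It will bound single clients crudely, losing a
factor √K that the weights n_k/N can afford, and it avoids a union bound with its logarithm. -/
lemma measure_not_score_client_le_le (hf : IsTwiceDiffLoss f)
    (hreg : E.Regular f c Cb Cx κ CL Cmin) (hc : 0 < c) (hstar : 0 < E.nstar) {σ : NNReal}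
    (hσ : 0 < σ) (hsub : ∀ (s : Σ k : Fin E.K, Fin (E.size k)) (j : Fin E.p),
      HasSubgaussianMGF (fun ω => E.scoreTerm f s ω j) σ E.μ)
    {C ε : ℝ} (hε : 0 < ε) (hC : 8 * σ / (c * ε) ≤ C) :
    E.μ {ω | ¬ ∑ k, ∑ j : E.Act, (1 / (E.size k : ℝ) * E.scoreSum f k ω j) ^ 2
        ≤ C * (E.K * E.q / E.nstar)} ≤ ENNReal.ofReal ε := by
  have hσ' : (0 : ℝ) < σ := by exact_mod_cast hσ
  have hK := E.K_pos_real
  have hq : (0 : ℝ) < E.q := lt_of_lt_of_le one_pos one_le_q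
  have hn : ∀ k, (0 : ℝ) < E.size k := fun k => (mul_pos hc hstar).trans_le (hreg.size_ge k)
  have hsubG : ∀ k (j : E.Act), HasSubgaussianMGF (fun ω => E.scoreSum f k ω j)
      ((E.size k : NNReal) * σ) E.μ := fun k j => hasSubgaussianMGF_scoreSum hf hreg.indep hsub k j
  have hint : ∀ k (j : E.Act),
      Integrable (fun ω => (1 / (E.size k : ℝ) * E.scoreSum f k ω j) ^ 2) E.μ :=
    fun k j => (((hsubG k j).memLp 2).const_mul (1 / (E.size k : ℝ))).integrable_sq
  have hsq : ∀ k (j : E.Act), ∫ ω, (1 / (E.size k : ℝ) * E.scoreSum f k ω j) ^ 2 ∂E.μ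
        ≤ 8 * σ / (c * E.nstar) := by
    intro k j
    have hm : (0 : NNReal) < E.size k := by exact_mod_cast hn k
    have h1 := (hsubG k j).integral_sq_le (mul_pos hm hσ)
    have h2 := hreg.size_ge k
    have h3 := hn k
    simp only [mul_pow]
    rw [integral_const_mul]
    calc (1 / (E.size k : ℝ)) ^ 2 * ∫ ω, E.scoreSum f k ω j ^ 2 ∂E.μ
        ≤ (1 / (E.size k : ℝ)) ^ 2 * (8 * ((E.size k : NNReal) * σ : NNReal)) := by gcongr
      _ = 8 * (σ : ℝ) / E.size k := by push_cast; field_simp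
      _ ≤ _ := by gcongr
  have hintA : ∀ k, Integrable (fun ω =>
      ∑ j : E.Act, (1 / (E.size k : ℝ) * E.scoreSum f k ω j) ^ 2) E.μ :=
    fun k => integrable_finsetSum _ fun j _ => hint k j
  have hA : 0 < 8 * σ / c * (E.K * E.q / E.nstar : ℝ) := by positivity
  have h1 := measure_lt_le_of_integral_le (integrable_finsetSum Finset.univ fun k _ => hintA k)
    (fun ω => Finset.sum_nonneg fun k _ => by positivity) hA (C := 1 / ε) (by positivity) (by
      rw [integral_finsetSum _ fun k _ => hintA k]
      calc ∑ k, ∫ ω, ∑ j : E.Act, (1 / (E.size k : ℝ) * E.scoreSum f k ω j) ^ 2 ∂E.μ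
          ≤ ∑ _k : Fin E.K, (E.q : ℝ) * (8 * σ / (c * E.nstar)) := by
            refine Finset.sum_le_sum fun k _ => ?_
            rw [integral_finsetSum _ fun j _ => hint k j]
            refine (Finset.sum_le_card_nsmul _ _ _ fun j _ => hsq k j).trans (le_of_eq ?_)
            rw [Finset.card_univ, card_act, nsmul_eq_mul]
        _ = 8 * σ / c * (E.K * E.q / E.nstar) := by
            rw [Finset.sum_const, Finset.card_univ, Fintype.card_fin, nsmul_eq_mul]
            field_simp)
  rw [one_div_one_div] at h1
  refine (measure_mono fun ω hω => ?_).trans h1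
  simp only [Set.mem_ofPred_eq, not_le] at hω ⊢
  refine lt_of_le_of_lt ?_ hω
  calc 1 / ε * (8 * σ / c * (E.K * E.q / E.nstar))
      = 8 * σ / (c * ε) * (E.K * E.q / E.nstar : ℝ) := by field_simp
    _ ≤ _ := by gcongr

end Probability

end Experiment

/-! ### Deterministic Hessian and gradient bounds on the good event -/

lemma l2_le_l2_of_abs_le {ι : Type*} [Fintype ι] {v w : ι → ℝ} (h : ∀ i, |v i| ≤ w i) :
    l2 v ≤ l2 w := by
  refine l2_le_of_sq_le (l2_nonneg w) ?_
  rw [l2_sq]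
  exact Finset.sum_le_sum fun i _ => sq_le_sq' (abs_le.1 (h i)).1 (abs_le.1 (h i)).2

lemma l2_const {ι : Type*} [Fintype ι] {b : ℝ} (hb : 0 ≤ b) :
    l2 (fun _ : ι => b) = Real.sqrt (Fintype.card ι) * b := by
  rw [l2_eq_sqrt, Finset.sum_const, Finset.card_univ, nsmul_eq_mul,
    Real.sqrt_mul (Nat.cast_nonneg _), Real.sqrt_sq hb]

namespace Experiment

variable {E : Experiment.{u}} {f : ℝ → ℝ → ℝ}

lemma actPart_dotProduct (v w : Fin E.p → ℝ) :
    E.actPart v ⬝ᵥ w = ∑ j : E.Act, v j * w j := by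
  rw [sum_subtype_eq_ite (fun j : Fin E.p => (j : ℕ) < E.q) (fun j => v j * w j)]
  refine Finset.sum_congr rfl fun j _ => ?_
  unfold actPart
  split_ifs <;> simp

variable (E f) in
/-- A good event, in an experiment whose sample sizes make the linearization error negligible. -/
structure Controlled (Cb Cx CL Clip Cmin C : ℝ) (ω : E.Ω) : Prop where
  loss : IsTwiceDiffLoss f
  good : E.GoodEvent f Cx CL Cmin C ω
  Cb_pos : 0 < Cb
  Cx_pos : 0 < Cx
  CL_pos : 0 < CL
  Clip_pos : 0 < Clip
  Cmin_pos : 0 < Cmin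
  C_pos : 0 < C
  size_pos : ∀ k, 0 < E.size k
  size_le : ∀ k, (E.size k : ℝ) ≤ Cb * E.nstar
  nstar_pos : 0 < E.nstar
  lip : ∀ a b y : ℝ, |lossD2 f a y - lossD2 f b y| ≤ Clip * |a - b|
  small : Clip * Cx ^ 2 * C * (E.q * E.localRate) ≤ Cmin / 4

/-- The oracle rate. -/
def rate (E : Experiment.{u}) : ℝ := Real.sqrt E.Gmax * E.r1

/-- The bound for the operator norm of the local Hessians on the important covariates. -/
def hessBound (Cx CL Cmin : ℝ) : ℝ := CL * (Cx ^ 2 + Cx + 1) + Cmin / 4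

/-- The bound for the linearization error. -/
def remBound (E : Experiment.{u}) (Cx Clip C : ℝ) : ℝ :=
  Clip * Cx * (C ^ 2 * (E.q * Real.log E.p / E.nstar))

lemma localRate_nonneg : 0 ≤ E.localRate := Real.sqrt_nonneg _

namespace Controlled

variable {Cb Cx CL Clip Cmin C : ℝ} {ω : E.Ω}

lemma size_pos_real (h : E.Controlled f Cb Cx CL Clip Cmin C ω) (k : Fin E.K) :
    (0 : ℝ) < E.size k := by exact_mod_cast h.size_pos k

lemma mean_abs_predError_le (h : E.Controlled f Cb Cx CL Clip Cmin C ω) (k : Fin E.K) :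
    1 / (E.size k : ℝ) * ∑ i, |E.predError k i ω| ≤ C * E.localRate := by
  have hn := h.size_pos_real k
  refine le_trans ?_ (h.good.pred_le k)
  have h1 := abs_dotProduct_le_l2 (fun _ : Fin (E.size k) => (1 : ℝ))
    (fun i => |E.predError k i ω|)
  have h2 : (fun _ : Fin (E.size k) => (1 : ℝ)) ⬝ᵥ (fun i => |E.predError k i ω|)
      = ∑ i, |E.predError k i ω| := by simp [dotProduct]
  have h3 : l2 (fun i => |E.predError k i ω|) = l2 (fun i => E.predError k i ω) := by
    simp only [l2_eq_sqrt, sq_abs]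
  rw [h2, l2_const zero_le_one, mul_one, Fintype.card_fin, h3] at h1
  have hs : 0 < Real.sqrt (E.size k) := Real.sqrt_pos.2 hn
  calc 1 / (E.size k : ℝ) * ∑ i, |E.predError k i ω|
      ≤ 1 / (E.size k : ℝ) * (Real.sqrt (E.size k) * l2 (fun i => E.predError k i ω)) :=
        mul_le_mul_of_nonneg_left ((le_abs_self _).trans h1) (by positivity)
    _ = 1 / Real.sqrt (E.size k) * l2 (fun i => E.predError k i ω) := by
        rw [← mul_assoc]
        congr 1
        rw [one_div_mul_eq_div, div_eq_div_iff hn.ne' hs.ne', Real.mul_self_sqrt hn.le, one_mul]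

lemma mean_sq_predError_le (h : E.Controlled f Cb Cx CL Clip Cmin C ω) (k : Fin E.K) :
    1 / (E.size k : ℝ) * ∑ i, E.predError k i ω ^ 2
      ≤ C ^ 2 * (E.q * Real.log E.p / E.nstar) := by
  have hn := h.size_pos_real k
  have hstar := h.nstar_pos
  have h1 : 1 / (E.size k : ℝ) * ∑ i, E.predError k i ω ^ 2
      = (1 / Real.sqrt (E.size k) * l2 (fun i => E.predError k i ω)) ^ 2 := by
    rw [mul_pow, l2_sq, div_pow, Real.sq_sqrt hn.le, one_pow]
  have h2 : E.localRate ^ 2 = E.q * Real.log E.p / E.nstar := by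
    have := E.log_p_nonneg
    rw [localRate, Real.sq_sqrt (by positivity)]
  rw [h1, ← h2, ← mul_pow]
  have := l2_nonneg (fun i => E.predError k i ω)
  exact pow_le_pow_left₀ (by positivity) (h.good.pred_le k) 2

/-- Replacing the truth by the local estimator changes the Hessian form very little. -/
lemma abs_form_sub_le (h : E.Controlled f Cb Cx CL Clip Cmin C ω) (k : Fin E.K)
    {v w : Fin E.p → ℝ} {Lv Lw : ℝ} (hv : ∀ i, |E.x k i ω ⬝ᵥ v| ≤ Cx * Real.sqrt E.q * Lv)
    (hw : ∀ i, |E.x k i ω ⬝ᵥ w| ≤ Cx * Real.sqrt E.q * Lw) (hLv : 0 ≤ Lv) (hLw : 0 ≤ Lw) :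
    |v ⬝ᵥ (E.Vlocal f k ω *ᵥ w) - v ⬝ᵥ (E.hess f k ω (E.column E.θstar k) *ᵥ w)|
      ≤ Cmin / 4 * (Lv * Lw) := by
  have hn := h.size_pos_real k
  have hCx := h.Cx_pos
  have hClip := h.Clip_pos
  rw [Vlocal, dotProduct_hess_mulVec h.loss, dotProduct_hess_mulVec h.loss, ← mul_sub,
    ← Finset.sum_sub_distrib, abs_mul, abs_of_nonneg (by positivity : (0 : ℝ) ≤ 1 / (E.size k : ℝ))]
  have h1 : ∀ i, |lossD2 f (E.x k i ω ⬝ᵥ E.θlocal k ω) (E.y k i ω) * (E.x k i ω ⬝ᵥ v)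
        * (E.x k i ω ⬝ᵥ w) - lossD2 f (E.x k i ω ⬝ᵥ E.column E.θstar k) (E.y k i ω)
        * (E.x k i ω ⬝ᵥ v) * (E.x k i ω ⬝ᵥ w)|
      ≤ (Clip * Cx ^ 2 * E.q * (Lv * Lw)) * |E.predError k i ω| := by
    intro i
    have h2 := h.lip (E.x k i ω ⬝ᵥ E.θlocal k ω) (E.x k i ω ⬝ᵥ E.column E.θstar k) (E.y k i ω)
    rw [← dotProduct_sub] at h2
    rw [← sub_mul, ← sub_mul, abs_mul, abs_mul]
    calc _ ≤ (Clip * |E.predError k i ω|) * (Cx * Real.sqrt E.q * Lv)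
          * (Cx * Real.sqrt E.q * Lw) := by
          have h3 := hv i
          have h4 := hw i
          unfold predError
          gcongr
      _ = Clip * Cx ^ 2 * (Real.sqrt E.q * Real.sqrt E.q) * (Lv * Lw) * |E.predError k i ω| := by
          ring
      _ = _ := by rw [Real.mul_self_sqrt (Nat.cast_nonneg _)]
  calc _ ≤ 1 / (E.size k : ℝ) * ∑ i, (Clip * Cx ^ 2 * E.q * (Lv * Lw)) * |E.predError k i ω| :=
        mul_le_mul_of_nonneg_left ((Finset.abs_sum_le_sum_abs _ _).trans
          (Finset.sum_le_sum fun i _ => h1 i)) (by positivity)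
    _ = (Clip * Cx ^ 2 * E.q * (Lv * Lw)) * (1 / (E.size k : ℝ) * ∑ i, |E.predError k i ω|) := by
        rw [← Finset.mul_sum]
        ring
    _ ≤ (Clip * Cx ^ 2 * E.q * (Lv * Lw)) * (C * E.localRate) :=
        mul_le_mul_of_nonneg_left (h.mean_abs_predError_le k) (by positivity)
    _ = Clip * Cx ^ 2 * C * (E.q * E.localRate) * (Lv * Lw) := by ring
    _ ≤ _ := mul_le_mul_of_nonneg_right h.small (by positivity)

lemma abs_x_actPart_le (h : E.Controlled f Cb Cx CL Clip Cmin C ω) (k : Fin E.K)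
    (i : Fin (E.size k)) (v : Fin E.p → ℝ) :
    |E.x k i ω ⬝ᵥ E.actPart v| ≤ Cx * Real.sqrt E.q * l2 (E.actPart v) :=
  abs_dotProduct_actPart_le h.Cx_pos.le (fun j => h.good.x_le k i j) v

/-- Curvature Cmin/2 at the truth, minus the Cmin/4 lost in moving to the local estimator. -/
lemma le_quad (h : E.Controlled f Cb Cx CL Clip Cmin C ω) (k : Fin E.K) (v : Fin E.p → ℝ) :
    Cmin / 4 * l2 (E.actPart v) ^ 2 ≤ E.actPart v ⬝ᵥ (E.Vlocal f k ω *ᵥ E.actPart v) := by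
  have h1 := h.abs_form_sub_le k (fun i => h.abs_x_actPart_le k i v)
    (fun i => h.abs_x_actPart_le k i v) (l2_nonneg _) (l2_nonneg _)
  have h2 := h.good.hess_ge k v
  rw [← sq] at h1
  linarith [(abs_le.1 h1).1]

/-- Cauchy–Schwarz over the observations with |f″| ≤ CL at the truth, plus the transfer error. The
bounds Lv, Lw and the constant Cx² + Cx + 1 are chosen to accommodate both vectors on the important
covariates (Gram bound Cx + 1) and arbitrary coordinate vectors (Gram bound Cx²). -/
lemma abs_form_le (h : E.Controlled f Cb Cx CL Clip Cmin C ω) (k : Fin E.K)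
    {v w : Fin E.p → ℝ} {Lv Lw : ℝ} (hv : ∀ i, |E.x k i ω ⬝ᵥ v| ≤ Cx * Real.sqrt E.q * Lv)
    (hw : ∀ i, |E.x k i ω ⬝ᵥ w| ≤ Cx * Real.sqrt E.q * Lw) (hLv : 0 ≤ Lv) (hLw : 0 ≤ Lw)
    (hv2 : 1 / (E.size k : ℝ) * ∑ i, (E.x k i ω ⬝ᵥ v) ^ 2 ≤ (Cx ^ 2 + Cx + 1) * Lv ^ 2)
    (hw2 : 1 / (E.size k : ℝ) * ∑ i, (E.x k i ω ⬝ᵥ w) ^ 2 ≤ (Cx ^ 2 + Cx + 1) * Lw ^ 2) :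
    |v ⬝ᵥ (E.Vlocal f k ω *ᵥ w)| ≤ hessBound Cx CL Cmin * (Lv * Lw) := by
  have hn := h.size_pos_real k
  have hCx := h.Cx_pos
  have hCL := h.CL_pos
  have h1 := h.abs_form_sub_le k hv hw hLv hLw
  have h2 : |v ⬝ᵥ (E.hess f k ω (E.column E.θstar k) *ᵥ w)|
      ≤ CL * (Cx ^ 2 + Cx + 1) * (Lv * Lw) := by
    have hcs : (∑ i, |E.x k i ω ⬝ᵥ v| * |E.x k i ω ⬝ᵥ w|)
        ≤ E.size k * ((Cx ^ 2 + Cx + 1) * (Lv * Lw)) := by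
      rw [one_div_mul_eq_div, div_le_iff₀ hn] at hv2 hw2
      refine abs_le_of_sq_le_sq' ?_ (by positivity) |>.2
      refine (Finset.sum_mul_sq_le_sq_mul_sq _ _ _).trans ?_
      simp only [sq_abs]
      calc _ ≤ ((Cx ^ 2 + Cx + 1) * Lv ^ 2 * E.size k) * ((Cx ^ 2 + Cx + 1) * Lw ^ 2 * E.size k) :=
            mul_le_mul hv2 hw2 (Finset.sum_nonneg fun i _ => sq_nonneg _) (by positivity)
        _ = _ := by ring
    rw [dotProduct_hess_mulVec h.loss, abs_mul,
      abs_of_nonneg (by positivity : (0 : ℝ) ≤ 1 / (E.size k : ℝ)), one_div_mul_eq_div,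
      div_le_iff₀ hn]
    calc _ ≤ ∑ i, CL * (|E.x k i ω ⬝ᵥ v| * |E.x k i ω ⬝ᵥ w|) := by
          refine (Finset.abs_sum_le_sum_abs _ _).trans (Finset.sum_le_sum fun i _ => ?_)
          rw [abs_mul, abs_mul, mul_assoc]
          exact mul_le_mul_of_nonneg_right (h.good.curv_le k i) (by positivity)
      _ ≤ CL * (E.size k * ((Cx ^ 2 + Cx + 1) * (Lv * Lw))) := by
          rw [← Finset.mul_sum]
          exact mul_le_mul_of_nonneg_left hcs hCL.le
      _ = _ := by ring
  have h3 := abs_add_le (v ⬝ᵥ (E.Vlocal f k ω *ᵥ w)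
    - v ⬝ᵥ (E.hess f k ω (E.column E.θstar k) *ᵥ w))
    (v ⬝ᵥ (E.hess f k ω (E.column E.θstar k) *ᵥ w))
  rw [sub_add_cancel] at h3
  unfold hessBound
  linarith

lemma gram_actPart_le (h : E.Controlled f Cb Cx CL Clip Cmin C ω) (k : Fin E.K)
    (v : Fin E.p → ℝ) : 1 / (E.size k : ℝ) * ∑ i, (E.x k i ω ⬝ᵥ E.actPart v) ^ 2
      ≤ (Cx ^ 2 + Cx + 1) * l2 (E.actPart v) ^ 2 :=
  (h.good.gram_le k v).trans (mul_le_mul_of_nonneg_right (by nlinarith) (sq_nonneg _))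

/-- Entries of the Hessian times a vector supported on the important covariates. -/
lemma abs_mulVec_apply_le (h : E.Controlled f Cb Cx CL Clip Cmin C ω) (k : Fin E.K)
    (w : Fin E.p → ℝ) (j : Fin E.p) :
    |(E.Vlocal f k ω *ᵥ E.actPart w) j| ≤ hessBound Cx CL Cmin * l2 (E.actPart w) := by
  have hn := h.size_pos_real k
  have hCx := h.Cx_pos
  have hx : ∀ i, E.x k i ω ⬝ᵥ Pi.single j 1 = E.x k i ω j := fun i => by
    rw [dotProduct_single, mul_one]
  have hq : 1 ≤ Real.sqrt E.q := Real.one_le_sqrt.2 one_le_q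
  -- A coordinate vector qualifies with Lv = 1 even when j is unimportant, since boundedness of the
  -- covariates gives |x_j| ≤ Cx ≤ Cx√q.
  have h1 := h.abs_form_le k (v := Pi.single j 1) (w := E.actPart w) (Lv := 1)
    (fun i => by
      rw [hx, mul_one]
      exact (h.good.x_le k i j).trans (le_mul_of_one_le_right hCx.le hq))
    (fun i => h.abs_x_actPart_le k i w) zero_le_one (l2_nonneg _) (by
      rw [one_div_mul_eq_div, div_le_iff₀ hn]
      have h2 : ∀ i ∈ Finset.univ, (E.x k i ω ⬝ᵥ Pi.single j 1) ^ 2 ≤ Cx ^ 2 := fun i _ => by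
        rw [hx]
        exact sq_le_sq' (abs_le.1 (h.good.x_le k i j)).1 (abs_le.1 (h.good.x_le k i j)).2
      refine (Finset.sum_le_card_nsmul _ _ _ h2).trans ?_
      rw [Finset.card_univ, Fintype.card_fin, nsmul_eq_mul, mul_comm]
      refine mul_le_mul_of_nonneg_right ?_ hn.le
      linarith) (h.gram_actPart_le k w)
  rwa [single_dotProduct, one_mul, one_mul] at h1

/-- The Hessian on the important covariates is a bounded operator. -/
lemma l2_actPart_mulVec_le (h : E.Controlled f Cb Cx CL Clip Cmin C ω) (k : Fin E.K)
    (w : Fin E.p → ℝ) :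
    l2 (E.actPart (E.Vlocal f k ω *ᵥ E.actPart w)) ≤ hessBound Cx CL Cmin * l2 (E.actPart w) := by
  -- Testing the form against its own image gives the operator bound after division by the norm.
  set v := E.Vlocal f k ω *ᵥ E.actPart w with hv
  have h1 := h.abs_form_le k (fun i => h.abs_x_actPart_le k i v)
    (fun i => h.abs_x_actPart_le k i w) (l2_nonneg _) (l2_nonneg _) (h.gram_actPart_le k v)
    (h.gram_actPart_le k w)
  have h2 : E.actPart v ⬝ᵥ v = l2 (E.actPart v) ^ 2 := by
    rw [actPart_dotProduct, l2_sq, sum_actPart_sq]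
    exact Finset.sum_congr rfl fun j _ => (sq _).symm
  rw [← hv, h2, abs_of_nonneg (sq_nonneg _)] at h1
  rcases eq_or_lt_of_le (l2_nonneg (E.actPart v)) with h0 | hpos
  · rw [← h0]
    have := h.Cx_pos
    have := h.CL_pos
    have := h.Cmin_pos
    have := l2_nonneg (E.actPart w)
    unfold hessBound
    positivity
  · refine le_of_mul_le_mul_left ?_ hpos
    linarith

lemma abs_surrogateGrad_sub_le (h : E.Controlled f Cb Cx CL Clip Cmin C ω) (k : Fin E.K)
    (j : Fin E.p) :
    |E.surrogateGrad f k ω j - 1 / (E.size k : ℝ) * E.scoreSum f k ω j| ≤ E.remBound Cx Clip C := by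
  refine (Experiment.abs_surrogateGrad_sub_le h.loss h.lip k ω j
    fun i => h.good.x_le k i j).trans ?_
  have := h.Clip_pos
  have := h.Cx_pos
  exact mul_le_mul_of_nonneg_left (h.mean_sq_predError_le k) (by positivity)

lemma remBound_nonneg (h : E.Controlled f Cb Cx CL Clip Cmin C ω) :
    0 ≤ E.remBound Cx Clip C := by
  have := h.Clip_pos
  have := h.Cx_pos
  have := h.nstar_pos
  have := E.log_p_nonneg
  unfold remBound
  positivity

end Controlled

end Experiment

namespace Experiment

variable {E : Experiment.{u}} {f : ℝ → ℝ → ℝ}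

/-! ### The oracle rate -/

lemma r1_nonneg : 0 ≤ E.r1 := by
  have := E.log_p_nonneg
  unfold r1
  positivity

lemma rate_nonneg : 0 ≤ E.rate := mul_nonneg (Real.sqrt_nonneg _) r1_nonneg

/-- The first term of `r1`, squared and multiplied by |G_max| ≥ |G_min|: the stochastic part of the
rate. -/
lemma div_Nmin_le_rate_sq (hN : (0 : ℝ) < E.Nmin) : E.K * E.q / E.Nmin ≤ E.rate ^ 2 := by
  have hlog := E.log_p_nonneg
  have hGmin : (0 : ℝ) < E.Gmin := lt_of_lt_of_le one_pos one_le_Gmin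
  have h1 : Real.sqrt (((E.K : ℝ) / E.Gmin) * E.q / E.Nmin) ≤ E.r1 := by
    unfold r1
    exact le_add_of_nonneg_right (by positivity)
  rw [rate, mul_pow, Real.sq_sqrt (Nat.cast_nonneg _)]
  calc (E.K : ℝ) * E.q / E.Nmin = E.Gmin * (((E.K : ℝ) / E.Gmin) * E.q / E.Nmin) := by
        field_simp
    _ ≤ E.Gmax * (((E.K : ℝ) / E.Gmin) * E.q / E.Nmin) :=
        mul_le_mul_of_nonneg_right Gmin_le_Gmax (by positivity)
    _ = E.Gmax * Real.sqrt (((E.K : ℝ) / E.Gmin) * E.q / E.Nmin) ^ 2 := by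
        rw [Real.sq_sqrt (by positivity)]
    _ ≤ _ := by gcongr

lemma rate_pos (hN : (0 : ℝ) < E.Nmin) : 0 < E.rate := by
  have h1 := div_Nmin_le_rate_sq hN
  have hK := E.K_pos_real
  have hq : (0 : ℝ) < E.q := lt_of_lt_of_le one_pos one_le_q
  have h2 : 0 < E.rate ^ 2 := lt_of_lt_of_le (by positivity) h1
  exact lt_of_le_of_ne rate_nonneg fun h => by simp [← h] at h2

/-- The second term of `r1` pays for the linearization remainder, through K ≤ |G_max|M and N_min ≤
Cb|G_min|n*. -/
lemma linearization_le_rate {Cb : ℝ} (hCb : 0 < Cb) (hstar : 0 < E.nstar)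
    (hN : (0 : ℝ) < E.Nmin) (hsize : ∀ k, (E.size k : ℝ) ≤ Cb * E.nstar) :
    Real.sqrt E.K * Real.sqrt E.q * (E.q * Real.log E.p / E.nstar) ≤ Cb * E.rate := by
  have hlog := E.log_p_nonneg
  have hq : (0 : ℝ) < E.q := lt_of_lt_of_le one_pos one_le_q
  have hGmin : (0 : ℝ) < E.Gmin := lt_of_lt_of_le one_pos one_le_Gmin
  have hGG := E.Gmin_le_Gmax
  have hGmax : (0 : ℝ) < E.Gmax := hGmin.trans_le hGG
  have h1 : (E.Gmax : ℝ) * Real.sqrt E.M * (E.q : ℝ) ^ (3 / 2 : ℝ) * Real.log E.p / E.Nmin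
      ≤ E.r1 := by
    unfold r1
    exact le_add_of_nonneg_left (Real.sqrt_nonneg _)
  have hpow : (E.q : ℝ) ^ (3 / 2 : ℝ) = E.q * Real.sqrt E.q := by
    rw [show (3 / 2 : ℝ) = 1 + 1 / 2 by norm_num, Real.rpow_add hq, Real.rpow_one,
      Real.sqrt_eq_rpow]
  have h2 : Real.sqrt E.K ≤ Real.sqrt E.Gmax * Real.sqrt E.M := by
    rw [← Real.sqrt_mul (Nat.cast_nonneg _)]
    exact Real.sqrt_le_sqrt K_le_Gmax_mul_M
  have h3 := Nmin_le hsize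
  calc Real.sqrt E.K * Real.sqrt E.q * (E.q * Real.log E.p / E.nstar)
      ≤ (Real.sqrt E.Gmax * Real.sqrt E.M) * Real.sqrt E.q * (E.q * Real.log E.p / E.nstar) := by
        gcongr
    _ = Cb * (Real.sqrt E.Gmax * (E.Gmin * Real.sqrt E.M * (E.q * Real.sqrt E.q) * Real.log E.p
          / (Cb * E.Gmin * E.nstar))) := by field_simp
    _ ≤ Cb * (Real.sqrt E.Gmax * (E.Gmax * Real.sqrt E.M * (E.q * Real.sqrt E.q) * Real.log E.p
          / E.Nmin)) := by gcongr
    _ ≤ Cb * E.rate := by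
        unfold rate
        rw [← hpow]
        gcongr

lemma div_nstar_le_rate_sq {Cb : ℝ} (hCb : 0 < Cb) (hstar : 0 < E.nstar)
    (hN : (0 : ℝ) < E.Nmin) (hsize : ∀ k, (E.size k : ℝ) ≤ Cb * E.nstar) :
    E.q / E.nstar ≤ Cb * E.rate ^ 2 := by
  have hGmin : (0 : ℝ) < E.Gmin := lt_of_lt_of_le one_pos one_le_Gmin
  have h3 := Nmin_le hsize
  calc (E.q : ℝ) / E.nstar = Cb * (E.Gmin * E.q / (Cb * E.Gmin * E.nstar)) := by field_simp
    _ ≤ Cb * (E.K * E.q / E.Nmin) := by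
        have := E.Gmin_le_K
        gcongr
    _ ≤ _ := by
        have := div_Nmin_le_rate_sq hN
        gcongr

/-! ### The oracle estimator -/

variable (E f) in
/-- The Hessian of the pooled quadratic surrogate of a cluster, on the important covariates. -/
def clusterHess (ω : E.Ω) (m : Fin E.M) : Matrix E.Act E.Act ℝ := fun j l =>
  ∑ k ∈ Finset.univ.filter (fun k => E.cluster k = m), (E.size k : ℝ) * E.Vlocal f k ω j l

variable (E f) in
/-- The linear part of the pooled quadratic surrogate of a cluster. -/
def clusterζ (ω : E.Ω) (m : Fin E.M) : E.Act → ℝ := fun j =>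
  ∑ k ∈ Finset.univ.filter (fun k => E.cluster k = m), (E.size k : ℝ) * E.ζlocal f k ω j

variable (E f) in
/-- The minimizer of the pooled quadratic surrogate of a cluster. -/
def oracleCoef (ω : E.Ω) (m : Fin E.M) : Fin E.p → ℝ := fun j =>
  if h : (j : ℕ) < E.q then ((E.clusterHess f ω m)⁻¹ *ᵥ E.clusterζ f ω m) ⟨j, h⟩ else 0

variable (E f) in
/-- The oracle estimator. -/
def oracle (ω : E.Ω) : E.Coef := fun j k => E.oracleCoef f ω (E.cluster k) j

variable (E f) in
/-- The estimation error of the oracle in one cluster. -/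
def oracleError (ω : E.Ω) (m : Fin E.M) : Fin E.p → ℝ := fun j =>
  E.oracleCoef f ω m j - E.ψstar j m

lemma oracle_mem_clusterSpace (ω : E.Ω) : E.oracle f ω ∈ E.clusterSpace := by
  intro k k' hk
  ext j
  simp only [column, oracle, hk]

lemma oracle_zeroOff (ω : E.Ω) : E.ZeroOffActive (E.oracle f ω) := by
  intro j hj
  ext k
  simp only [oracle, oracleCoef, not_lt.2 hj, dite_false]
  rfl

lemma actPart_oracleError (ω : E.Ω) (m : Fin E.M) :
    E.actPart (E.oracleError f ω m) = E.oracleError f ω m := by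
  ext j
  unfold actPart
  split_ifs with hj
  · rfl
  · simp [oracleError, oracleCoef, hj, E.ψstar_zero j (not_lt.1 hj)]

lemma measurable_matrix_det {Ω n : Type*} [MeasurableSpace Ω] [Fintype n] [DecidableEq n]
    {A : Ω → Matrix n n ℝ} (hA : ∀ i j, Measurable fun ω => A ω i j) :
    Measurable fun ω => (A ω).det := by
  simp only [Matrix.det_apply']
  exact Finset.measurable_sum _ fun σ _ =>
    (Finset.measurable_prod _ fun i _ => hA (σ i) i).const_mul _

/-- Cramer's formula as an identity of total functions: singular matrices have inverse zero, so no
invertibility is required. -/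
lemma measurable_matrix_inv_apply {Ω n : Type*} [MeasurableSpace Ω] [Fintype n] [DecidableEq n]
    {A : Ω → Matrix n n ℝ} (hA : ∀ i j, Measurable fun ω => A ω i j) (a b : n) :
    Measurable fun ω => (A ω)⁻¹ a b := by
  simp only [Matrix.inv_def, Matrix.smul_apply, smul_eq_mul, Ring.inverse_eq_inv,
    Matrix.adjugate_apply]
  refine (measurable_matrix_det hA).inv.mul (measurable_matrix_det fun i j => ?_)
  simp only [Matrix.updateRow_apply]
  split_ifs
  · exact measurable_const
  · exact hA i j

lemma measurable_oracle (hf : IsTwiceDiffLoss f) (j : Fin E.p) (k : Fin E.K) :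
    Measurable fun ω => E.oracle f ω j k := by
  by_cases hj : (j : ℕ) < E.q
  · simp only [oracle, oracleCoef, hj, dite_true]
    have hH : ∀ a b, Measurable fun ω => E.clusterHess f ω (E.cluster k) a b := fun a b =>
      Finset.measurable_sum _ fun k _ => (measurable_Vlocal hf k a b).const_mul _
    have hInv := measurable_matrix_inv_apply hH
    simp only [Matrix.mulVec, dotProduct]
    refine Finset.measurable_sum _ fun l _ => (hInv _ _).mul ?_
    exact Finset.measurable_sum _ fun k _ => (measurable_ζlocal hf k l).const_mul _
  · simp only [oracle, oracleCoef, hj, dite_false]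
    exact measurable_const

namespace Controlled

variable {Cb Cx CL Clip Cmin C : ℝ} {ω : E.Ω}

/-- A kernel vector, extended by zero, makes a sum of nonnegative client forms vanish; one client of
the nonempty cluster already forces the vector to be zero. -/
lemma isUnit_det_clusterHess (h : E.Controlled f Cb Cx CL Clip Cmin C ω) (m : Fin E.M) :
    IsUnit (E.clusterHess f ω m).det := by
  rw [isUnit_iff_ne_zero]
  intro hdet
  obtain ⟨v, hv, hv0⟩ := Matrix.exists_mulVec_eq_zero_iff.2 hdet
  set w : Fin E.p → ℝ := fun j => if hj : (j : ℕ) < E.q then v ⟨j, hj⟩ else 0 with hw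
  have hwv : ∀ j : E.Act, w j = v j := fun j => by simp [hw, j.2]
  have h1 : ∑ k ∈ Finset.univ.filter (fun k => E.cluster k = m),
      (E.size k : ℝ) * (E.actPart w ⬝ᵥ (E.Vlocal f k ω *ᵥ E.actPart w)) = 0 := by
    have h2 : v ⬝ᵥ (E.clusterHess f ω m *ᵥ v) = 0 := by rw [hv0, dotProduct_zero]
    have h3 : ∀ (k : Fin E.K) (j : Fin E.p), (E.Vlocal f k ω *ᵥ E.actPart w) j
        = ∑ l : E.Act, E.Vlocal f k ω j l * v l := by
      intro k j
      rw [Matrix.mulVec, dotProduct_comm, actPart_dotProduct]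
      exact Finset.sum_congr rfl fun l _ => by rw [hwv, mul_comm]
    have h4 : v ⬝ᵥ (E.clusterHess f ω m *ᵥ v)
        = ∑ j, v j * ∑ l, E.clusterHess f ω m j l * v l := rfl
    rw [← h2, h4]
    simp only [actPart_dotProduct, h3, hwv, clusterHess, Finset.mul_sum, Finset.sum_mul]
    rw [Finset.sum_comm]
    refine Finset.sum_congr rfl fun j _ => ?_
    rw [Finset.sum_comm]
    refine Finset.sum_congr rfl fun l _ => Finset.sum_congr rfl fun k _ => ?_
    ring
  have hw0 : l2 (E.actPart w) = 0 := by
    obtain ⟨k, hk⟩ := E.cluster_surj m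
    have hnn : ∀ k ∈ Finset.univ.filter (fun k => E.cluster k = m),
        0 ≤ (E.size k : ℝ) * (E.actPart w ⬝ᵥ (E.Vlocal f k ω *ᵥ E.actPart w)) := fun k _ => by
      have h4 := h.le_quad k w
      have h5 : 0 ≤ Cmin / 4 * l2 (E.actPart w) ^ 2 := by
        have := h.Cmin_pos
        positivity
      exact mul_nonneg (Nat.cast_nonneg _) (h5.trans h4)
    have h6 := (Finset.sum_eq_zero_iff_of_nonneg hnn).1 h1 k (by simp [hk])
    have h7 := h.le_quad k w
    have h8 := (mul_eq_zero.1 h6).resolve_left (h.size_pos_real k).ne'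
    have h9 := h.Cmin_pos
    rw [h8] at h7
    have h10 : l2 (E.actPart w) ^ 2 ≤ 0 := by
      by_contra hcon
      have : 0 < Cmin / 4 * l2 (E.actPart w) ^ 2 := mul_pos (by linarith) (not_le.1 hcon)
      linarith
    exact pow_eq_zero_iff two_ne_zero |>.1 (le_antisymm h10 (sq_nonneg _))
  refine hv ?_
  rw [l2_eq_zero_iff] at hw0
  ext j
  have := congrFun hw0 j
  simpa [actPart, j.2, hwv] using this

/-- The gradient at the oracle, in terms of its estimation error. -/
lemma mulVec_oracle_sub (k : Fin E.K) :
    E.Vlocal f k ω *ᵥ E.column (E.oracle f ω) k - E.ζlocal f k ω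
      = E.Vlocal f k ω *ᵥ E.oracleError f ω (E.cluster k) + E.surrogateGrad f k ω := by
  have h1 : E.column (E.oracle f ω) k
      = E.oracleError f ω (E.cluster k) + E.column E.θstar k := by
    ext j
    simp [column, oracle, oracleError, θstar]
  rw [h1, Matrix.mulVec_add, surrogateGrad]
  abel

/-- The normal equations. -/
lemma normal_eq (h : E.Controlled f Cb Cx CL Clip Cmin C ω) (m : Fin E.M) (j : E.Act) :
    ∑ k ∈ Finset.univ.filter (fun k => E.cluster k = m), (E.size k : ℝ) *
      ((E.Vlocal f k ω *ᵥ E.oracleError f ω m) j + E.surrogateGrad f k ω j) = 0 := by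
  have h1 : (E.clusterHess f ω m *ᵥ ((E.clusterHess f ω m)⁻¹ *ᵥ E.clusterζ f ω m)) j
      = E.clusterζ f ω m j := by
    rw [Matrix.mulVec_mulVec, Matrix.mul_nonsing_inv _ (h.isUnit_det_clusterHess m),
      Matrix.one_mulVec]
  have h2 : (E.clusterHess f ω m *ᵥ ((E.clusterHess f ω m)⁻¹ *ᵥ E.clusterζ f ω m)) j
      = ∑ k ∈ Finset.univ.filter (fun k => E.cluster k = m), (E.size k : ℝ) *
        (E.Vlocal f k ω *ᵥ E.oracleCoef f ω m) j := by
    have h3 : ∀ k, (E.Vlocal f k ω *ᵥ E.oracleCoef f ω m) j = ∑ l : E.Act, E.Vlocal f k ω j l *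
        ((E.clusterHess f ω m)⁻¹ *ᵥ E.clusterζ f ω m) l := by
      intro k
      have h4 : ∀ l : E.Act, ((E.clusterHess f ω m)⁻¹ *ᵥ E.clusterζ f ω m) l
          = E.oracleCoef f ω m l := fun l => by simp [oracleCoef, l.2]
      have h5 : (E.Vlocal f k ω *ᵥ E.oracleCoef f ω m) j
          = ∑ l, E.Vlocal f k ω j l * E.oracleCoef f ω m l := rfl
      simp only [h4]
      rw [h5, sum_subtype_eq_ite (fun l : Fin E.p => (l : ℕ) < E.q)
        (fun l => E.Vlocal f k ω j l * E.oracleCoef f ω m l)]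
      refine Finset.sum_congr rfl fun l _ => ?_
      split_ifs with hl
      · rfl
      · simp [oracleCoef, hl]
    have h4 : ∀ z : E.Act → ℝ, (E.clusterHess f ω m *ᵥ z) j
        = ∑ l, E.clusterHess f ω m j l * z l := fun z => rfl
    rw [h4]
    simp only [h3, Finset.mul_sum]
    rw [Finset.sum_comm]
    refine Finset.sum_congr rfl fun l _ => ?_
    rw [clusterHess, Finset.sum_mul]
    exact Finset.sum_congr rfl fun k _ => mul_assoc _ _ _
  rw [h2, clusterζ, ← sub_eq_zero, ← Finset.sum_sub_distrib] at h1
  rw [← h1]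
  refine Finset.sum_congr rfl fun k hk => ?_
  have hkm : E.cluster k = m := (Finset.mem_filter.1 hk).2
  have h5 := congrFun (mulVec_oracle_sub (f := f) (ω := ω) k) j
  have h6 : E.column (E.oracle f ω) k = E.oracleCoef f ω m := by
    ext l
    simp only [column, oracle, hkm]
  rw [hkm, h6] at h5
  simp only [Pi.sub_apply, Pi.add_apply] at h5
  rw [← h5]
  ring

/-- The estimation error in one cluster. -/
lemma l2_oracleError_le (h : E.Controlled f Cb Cx CL Clip Cmin C ω) (m : Fin E.M) :
    Cmin / 4 * (E.clusterN m * l2 (E.oracleError f ω m))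
      ≤ l2 (fun j : E.Act => ∑ k ∈ Finset.univ.filter (fun k => E.cluster k = m),
          E.scoreSum f k ω j) + Real.sqrt E.q * (E.clusterN m * E.remBound Cx Clip C) := by
  set U := E.oracleError f ω m with hU
  have hUA : E.actPart U = U := actPart_oracleError ω m
  set D : E.Act → ℝ := fun j => ∑ k ∈ Finset.univ.filter (fun k => E.cluster k = m),
    (E.size k : ℝ) * E.surrogateGrad f k ω j with hD
  have hρ := h.remBound_nonneg
  have hDle : l2 D ≤ l2 (fun j : E.Act => ∑ k ∈ Finset.univ.filter (fun k => E.cluster k = m),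
      E.scoreSum f k ω j) + Real.sqrt E.q * (E.clusterN m * E.remBound Cx Clip C) := by
    set T : E.Act → ℝ := fun j => ∑ k ∈ Finset.univ.filter (fun k => E.cluster k = m),
      E.scoreSum f k ω j with hT
    have h1 : l2 (D - T) ≤ Real.sqrt E.q * (E.clusterN m * E.remBound Cx Clip C) := by
      have hc := l2_const (ι := E.Act) (b := E.clusterN m * E.remBound Cx Clip C) (by positivity)
      rw [card_act] at hc
      rw [← hc]
      refine l2_le_l2_of_abs_le fun j => ?_
      rw [Pi.sub_apply, hD, hT, ← Finset.sum_sub_distrib, clusterN, Nat.cast_sum, Finset.sum_mul]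
      refine (Finset.abs_sum_le_sum_abs _ _).trans (Finset.sum_le_sum fun k _ => ?_)
      have hn := h.size_pos_real k
      have h2 : (E.size k : ℝ) * E.surrogateGrad f k ω j - E.scoreSum f k ω j
          = E.size k * (E.surrogateGrad f k ω j - 1 / (E.size k : ℝ) * E.scoreSum f k ω j) := by
        field_simp
      rw [h2, abs_mul, abs_of_pos hn]
      exact mul_le_mul_of_nonneg_left (h.abs_surrogateGrad_sub_le k j) hn.le
    have h2 := l2_add_le (D - T) T
    rw [sub_add_cancel] at h2
    linarith
  refine le_trans ?_ hDle
  -- The normal equations are tested against the error U itself, to be compared with curvature on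
  -- one side and Cauchy–Schwarz on the other.
  have h1 : ∑ k ∈ Finset.univ.filter (fun k => E.cluster k = m),
      (E.size k : ℝ) * (U ⬝ᵥ (E.Vlocal f k ω *ᵥ U)) = -((fun j : E.Act => U j) ⬝ᵥ D) := by
    rw [eq_neg_iff_add_eq_zero]
    have h2 : ∀ k, U ⬝ᵥ (E.Vlocal f k ω *ᵥ U) = ∑ j : E.Act, U j * (E.Vlocal f k ω *ᵥ U) j := by
      intro k
      conv_lhs => rw [← hUA]
      rw [actPart_dotProduct, hUA]
    have h4 : (fun j : E.Act => U j) ⬝ᵥ D = ∑ j : E.Act, U j * D j := rfl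
    rw [h4]
    simp only [h2, hD, Finset.mul_sum]
    rw [Finset.sum_comm, ← Finset.sum_add_distrib]
    refine Finset.sum_eq_zero fun j _ => ?_
    rw [← Finset.sum_add_distrib]
    have h3 := h.normal_eq m j
    rw [← hU] at h3
    calc _ = U j * ∑ k ∈ Finset.univ.filter (fun k => E.cluster k = m), (E.size k : ℝ) *
          ((E.Vlocal f k ω *ᵥ U) j + E.surrogateGrad f k ω j) := by
          rw [Finset.mul_sum]
          exact Finset.sum_congr rfl fun k _ => by ring
      _ = 0 := by rw [h3, mul_zero]
  have h2 : Cmin / 4 * l2 U ^ 2 * E.clusterN m ≤ ∑ k ∈ Finset.univ.filter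
      (fun k => E.cluster k = m), (E.size k : ℝ) * (U ⬝ᵥ (E.Vlocal f k ω *ᵥ U)) := by
    rw [clusterN, Nat.cast_sum, Finset.mul_sum]
    refine Finset.sum_le_sum fun k _ => ?_
    have h3 := h.le_quad k U
    rw [hUA] at h3
    rw [mul_comm]
    exact mul_le_mul_of_nonneg_left h3 (Nat.cast_nonneg _)
  have h3 : l2 (fun j : E.Act => U j) = l2 U := by rw [← l2_actPart, hUA]
  have h4 := (abs_le.1 (abs_dotProduct_le_l2 (fun j : E.Act => U j) D)).1
  rw [h3] at h4
  rcases eq_or_lt_of_le (l2_nonneg U) with h0 | hpos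
  · rw [← h0, mul_zero, mul_zero]
    exact l2_nonneg _
  · refine le_of_mul_le_mul_left ?_ hpos
    calc l2 U * (Cmin / 4 * (E.clusterN m * l2 U)) = Cmin / 4 * l2 U ^ 2 * E.clusterN m := by ring
      _ ≤ _ := by linarith

lemma Nmin_pos (h : E.Controlled f Cb Cx CL Clip Cmin C ω) : (0 : ℝ) < E.Nmin :=
  Experiment.Nmin_pos h.size_pos

lemma sqrt_mul_remBound_le (h : E.Controlled f Cb Cx CL Clip Cmin C ω) :
    Real.sqrt E.K * Real.sqrt E.q * E.remBound Cx Clip C ≤ Clip * Cx * C ^ 2 * Cb * E.rate := by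
  have h1 := linearization_le_rate h.Cb_pos h.nstar_pos h.Nmin_pos h.size_le
  have := h.Clip_pos
  have := h.Cx_pos
  calc _ = Clip * Cx * C ^ 2 * (Real.sqrt E.K * Real.sqrt E.q
        * (E.q * Real.log E.p / E.nstar)) := by
        unfold remBound
        ring
    _ ≤ Clip * Cx * C ^ 2 * (Cb * E.rate) := by gcongr
    _ = _ := by ring

end Controlled

/-- The constant in the bound of the oracle error. -/
def errBound (Cb Cx Clip Cmin C : ℝ) : ℝ :=
  Real.sqrt (2 * (4 / Cmin) ^ 2 * (C + (Clip * Cx * C ^ 2 * Cb) ^ 2))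

namespace Controlled

variable {Cb Cx CL Clip Cmin C : ℝ} {ω : E.Ω}

/-- The error of cluster m counts |G_m| times. Squaring its two-term bound splits the sum into the
weighted pooled scores, controlled by `score_cluster_le`, and the remainders, whose total is Kqρ².
-/
lemma sum_l2_oracleError_sq_le (h : E.Controlled f Cb Cx CL Clip Cmin C ω) :
    ∑ k, l2 (E.oracleError f ω (E.cluster k)) ^ 2
      ≤ (errBound Cb Cx Clip Cmin C * E.rate) ^ 2 := by
  have hCmin := h.Cmin_pos
  have hC := h.C_pos
  set ρ := E.remBound Cx Clip C with hρdef
  have hρ : 0 ≤ ρ := h.remBound_nonneg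
  set T : Fin E.M → ℝ := fun m => l2 (fun j : E.Act =>
    ∑ k ∈ Finset.univ.filter (fun k => E.cluster k = m), E.scoreSum f k ω j) with hT
  have h1 : ∑ k, l2 (E.oracleError f ω (E.cluster k)) ^ 2
      = ∑ m, (E.clusterCard m : ℝ) * l2 (E.oracleError f ω m) ^ 2 := by
    rw [← Finset.sum_fiberwise (s := Finset.univ) (g := E.cluster)]
    refine Finset.sum_congr rfl fun m _ => ?_
    rw [clusterCard, ← nsmul_eq_mul, ← Finset.sum_const]
    exact Finset.sum_congr rfl fun k hk => by rw [(Finset.mem_filter.1 hk).2]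
  have h2 : ∀ m, l2 (E.oracleError f ω m) ^ 2
      ≤ 2 * (4 / Cmin) ^ 2 * (T m ^ 2 / (E.clusterN m : ℝ) ^ 2 + E.q * ρ ^ 2) := by
    intro m
    have hm : (0 : ℝ) < E.clusterN m := by exact_mod_cast clusterN_pos h.size_pos m
    have h3 := h.l2_oracleError_le m
    have h4 : l2 (E.oracleError f ω m) ≤ 4 / Cmin * (T m / E.clusterN m + Real.sqrt E.q * ρ) := by
      rw [div_mul_eq_mul_div, le_div_iff₀ hCmin]
      have h5 : l2 (E.oracleError f ω m) * Cmin * E.clusterN m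
          ≤ 4 * (T m / E.clusterN m + Real.sqrt E.q * ρ) * E.clusterN m := by
        have h6 : 4 * (T m / E.clusterN m + Real.sqrt E.q * ρ) * E.clusterN m
            = 4 * (T m + Real.sqrt E.q * (E.clusterN m * ρ)) := by
          field_simp
        rw [h6]
        linarith
      exact le_of_mul_le_mul_right h5 hm
    calc l2 (E.oracleError f ω m) ^ 2
        ≤ (4 / Cmin * (T m / E.clusterN m + Real.sqrt E.q * ρ)) ^ 2 :=
          pow_le_pow_left₀ (l2_nonneg _) h4 2
      _ = (4 / Cmin) ^ 2 * (T m / E.clusterN m + Real.sqrt E.q * ρ) ^ 2 := mul_pow _ _ _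
      _ ≤ (4 / Cmin) ^ 2 * (2 * ((T m / E.clusterN m) ^ 2 + (Real.sqrt E.q * ρ) ^ 2)) := by
          gcongr
          exact add_sq_le
      _ = _ := by
          rw [mul_pow, Real.sq_sqrt (Nat.cast_nonneg _), div_pow]
          ring
  have h3 : ∑ m, (E.clusterCard m : ℝ) * (T m ^ 2 / (E.clusterN m : ℝ) ^ 2) ≤ C * E.rate ^ 2 := by
    have h4 := h.good.score_cluster_le
    have h5 : ∀ m, (E.clusterCard m : ℝ) * (T m ^ 2 / (E.clusterN m : ℝ) ^ 2)
        = (E.clusterCard m : ℝ) / (E.clusterN m : ℝ) ^ 2 * ∑ j : E.Act,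
          (∑ k ∈ Finset.univ.filter (fun k => E.cluster k = m), E.scoreSum f k ω j) ^ 2 := by
      intro m
      rw [← l2_sq]
      ring
    simp only [h5]
    exact h4.trans (mul_le_mul_of_nonneg_left (div_Nmin_le_rate_sq h.Nmin_pos) hC.le)
  have h4 : ∑ m, (E.clusterCard m : ℝ) * (E.q * ρ ^ 2)
      ≤ (Clip * Cx * C ^ 2 * Cb) ^ 2 * E.rate ^ 2 := by
    rw [← Finset.sum_mul, ← Nat.cast_sum, sum_clusterCard]
    have h5 := pow_le_pow_left₀ (by positivity) h.sqrt_mul_remBound_le 2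
    rw [mul_pow, mul_pow, mul_pow, Real.sq_sqrt (Nat.cast_nonneg _),
      Real.sq_sqrt (Nat.cast_nonneg _), ← hρdef] at h5
    linarith
  rw [h1, mul_pow, errBound, Real.sq_sqrt (by positivity)]
  calc ∑ m, (E.clusterCard m : ℝ) * l2 (E.oracleError f ω m) ^ 2
      ≤ ∑ m, (E.clusterCard m : ℝ)
          * (2 * (4 / Cmin) ^ 2 * (T m ^ 2 / (E.clusterN m : ℝ) ^ 2 + E.q * ρ ^ 2)) :=
        Finset.sum_le_sum fun m _ => mul_le_mul_of_nonneg_left (h2 m) (Nat.cast_nonneg _)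
    _ = 2 * (4 / Cmin) ^ 2 * (∑ m, (E.clusterCard m : ℝ) * (T m ^ 2 / (E.clusterN m : ℝ) ^ 2)
          + ∑ m, (E.clusterCard m : ℝ) * (E.q * ρ ^ 2)) := by
        rw [← Finset.sum_add_distrib, Finset.mul_sum]
        exact Finset.sum_congr rfl fun m _ => by ring
    _ ≤ 2 * (4 / Cmin) ^ 2 * (C * E.rate ^ 2 + (Clip * Cx * C ^ 2 * Cb) ^ 2 * E.rate ^ 2) := by
        gcongr
    _ = _ := by ring

end Controlled

end Experiment

/-! ### The gradient at the oracle and the signal conditions -/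

namespace Experiment

variable {E : Experiment.{u}} {f : ℝ → ℝ → ℝ}

namespace Controlled

variable {Cb Cx CL Clip Cmin C : ℝ} {ω : E.Ω}

lemma hessBound_pos (h : E.Controlled f Cb Cx CL Clip Cmin C ω) : 0 < hessBound Cx CL Cmin := by
  have := h.Cx_pos
  have := h.CL_pos
  have := h.Cmin_pos
  unfold hessBound
  positivity

lemma size_div_N_le (h : E.Controlled f Cb Cx CL Clip Cmin C ω) (k : Fin E.K) :
    2 * (E.size k : ℝ) / E.N ≤ 2 * Cb / E.K := by
  have hK := E.K_pos_real
  have hstar := h.nstar_pos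
  have h1 := h.size_le k
  rw [E.N_eq, div_le_div_iff₀ (by positivity) hK]
  calc 2 * (E.size k : ℝ) * E.K ≤ 2 * (Cb * E.nstar) * E.K := by gcongr
    _ = _ := by ring

lemma fitGrad_oracle (k : Fin E.K) (j : Fin E.p) :
    E.fitGrad f ω (E.oracle f ω) j k = 2 * (E.size k : ℝ) / E.N *
      ((E.Vlocal f k ω *ᵥ E.oracleError f ω (E.cluster k)) j + E.surrogateGrad f k ω j) := by
  have h1 := congrFun (mulVec_oracle_sub (f := f) (ω := ω) k) j
  simp only [Pi.sub_apply, Pi.add_apply] at h1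
  rw [fitGrad, h1]

lemma l2_l2_oracleError_le (h : E.Controlled f Cb Cx CL Clip Cmin C ω) :
    l2 (fun k => l2 (E.oracleError f ω (E.cluster k))) ≤ errBound Cb Cx Clip Cmin C * E.rate :=
  l2_le_of_sq_le (mul_nonneg (Real.sqrt_nonneg _) rate_nonneg) h.sum_l2_oracleError_sq_le

lemma l2_oracleError_le_rate (h : E.Controlled f Cb Cx CL Clip Cmin C ω) (k : Fin E.K) :
    l2 (E.oracleError f ω (E.cluster k)) ≤ errBound Cb Cx Clip Cmin C * E.rate :=
  ((le_abs_self _).trans (abs_apply_le_l2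
    (fun k => l2 (E.oracleError f ω (E.cluster k))) k)).trans h.l2_l2_oracleError_le

/-- The gradient of the lack of fit at the oracle, row by row. -/
lemma l2_fitGrad_row_le (h : E.Controlled f Cb Cx CL Clip Cmin C ω) (j : Fin E.p) :
    l2 (E.fitGrad f ω (E.oracle f ω) j) ≤ 2 * Cb * ((hessBound Cx CL Cmin
      * errBound Cb Cx Clip Cmin C + Clip * Cx * C ^ 2 * Cb) * E.rate
        + C * Real.sqrt (Real.log E.p / E.N)) := by
  have hK := E.K_pos_real
  have hstar := h.nstar_pos
  have hC := h.C_pos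
  have hCb := h.Cb_pos
  have hH := h.hessBound_pos
  have hlog := E.log_p_nonneg
  set ρ := E.remBound Cx Clip C with hρdef
  have hρ : 0 ≤ ρ := h.remBound_nonneg
  set s := Real.sqrt (Real.log E.p / E.nstar) with hs
  have hs0 : 0 ≤ s := Real.sqrt_nonneg _
  have h1 : ∀ k, |E.fitGrad f ω (E.oracle f ω) j k| ≤ ((2 * Cb / E.K) •
      (hessBound Cx CL Cmin • (fun k => l2 (E.oracleError f ω (E.cluster k)))
        + fun _ => ρ + C * s) : Fin E.K → ℝ) k := by
    intro k
    have hn := h.size_pos_real k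
    rw [fitGrad_oracle, abs_mul, abs_of_nonneg (by positivity)]
    simp only [Pi.smul_apply, Pi.add_apply, smul_eq_mul]
    refine mul_le_mul (h.size_div_N_le k) ?_ (abs_nonneg _) (by positivity)
    have h2 := h.abs_mulVec_apply_le k (E.oracleError f ω (E.cluster k)) j
    rw [actPart_oracleError] at h2
    have h3 := h.abs_surrogateGrad_sub_le k j
    have h4 : |1 / (E.size k : ℝ) * E.scoreSum f k ω j| ≤ C * s := by
      rw [abs_mul, abs_of_pos (by positivity : (0 : ℝ) < 1 / (E.size k : ℝ)), one_div_mul_eq_div,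
        div_le_iff₀ hn]
      exact (h.good.score_le k j).trans (le_of_eq (by ring))
    have h5 := abs_add_le (E.surrogateGrad f k ω j - 1 / (E.size k : ℝ) * E.scoreSum f k ω j)
      (1 / (E.size k : ℝ) * E.scoreSum f k ω j)
    rw [sub_add_cancel] at h5
    refine (abs_add_le _ _).trans (add_le_add h2 ?_)
    linarith
  refine (l2_le_l2_of_abs_le h1).trans ?_
  rw [l2_smul, abs_of_nonneg (by positivity)]
  have h2 := l2_add_le (hessBound Cx CL Cmin • (fun k => l2 (E.oracleError f ω (E.cluster k))))
    (fun _ => ρ + C * s)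
  rw [l2_smul, abs_of_pos hH, l2_const (by positivity), Fintype.card_fin] at h2
  have h3 := h.l2_l2_oracleError_le
  have h4 : Real.sqrt E.K * ρ ≤ Clip * Cx * C ^ 2 * Cb * E.rate := by
    refine le_trans ?_ h.sqrt_mul_remBound_le
    refine mul_le_mul_of_nonneg_right ?_ hρ
    exact le_mul_of_one_le_right (Real.sqrt_nonneg _) (Real.one_le_sqrt.2 one_le_q)
  -- Because N = K n*. The factor K is cancelled by the client weights n_k/N of order 1/K, so the
  -- score contributes √(log p / N) to a whole row.
  have h5 : Real.sqrt E.K * s = E.K * Real.sqrt (Real.log E.p / E.N) := by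
    rw [E.N_eq, mul_comm (E.K : ℝ) E.nstar, ← div_div, Real.sqrt_div (by positivity), ← hs,
      mul_div_assoc']
    rw [eq_div_iff (Real.sqrt_pos.2 hK).ne', mul_right_comm, Real.mul_self_sqrt hK.le]
  have hrate := E.rate_nonneg
  have hB1 : 0 ≤ errBound Cb Cx Clip Cmin C := Real.sqrt_nonneg _
  have hκ : 0 ≤ Clip * Cx * C ^ 2 * Cb := by
    have := h.Clip_pos
    have := h.Cx_pos
    positivity
  calc 2 * Cb / E.K * l2 (hessBound Cx CL Cmin
        • (fun k => l2 (E.oracleError f ω (E.cluster k))) + fun _ => ρ + C * s)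
      ≤ 2 * Cb / E.K * (hessBound Cx CL Cmin * (errBound Cb Cx Clip Cmin C * E.rate)
          + (Clip * Cx * C ^ 2 * Cb * E.rate + C * (E.K * Real.sqrt (Real.log E.p / E.N)))) := by
        refine mul_le_mul_of_nonneg_left (h2.trans ?_) (by positivity)
        rw [mul_add, mul_left_comm, h5]
        gcongr
    _ = 2 * Cb * ((hessBound Cx CL Cmin * errBound Cb Cx Clip Cmin C + Clip * Cx * C ^ 2 * Cb)
          * E.rate / E.K + C * Real.sqrt (Real.log E.p / E.N)) := by
        field_simp
        ring
    _ ≤ _ := by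
        gcongr
        exact div_le_self (by positivity) one_le_K

/-- The gradient of the lack of fit at the oracle, on the important covariates of one client. -/
lemma l2_fitGrad_column_le (h : E.Controlled f Cb Cx CL Clip Cmin C ω) (k : Fin E.K) :
    l2 (fun j : E.Act => E.fitGrad f ω (E.oracle f ω) j k) ≤ 2 * Cb * ((hessBound Cx CL Cmin
      * errBound Cb Cx Clip Cmin C + Clip * Cx * C ^ 2 * Cb + Real.sqrt (C * Cb)) * E.rate) := by
  have hK := E.K_pos_real
  have hn := h.size_pos_real k
  have hstar := h.nstar_pos
  have hC := h.C_pos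
  have hCb := h.Cb_pos
  have hH := h.hessBound_pos
  have hrate := E.rate_nonneg
  set ρ := E.remBound Cx Clip C with hρdef
  have hρ : 0 ≤ ρ := h.remBound_nonneg
  set U := E.oracleError f ω (E.cluster k) with hU
  set g : E.Act → ℝ := fun j => 1 / (E.size k : ℝ) * E.scoreSum f k ω j with hg
  have h1 : (fun j : E.Act => E.fitGrad f ω (E.oracle f ω) j k) = (2 * (E.size k : ℝ) / E.N) •
      ((fun j : E.Act => (E.Vlocal f k ω *ᵥ U) j)
        + ((fun j : E.Act => E.surrogateGrad f k ω j - g j) + g)) := by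
    ext j
    simp only [fitGrad_oracle, Pi.smul_apply, Pi.add_apply, smul_eq_mul, sub_add_cancel, ← hU]
  have h2 : l2 (fun j : E.Act => (E.Vlocal f k ω *ᵥ U) j)
      ≤ hessBound Cx CL Cmin * (errBound Cb Cx Clip Cmin C * E.rate) := by
    have h3 := h.l2_actPart_mulVec_le k U
    rw [hU, actPart_oracleError, l2_actPart] at h3
    exact h3.trans (mul_le_mul_of_nonneg_left (h.l2_oracleError_le_rate k) hH.le)
  have h3 : l2 (fun j : E.Act => E.surrogateGrad f k ω j - g j)
      ≤ Clip * Cx * C ^ 2 * Cb * E.rate := by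
    have hc := l2_const (ι := E.Act) (b := ρ) hρ
    rw [card_act] at hc
    refine le_trans (l2_le_l2_of_abs_le fun j => h.abs_surrogateGrad_sub_le k j) ?_
    rw [hc]
    refine le_trans ?_ h.sqrt_mul_remBound_le
    rw [mul_assoc]
    exact le_mul_of_one_le_left (by positivity) (Real.one_le_sqrt.2 one_le_K)
  -- One client is bounded by the sum over all clients. This is wasteful, but the resulting K is
  -- compensated by the client weight of order 1/K.
  have h4 : l2 g ≤ E.K * (Real.sqrt (C * Cb) * E.rate) := by
    refine l2_le_of_sq_le (by positivity) ?_
    have h5 : ∑ j, g j ^ 2 ≤ C * (E.K * E.q / E.nstar) :=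
      (Finset.single_le_sum (f := fun k => ∑ j : E.Act,
        (1 / (E.size k : ℝ) * E.scoreSum f k ω j) ^ 2)
        (fun k _ => Finset.sum_nonneg fun j _ => sq_nonneg _) (Finset.mem_univ k)).trans
        h.good.score_client_le
    have h6 := div_nstar_le_rate_sq hCb hstar h.Nmin_pos h.size_le
    rw [mul_pow, mul_pow, Real.sq_sqrt (by positivity)]
    calc _ ≤ C * (E.K * E.q / E.nstar) := h5
      _ = C * E.K * (E.q / E.nstar) := by ring
      _ ≤ C * E.K * (Cb * E.rate ^ 2) := by gcongr
      _ = E.K * (C * Cb * E.rate ^ 2) := by ring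
      _ ≤ (E.K : ℝ) ^ 2 * (C * Cb * E.rate ^ 2) := by
          refine mul_le_mul_of_nonneg_right ?_ (by positivity)
          exact le_self_pow₀ one_le_K two_ne_zero
  have h5 := l2_add_le (fun j : E.Act => (E.Vlocal f k ω *ᵥ U) j)
    ((fun j : E.Act => E.surrogateGrad f k ω j - g j) + g)
  have h6 := l2_add_le (fun j : E.Act => E.surrogateGrad f k ω j - g j) g
  have hB1 : 0 ≤ errBound Cb Cx Clip Cmin C := Real.sqrt_nonneg _
  have hκ : 0 ≤ Clip * Cx * C ^ 2 * Cb := by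
    have := h.Clip_pos
    have := h.Cx_pos
    positivity
  rw [h1, l2_smul, abs_of_nonneg (by positivity)]
  calc _ ≤ 2 * Cb / E.K * (hessBound Cx CL Cmin * (errBound Cb Cx Clip Cmin C * E.rate)
        + (Clip * Cx * C ^ 2 * Cb * E.rate + E.K * (Real.sqrt (C * Cb) * E.rate))) := by
        refine mul_le_mul (h.size_div_N_le k) ?_ (l2_nonneg _) (by positivity)
        linarith
    _ = 2 * Cb * ((hessBound Cx CL Cmin * errBound Cb Cx Clip Cmin C + Clip * Cx * C ^ 2 * Cb)
          * E.rate / E.K + Real.sqrt (C * Cb) * E.rate) := by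
        field_simp
        ring
    _ ≤ 2 * Cb * ((hessBound Cx CL Cmin * errBound Cb Cx Clip Cmin C + Clip * Cx * C ^ 2 * Cb)
          * E.rate + Real.sqrt (C * Cb) * E.rate) := by
        gcongr
        exact div_le_self (by positivity) one_le_K
    _ = _ := by ring

lemma oracle_eq_add (j : Fin E.p) (k : Fin E.K) :
    E.oracle f ω j k = E.θstar j k + E.oracleError f ω (E.cluster k) j := by
  simp [oracle, oracleError, θstar]

/-- Error of the oracle estimator in the Frobenius norm. -/
lemma frob_oracle_sub_le (h : E.Controlled f Cb Cx CL Clip Cmin C ω) :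
    frob (E.actRows (E.oracle f ω) - E.actRows E.θstar)
      ≤ errBound Cb Cx Clip Cmin C * E.rate := by
  rw [frob]
  refine Real.sqrt_le_iff.2 ⟨mul_nonneg (Real.sqrt_nonneg _) rate_nonneg, ?_⟩
  refine le_trans (le_of_eq ?_) h.sum_l2_oracleError_sq_le
  rw [Finset.sum_comm]
  refine Finset.sum_congr rfl fun k _ => ?_
  rw [← actPart_oracleError ω (E.cluster k), l2_sq, sum_actPart_sq]
  refine Finset.sum_congr rfl fun j _ => ?_
  simp [actRows, oracle_eq_add]

lemma l2_row_le (h : E.Controlled f Cb Cx CL Clip Cmin C ω) (j : Fin E.p) :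
    l2 (fun k => E.oracleError f ω (E.cluster k) j) ≤ errBound Cb Cx Clip Cmin C * E.rate :=
  (l2_le_l2_of_abs_le fun k => abs_apply_le_l2 (E.oracleError f ω (E.cluster k)) j).trans
    h.l2_l2_oracleError_le

end Controlled

/-- Every entry of ψ⋆ is repeated |G_m| ≥ |G_min| times in the corresponding row of θ⋆. -/
lemma sqrt_Gmin_mul_le (j : Fin E.p) :
    Real.sqrt E.Gmin * l2 (E.ψstar j) ≤ l2 (E.θstar j) := by
  refine abs_le_of_sq_le_sq' ?_ (l2_nonneg _) |>.2
  rw [mul_pow, Real.sq_sqrt (Nat.cast_nonneg _), l2_sq, l2_sq, Finset.mul_sum]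
  rw [← Finset.sum_fiberwise (s := Finset.univ) (g := E.cluster)]
  refine Finset.sum_le_sum fun m _ => ?_
  have h1 : ∑ k ∈ Finset.univ.filter (fun k => E.cluster k = m), E.θstar j k ^ 2
      = E.clusterCard m * E.ψstar j m ^ 2 := by
    rw [clusterCard, ← nsmul_eq_mul, ← Finset.sum_const]
    exact Finset.sum_congr rfl fun k hk => by rw [θstar, (Finset.mem_filter.1 hk).2]
  rw [h1]
  exact mul_le_mul_of_nonneg_right (by exact_mod_cast Gmin_le_clusterCard m) (sq_nonneg _)

/-- The constant controlling all deterministic bounds at the oracle. -/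
def totalBound (Cb Cx CL Clip Cmin C : ℝ) : ℝ :=
  4 * Cb * (hessBound Cx CL Cmin * errBound Cb Cx Clip Cmin C + Clip * Cx * C ^ 2 * Cb
    + Real.sqrt (C * Cb) + C) + 2 * errBound Cb Cx Clip Cmin C + 1

namespace Controlled

variable {Cb Cx CL Clip Cmin C : ℝ} {ω : E.Ω}

/-- On a good event, with penalty levels and signals that dominate the oracle rate, the oracle
satisfies all conditions for local minimality. -/
theorem oracleConditions (h : E.Controlled f Cb Cx CL Clip Cmin C ω) {τ lam1 lam2 : ℝ}
    (hlam1 : totalBound Cb Cx CL Clip Cmin C * E.rate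
      + totalBound Cb Cx CL Clip Cmin C * Real.sqrt (Real.log E.p / E.N) < lam1)
    (hlam2 : totalBound Cb Cx CL Clip Cmin C * E.rate < lam2)
    (hd1 : ∀ j : Fin E.p, (j : ℕ) < E.q → τ * lam1 + totalBound Cb Cx CL Clip Cmin C * E.rate
      < Real.sqrt E.Gmin * l2 (E.ψstar j))
    (hd2 : ∀ m m' : Fin E.M, m ≠ m' → τ * lam2 + totalBound Cb Cx CL Clip Cmin C * E.rate
      < l2 (fun j : E.Act => E.ψstar j.1 m - E.ψstar j.1 m')) :
    E.OracleConditions f τ lam1 lam2 ω (E.oracle f ω) := by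
  have hrate := E.rate_nonneg
  have hB1 : 0 ≤ errBound Cb Cx Clip Cmin C := Real.sqrt_nonneg _
  have hH := h.hessBound_pos
  have hCb := h.Cb_pos
  have hC := h.C_pos
  have hCbC : 0 ≤ Real.sqrt (C * Cb) := Real.sqrt_nonneg _
  have hκ : 0 ≤ Clip * Cx * C ^ 2 * Cb := by
    have := h.Clip_pos
    have := h.Cx_pos
    positivity
  have hHB : 0 ≤ hessBound Cx CL Cmin * errBound Cb Cx Clip Cmin C := by positivity
  -- Twice the error, since the separation of two columns loses the error of both.
  have hT1 : 2 * errBound Cb Cx Clip Cmin C ≤ totalBound Cb Cx CL Clip Cmin C := by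
    have : 0 ≤ 4 * Cb * (hessBound Cx CL Cmin * errBound Cb Cx Clip Cmin C + Clip * Cx * C ^ 2 * Cb
      + Real.sqrt (C * Cb) + C) := by positivity
    unfold totalBound
    linarith
  -- The 4 combines the factor 2 in `fitGrad` with the factor 2 required by `grad_act`.
  have hT2 : 4 * Cb * (hessBound Cx CL Cmin * errBound Cb Cx Clip Cmin C + Clip * Cx * C ^ 2 * Cb
      + Real.sqrt (C * Cb) + C) ≤ totalBound Cb Cx CL Clip Cmin C := by
    unfold totalBound
    linarith
  have herr : 2 * (errBound Cb Cx Clip Cmin C * E.rate)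
      ≤ totalBound Cb Cx CL Clip Cmin C * E.rate := by
    rw [← mul_assoc]
    exact mul_le_mul_of_nonneg_right hT1 hrate
  have herr0 : 0 ≤ errBound Cb Cx Clip Cmin C * E.rate := by positivity
  refine ⟨h.size_pos, fun k => Vlocal_transpose h.loss k ω, ?_, oracle_mem_clusterSpace ω,
    oracle_zeroOff ω, ?_, ?_, ?_, ?_, ?_⟩
  · intro k v hv
    refine lt_of_lt_of_le ?_ (h.le_quad k v)
    have h1 : 0 < l2 (E.actPart v) :=
      lt_of_le_of_ne (l2_nonneg _) fun h0 => hv (l2_eq_zero_iff.1 h0.symm)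
    have := h.Cmin_pos
    positivity
  · intro m j hj
    rw [← Finset.sum_filter]
    have h1 := h.normal_eq m ⟨j, hj⟩
    calc ∑ k ∈ Finset.univ.filter (fun k => E.cluster k = m), E.fitGrad f ω (E.oracle f ω) j k
        = 2 / E.N * ∑ k ∈ Finset.univ.filter (fun k => E.cluster k = m), (E.size k : ℝ) *
          ((E.Vlocal f k ω *ᵥ E.oracleError f ω m) j + E.surrogateGrad f k ω j) := by
          rw [Finset.mul_sum]
          refine Finset.sum_congr rfl fun k hk => ?_
          rw [fitGrad_oracle, (Finset.mem_filter.1 hk).2]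
          ring
      _ = 0 := by rw [h1, mul_zero]
  · intro j _
    refine (h.l2_fitGrad_row_le j).trans_lt (lt_of_le_of_lt ?_ hlam1)
    have hs : 0 ≤ Real.sqrt (Real.log E.p / E.N) := Real.sqrt_nonneg _
    calc _ = (2 * Cb * (hessBound Cx CL Cmin * errBound Cb Cx Clip Cmin C
            + Clip * Cx * C ^ 2 * Cb)) * E.rate
            + (2 * Cb * C) * Real.sqrt (Real.log E.p / E.N) := by ring
      _ ≤ _ := by
          refine add_le_add (mul_le_mul_of_nonneg_right (le_trans ?_ hT2) hrate)
            (mul_le_mul_of_nonneg_right (le_trans ?_ hT2) hs)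
          · nlinarith
          · nlinarith
  · intro k
    refine lt_of_le_of_lt ?_ hlam2
    calc _ ≤ 2 * (2 * Cb * ((hessBound Cx CL Cmin * errBound Cb Cx Clip Cmin C
          + Clip * Cx * C ^ 2 * Cb + Real.sqrt (C * Cb)) * E.rate)) :=
          mul_le_mul_of_nonneg_left (h.l2_fitGrad_column_le k) zero_le_two
      _ = (4 * Cb * (hessBound Cx CL Cmin * errBound Cb Cx Clip Cmin C
          + Clip * Cx * C ^ 2 * Cb + Real.sqrt (C * Cb))) * E.rate := by ring
      _ ≤ _ := by
          refine mul_le_mul_of_nonneg_right (le_trans ?_ hT2) hrate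
          exact mul_le_mul_of_nonneg_left (le_add_of_nonneg_right hC.le) (by positivity)
  · intro j hj
    have h1 := hd1 j hj
    have h2 := E.sqrt_Gmin_mul_le j
    have h3 := h.l2_row_le j
    have h4 : E.θstar j = E.oracle f ω j - fun k => E.oracleError f ω (E.cluster k) j := by
      ext k
      simp [oracle_eq_add]
    have h5 := l2_sub_le (E.oracle f ω j) (fun k => E.oracleError f ω (E.cluster k) j)
    rw [← h4] at h5
    linarith
  · intro k k' hk
    have h1 := hd2 _ _ hk
    have h2 := h.l2_oracleError_le_rate k
    have h3 := h.l2_oracleError_le_rate k'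
    have h4 : E.column E.θstar k - E.column E.θstar k' = (E.column (E.oracle f ω) k
        - E.column (E.oracle f ω) k') - (E.oracleError f ω (E.cluster k)
          - E.oracleError f ω (E.cluster k')) := by
      ext j
      simp only [column, Pi.sub_apply, oracle_eq_add]
      ring
    have h5 := l2_sub_le (E.column (E.oracle f ω) k - E.column (E.oracle f ω) k')
      (E.oracleError f ω (E.cluster k) - E.oracleError f ω (E.cluster k'))
    have h6 := l2_sub_le (E.oracleError f ω (E.cluster k)) (E.oracleError f ω (E.cluster k'))
    have h7 := l2_subtype_le (fun j : Fin E.p => (j : ℕ) < E.q)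
      (E.column E.θstar k - E.column E.θstar k')
    have h8 : l2 (fun j : E.Act => E.ψstar j.1 (E.cluster k) - E.ψstar j.1 (E.cluster k'))
        ≤ l2 (E.column E.θstar k - E.column E.θstar k') := h7
    rw [h4] at h8
    linarith

end Controlled

end Experiment

/-! ### Sequences of experiments -/

/-- Since K ≥ 1, the bound K ≤ e^(−L′)p yields both K ≤ p and log p ≥ L′; in the other condition the
ratio |G_max|/|G_min| ≥ 1 is dropped. -/
lemma GrowthConditions.eventually_largeSample {S : ℕ → Experiment.{u}} (h : GrowthConditions S)
    (L : ℝ) : ∀ᶠ n in atTop, (S n).LargeSample L := by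
  set L' := max L 1 with hL'
  have hL'1 : 1 ≤ L' := le_max_right _ _
  have h1 := h.1.bound (inv_pos.2 (lt_of_lt_of_le one_pos hL'1))
  have h2 := h.2.bound (Real.exp_pos (-L'))
  filter_upwards [h1, h2] with n hn1 hn2
  refine Experiment.LargeSample.mono (L := L') ?_ (le_max_left _ _)
  have hp := (S n).one_le_p
  have hp0 : (0 : ℝ) < (S n).p := by linarith
  rw [Real.norm_eq_abs, Real.norm_eq_abs, abs_of_nonneg (Nat.cast_nonneg _),
    abs_of_nonneg (Nat.cast_nonneg _)] at hn2
  refine ⟨?_, ?_, ?_⟩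
  · refine hn2.trans (mul_le_of_le_one_left hp0.le ?_)
    exact Real.exp_le_one_iff.2 (by linarith)
  · rw [Real.le_log_iff_exp_le hp0]
    have h3 := (S n).one_le_K.trans hn2
    rw [Real.exp_neg, inv_mul_eq_div, one_le_div (Real.exp_pos _)] at h3
    exact h3
  · have hlog := (S n).log_p_nonneg
    have hstar : 0 ≤ (S n).nstar := div_nonneg (Nat.cast_nonneg _) (Nat.cast_nonneg _)
    rw [Real.norm_eq_abs, Real.norm_eq_abs, abs_of_nonneg (by positivity),
      abs_of_nonneg hstar, inv_mul_eq_div, le_div_iff₀ (by linarith)] at hn1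
    refine le_trans ?_ hn1
    rw [mul_comm]
    refine mul_le_mul_of_nonneg_right ?_ (by linarith)
    refine mul_le_mul_of_nonneg_right ?_ hlog
    refine le_mul_of_one_le_left (by positivity) (one_le_pow₀ ?_)
    rw [one_le_div (lt_of_lt_of_le one_pos (S n).one_le_Gmin)]
    exact (S n).Gmin_le_Gmax

lemma withProbTendingToOne_of_forall {S : ℕ → Experiment.{u}} {P : ∀ n, (S n).Ω → Prop}
    (h : ∀ ε : ℝ, 0 < ε → ∀ᶠ n in atTop, (S n).μ {ω | ¬ P n ω} ≤ ENNReal.ofReal ε) :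
    WithProbTendingToOne S P := by
  refine ENNReal.tendsto_nhds_zero.2 fun ε hε => ?_
  by_cases htop : ε = ⊤
  · simp [htop]
  filter_upwards [h ε.toReal (ENNReal.toReal_pos hε.ne' htop)] with n hn
  rwa [ENNReal.ofReal_toReal htop] at hn

lemma measure_union_le_of_le {Ω : Type*} [MeasurableSpace Ω] {μ : Measure Ω} {s t : Set Ω}
    {a b : ℝ≥0∞} (hs : μ s ≤ a) (ht : μ t ≤ b) : μ (s ∪ t) ≤ a + b :=
  (measure_union_le s t).trans (add_le_add hs ht)

/-! ### Choice of constants, uniformly over experiments -/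

namespace Experiment

variable {E : Experiment.{u}} {f : ℝ → ℝ → ℝ}

/-- In a large sample, good events control the linearization. -/
lemma GoodEvent.controlled {c Cb Cx κ CL Clip Cmin C L : ℝ} {ω : E.Ω}
    (hgood : E.GoodEvent f Cx CL Cmin C ω) (hf : IsTwiceDiffLoss f)
    (hreg : E.Regular f c Cb Cx κ CL Cmin) (hc : 0 < c) (hCb : 0 < Cb) (hCx : 0 < Cx)
    (hCL : 0 < CL) (hClip : 0 < Clip) (hCmin : 0 < Cmin) (hC : 0 < C)
    (hlip : ∀ a b y : ℝ, |lossD2 f a y - lossD2 f b y| ≤ Clip * |a - b|)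
    (hL : 1 ≤ L) (hL1 : (4 * (Clip * Cx ^ 2 * C) / Cmin) ^ 2 ≤ L) (hlarge : E.LargeSample L) :
    E.Controlled f Cb Cx CL Clip Cmin C ω := by
  have hstar := hlarge.nstar_pos hL
  have hlog := hlarge.log_pos hL
  refine ⟨hf, hgood, hCb, hCx, hCL, hClip, hCmin, hC,
    fun k => hlarge.size_pos hL hc hreg.size_ge k, hreg.size_le, hstar, hlip, ?_⟩
  set A := 4 * (Clip * Cx ^ 2 * C) / Cmin with hA
  have hA0 : 0 < A := by positivity
  -- The square of the left side is q³ log p / n*, which is at most 1/L ≤ 1/A² in a large sample.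
  have h1 : E.q * E.localRate ≤ 1 / A := by
    refine abs_le_of_sq_le_sq' ?_ (by positivity) |>.2
    have hq4 : (E.q : ℝ) ^ 2 * E.q ≤ (E.q : ℝ) ^ 4 := by
      calc (E.q : ℝ) ^ 2 * E.q = (E.q : ℝ) ^ 3 := by ring
        _ ≤ _ := pow_le_pow_right₀ one_le_q (by norm_num)
    rw [mul_pow, localRate, Real.sq_sqrt (by positivity), div_pow, one_pow, ← mul_div_assoc,
      div_le_div_iff₀ hstar (by positivity), one_mul]
    calc (E.q : ℝ) ^ 2 * (E.q * Real.log E.p) * A ^ 2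
        = A ^ 2 * ((E.q : ℝ) ^ 2 * E.q * Real.log E.p) := by ring
      _ ≤ L * ((E.q : ℝ) ^ 4 * Real.log E.p) := by gcongr
      _ ≤ E.nstar := hlarge.le_nstar
  calc Clip * Cx ^ 2 * C * (E.q * E.localRate) ≤ Clip * Cx ^ 2 * C * (1 / A) := by gcongr
    _ = Cmin / 4 := by
        rw [hA]
        field_simp

/-- Good events have probability close to one, uniformly over large samples. -/
lemma exists_measure_not_goodEvent_le {c Cb Cx κ CL Cmin : ℝ} (hf : IsTwiceDiffLoss f)
    (hc : 0 < c) (hCx : 0 < Cx) (hκ : 0 < κ) (hCL : 0 < CL) (hCmin : 0 < Cmin) {ε : ℝ}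
    (hε : 0 < ε) : ∃ C₀ L : ℝ, 0 < C₀ ∧ ∀ (E : Experiment.{u}) (C : ℝ), C₀ ≤ C →
      E.Regular f c Cb Cx κ CL Cmin → E.LargeSample L →
      E.μ {ω | ¬ ∀ k, 1 / Real.sqrt (E.size k) * l2 (fun i => E.predError k i ω)
        ≤ C * E.localRate} ≤ ENNReal.ofReal ε →
      E.μ {ω | ¬ E.GoodEvent f Cx CL Cmin C ω} ≤ ENNReal.ofReal (6 * ε) := by
  set σ : NNReal := Real.toNNReal (64 * Real.exp 1 * (Cx * κ) ^ 2) with hσ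
  have hσ0 : 0 < σ := Real.toNNReal_pos.2 (by positivity)
  have hσ' : (0 : ℝ) < σ := by exact_mod_cast hσ0
  set C₁ := Real.sqrt (6 * σ / c) with hC₁
  have hC₁0 : 0 < C₁ := Real.sqrt_pos.2 (by positivity)
  set L := max (max 1 (2 / ε)) (max (8 * (CL * Cx * Cx) ^ 2 / (c * (Cmin / 2) ^ 2))
    (8 * (1 * Cx * Cx) ^ 2 / (c * 1 ^ 2))) with hL
  -- The three entries serve the uniform score tail and the two Markov bounds. Any larger C works as
  -- well, which leaves room for the constant in the prediction error.
  refine ⟨max C₁ (max (8 * σ / ε) (8 * σ / (c * ε))), L, lt_max_of_lt_left hC₁0, ?_⟩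
  intro E C hC hreg hlarge hpred
  have hL1 : 1 ≤ L := (le_max_left _ _).trans (le_max_left _ _)
  have hL2 : 2 / ε ≤ L := (le_max_right _ _).trans (le_max_left _ _)
  have hL3 : 8 * (CL * Cx * Cx) ^ 2 / (c * (Cmin / 2) ^ 2) ≤ L :=
    (le_max_left _ _).trans (le_max_right _ _)
  have hL4 : 8 * (1 * Cx * Cx) ^ 2 / (c * 1 ^ 2) ≤ L := (le_max_right _ _).trans (le_max_right _ _)
  have hCC₁ : C₁ ≤ C := (le_max_left _ _).trans hC
  have hC0 : 0 < C := hC₁0.trans_le hCC₁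
  have hC2 : 8 * σ / ε ≤ C := ((le_max_left _ _).trans (le_max_right _ _)).trans hC
  have hC3 : 8 * σ / (c * ε) ≤ C := ((le_max_right _ _).trans (le_max_right _ _)).trans hC
  have hC4 : 6 * σ ≤ C ^ 2 * c := by
    rw [← div_le_iff₀ hc, ← Real.sq_sqrt (by positivity : (0 : ℝ) ≤ 6 * σ / c)]
    exact pow_le_pow_left₀ hC₁0.le hCC₁ 2
  have hsub := hasSubgaussianMGF_scoreTerm hf hCx hκ hreg.x_le hreg.score_mean hreg.score_tail
  rw [← hσ] at hsub
  have hsize := hlarge.size_pos hL1 hc hreg.size_ge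
  have hstar := hlarge.nstar_pos hL1
  have h1 := ae_x_le_and_curv_le hreg
  have h2 := measure_not_hess_ge_le hf hreg hc hCx hCL hCmin hε hL1 hL3 hL2 hlarge
  have h3 := measure_not_gram_le_le hreg hc hCx hε hL1 hL4 hL2 hlarge
  have h4 := measure_not_score_le_le hf hreg hc hσ0 hsub hC0 hC4 hε hL1 hL2 hlarge
  have h5 := measure_not_score_cluster_le_le hf hreg.indep hsize hσ0 hsub hε hC2
  have h6 := measure_not_score_client_le_le hf hreg hc hstar hσ0 hsub hε hC3
  -- One null set, for the almost sure bounds, and six events of probability at most ε.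
  refine (measure_mono (t := _ ∪ (_ ∪ (_ ∪ (_ ∪ (_ ∪ (_ ∪ _)))))) fun ω hω => ?_).trans
    ((measure_union_le_of_le h1.le <| measure_union_le_of_le hpred <| measure_union_le_of_le h2 <|
      measure_union_le_of_le h3 <| measure_union_le_of_le h4 <| measure_union_le_of_le h5 h6).trans
      (le_of_eq ?_))
  · by_contra hcon
    simp only [Set.mem_union, Set.mem_ofPred_eq, not_or, not_not] at hcon
    obtain ⟨⟨g1, g2⟩, g3, g4, g5, g6, g7, g8⟩ := hcon
    exact hω ⟨g1, g2, g3, g4, g5, g6, g7, g8⟩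
  · rw [zero_add]
    rw [← ENNReal.ofReal_add (by positivity) (by positivity),
      ← ENNReal.ofReal_add (by positivity) (by positivity),
      ← ENNReal.ofReal_add (by positivity) (by positivity),
      ← ENNReal.ofReal_add (by positivity) (by positivity),
      ← ENNReal.ofReal_add (by positivity) (by positivity)]
    congr 1
    ring

lemma rowSumNorm_nonneg {ι κ : Type*} [Fintype ι] [Fintype κ] (Z : Matrix ι κ ℝ) :
    0 ≤ rowSumNorm Z :=
  Real.iSup_nonneg fun _ => Finset.sum_nonneg fun _ _ => abs_nonneg _

/-- Lets the oracle rate be isolated from the sum that λ₁ is assumed to dominate. -/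
lemma φmax_mul_r2_nonneg : 0 ≤ E.φmax f * E.r2 := by
  have hlog := E.log_p_nonneg
  refine mul_nonneg (Real.iSup_nonneg fun k => rowSumNorm_nonneg _) ?_
  unfold r2
  positivity

end Experiment

/-- The oracle estimators satisfy the conditions for local minimality outside of events of small
probability. -/
lemma exists_oracleConditions (S : ℕ → Experiment.{u}) (f : ℝ → ℝ → ℝ)
    (τ : ℝ) (lam1 lam2 : ℕ → ℝ) (hlam1 : ∀ n, 0 ≤ lam1 n) (hlam2 : ∀ n, 0 ≤ lam2 n)
    (hf : IsTwiceDiffLoss f) (hsizes : BalancedSizes S) (hindep : IndependentClients S)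
    (hdesign : BoundedDesign S) (htrue : TrueCoefficients S f) (hscore : SubGaussianScore S f)
    (heig : BoundedEigenvalues S f) (hsmooth : SmoothLoss S f) (hlocal : LocalEstimatorRates S)
    (hgrowth : GrowthConditions S)
    (hd1 : ∀ C : ℝ, ∀ᶠ n in atTop, ∀ j : Fin (S n).p, (j : ℕ) < (S n).q →
      τ * lam1 n + C * (Real.sqrt (S n).Gmax * (S n).r1)
        < Real.sqrt (S n).Gmin * l2 ((S n).ψstar j))
    (hlam1_r : (fun n => Real.sqrt (S n).Gmax * (S n).r1 + (S n).φmax f * (S n).r2)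
      =o[atTop] lam1)
    (hlam1_log : (fun n => max 1 ((S n).φmax f) * Real.sqrt (Real.log (S n).p / (S n).N))
      =o[atTop] lam1)
    (hd2 : ∀ C : ℝ, ∀ᶠ n in atTop, ∀ m m' : Fin (S n).M, m ≠ m' →
      τ * lam2 n + C * (Real.sqrt (S n).Gmax * (S n).r1)
        < l2 (fun j : (S n).Act => (S n).ψstar j.1 m - (S n).ψstar j.1 m'))
    (hlam2_r : (fun n => Real.sqrt (S n).Gmax * (S n).r1) =o[atTop] lam2)
    {ε : ℝ} (hε : 0 < ε) :
    ∃ B : ℝ, 0 < B ∧ ∀ᶠ n in atTop, 0 < lam1 n ∧ 0 < lam2 n ∧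
      (S n).μ {ω | ¬ ((S n).OracleConditions f τ (lam1 n) (lam2 n) ω ((S n).oracle f ω) ∧
        frob ((S n).actRows ((S n).oracle f ω) - (S n).actRows (S n).θstar)
          ≤ B * (Real.sqrt (S n).Gmax * (S n).r1))} ≤ ENNReal.ofReal ε := by
  obtain ⟨c, Cb, hc, hCb, hsize⟩ := hsizes
  obtain ⟨Cx, hCx, hx⟩ := hdesign
  obtain ⟨κ, hκ, hscoreκ⟩ := hscore
  obtain ⟨Cmin, Cmax, hCmin, heigen⟩ := heig
  obtain ⟨hcurv, Clip, hClip, hlip⟩ := hsmooth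
  -- Radius zero suffices: curvature is bounded at the truth only, and the Lipschitz condition
  -- carries it to the local estimators.
  obtain ⟨CL, hCL, hcurvCL⟩ := hcurv (fun _ => 0) (fun _ => le_rfl) tendsto_const_nhds
  have hreg : ∀ᶠ n in atTop, (S n).Regular f c Cb Cx κ CL Cmin := by
    filter_upwards [hcurvCL] with n hn
    refine ⟨(hindep n).1, fun k => (hsize n k).1, fun k => (hsize n k).2, fun k i => (hx n k i).1,
      fun k i => (hx n k i).2, fun k i j => htrue n k i j, fun k i => hscoreκ n k i, fun k i => ?_,
      fun k => (heigen n k).1⟩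
    filter_upwards [hn k i] with ω hω
    exact hω _ (by rw [sub_self, l2_zero])
  have hε6 : 0 < ε / 6 := by positivity
  obtain ⟨C₀, L₀, hC₀, hmeas⟩ := Experiment.exists_measure_not_goodEvent_le (Cb := Cb) hf hc hCx hκ
    hCL hCmin hε6
  obtain ⟨C₁, hC₁, hpred⟩ := hlocal.2 (ε / 6) hε6
  -- One constant for all parts of the good event: C₀ for the scores and C₁ for the prediction
  -- errors. L is chosen afterwards, since it depends on C.
  set C := max C₀ C₁ with hCdef
  have hC : 0 < C := lt_max_of_lt_left hC₀
  set L := max (max 1 L₀) ((4 * (Clip * Cx ^ 2 * C) / Cmin) ^ 2) with hLdef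
  have hL1 : 1 ≤ L := (le_max_left _ _).trans (le_max_left _ _)
  have hL2 : L₀ ≤ L := (le_max_right _ _).trans (le_max_left _ _)
  have hL3 : (4 * (Clip * Cx ^ 2 * C) / Cmin) ^ 2 ≤ L := le_max_right _ _
  set B := Experiment.totalBound Cb Cx CL Clip Cmin C with hB
  set B' := max B 1 with hB'
  have hB'1 : 1 ≤ B' := le_max_right _ _
  have hB'0 : 0 < B' := lt_of_lt_of_le one_pos hB'1
  have hBB' : B ≤ B' := le_max_left _ _
  set B₁ := max 1 (Experiment.errBound Cb Cx Clip Cmin C) with hB₁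
  -- With this constant in the little-o relations, B times the rate and B times √(log p / N) are
  -- each at most a quarter of the penalty level, so their sum stays strictly below it.
  have hc4 : 0 < 1 / (4 * B') := by positivity
  refine ⟨B₁, lt_of_lt_of_le one_pos (le_max_left _ _), ?_⟩
  filter_upwards [hreg, hpred, hgrowth.eventually_largeSample L, hd1 B, hd2 B, hlam1_r.bound hc4,
    hlam1_log.bound hc4, hlam2_r.bound hc4] with n hreg hpred hlarge hd1 hd2 hl1 hlog hl2
  have hstar := hlarge.nstar_pos hL1
  have hNmin := (S n).Nmin_pos (hlarge.size_pos hL1 hc hreg.size_ge)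
  have hrate := (S n).rate_pos hNmin
  have hlogp := hlarge.log_pos hL1
  have hN : (0 : ℝ) < (S n).N := by
    rw [(S n).N_eq]
    exact mul_pos (S n).K_pos_real hstar
  have hs : 0 < Real.sqrt (Real.log (S n).p / (S n).N) := Real.sqrt_pos.2 (by positivity)
  have hl1' : (S n).rate ≤ 1 / (4 * B') * lam1 n := by
    have h0 := Experiment.φmax_mul_r2_nonneg (E := S n) (f := f)
    rw [Real.norm_eq_abs, Real.norm_eq_abs, abs_of_nonneg (hlam1 n)] at hl1
    have h1 := (le_abs_self _).trans hl1
    have h2 : (S n).rate = Real.sqrt (S n).Gmax * (S n).r1 := rfl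
    linarith
  have hlog' : Real.sqrt (Real.log (S n).p / (S n).N) ≤ 1 / (4 * B') * lam1 n := by
    rw [Real.norm_eq_abs, Real.norm_eq_abs, abs_of_nonneg (hlam1 n)] at hlog
    refine le_trans ?_ ((le_abs_self _).trans hlog)
    exact le_mul_of_one_le_left hs.le (le_max_left _ _)
  have hl2' : (S n).rate ≤ 1 / (4 * B') * lam2 n := by
    rw [Real.norm_eq_abs, Real.norm_eq_abs, abs_of_nonneg (hlam2 n)] at hl2
    exact (le_abs_self _).trans hl2
  have hlam1pos : 0 < lam1 n := pos_of_mul_pos_right (hrate.trans_le hl1') hc4.le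
  have hlam2pos : 0 < lam2 n := pos_of_mul_pos_right (hrate.trans_le hl2') hc4.le
  have hmul : ∀ {x y : ℝ}, 0 < x → x ≤ 1 / (4 * B') * y → B * x ≤ y / 4 := by
    intro x y hx hxy
    calc B * x ≤ B' * x := by gcongr
      _ ≤ B' * (1 / (4 * B') * y) := by gcongr
      _ = y / 4 := by field_simp
  have h1 := hmul hrate hl1'
  have h2 := hmul hs hlog'
  have h3 := hmul hrate hl2'
  refine ⟨hlam1pos, hlam2pos, ?_⟩
  have hgood := hmeas (S n) C (le_max_left _ _) hreg (hlarge.mono hL2) (by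
    refine (measure_mono fun ω hω => ?_).trans hpred
    simp only [Set.mem_ofPred_eq, not_forall, not_le] at hω ⊢
    obtain ⟨k, hk⟩ := hω
    have hle := le_ciSup (f := fun k => (1 / Real.sqrt ((S n).size k)) *
      l2 (fun i => (S n).x k i ω ⬝ᵥ ((S n).θlocal k ω - (S n).column (S n).θstar k)))
      (Set.finite_range _).bddAbove k
    refine lt_of_lt_of_le (lt_of_le_of_lt ?_ hk) (hle.trans (le_abs_self _))
    exact mul_le_mul_of_nonneg_right (le_max_right _ _) (S n).localRate_nonneg)
  rw [mul_div_cancel₀ _ (by norm_num : (6 : ℝ) ≠ 0)] at hgood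
  refine (measure_mono fun ω hω => ?_).trans hgood
  intro hgoodω
  have hctrl := hgoodω.controlled hf hreg hc hCb hCx hCL hClip hCmin hC hlip hL1 hL3 hlarge
  refine hω ⟨hctrl.oracleConditions (by linarith) (by linarith) hd1 hd2, ?_⟩
  exact hctrl.frob_oracle_sub_le.trans (mul_le_mul_of_nonneg_right (le_max_right _ _) hrate.le)

end

/-! ### Oracle property for sequences of experiments -/

theorem theorem2 (S : ℕ → Experiment.{u}) (f : ℝ → ℝ → ℝ)
    (τ : ℝ) (hτ : 0 < τ) (pen : ℝ → ℝ → ℝ) (lam1 lam2 : ℕ → ℝ)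
    (hlam1 : ∀ n, 0 ≤ lam1 n) (hlam2 : ∀ n, 0 ≤ lam2 n)
    (hf : IsTwiceDiffLoss f)
    (hsizes : BalancedSizes S)
    (hindep : IndependentClients S)
    (hdesign : BoundedDesign S)
    (htrue : TrueCoefficients S f)
    (hscore : SubGaussianScore S f)
    (heig : BoundedEigenvalues S f)
    (hsmooth : SmoothLoss S f)
    (hlocal : LocalEstimatorRates S)
    (hpen : IsConcavePenalty τ pen)
    (hgrowth : GrowthConditions S)
    -- `|G_min|^{1/2} d_1 > τ λ_1`, by a margin of larger order than `|G_max|^{1/2} r_{1N}`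
    (hd1 : ∀ C : ℝ, ∀ᶠ n in atTop, ∀ j : Fin (S n).p, (j : ℕ) < (S n).q →
      τ * lam1 n + C * (Real.sqrt (S n).Gmax * (S n).r1)
        < Real.sqrt (S n).Gmin * l2 ((S n).ψstar j))
    (hlam1_r : (fun n => Real.sqrt (S n).Gmax * (S n).r1 + (S n).φmax f * (S n).r2)
      =o[atTop] lam1)
    (hr1 : Tendsto (fun n => (S n).r1) atTop (𝓝 0))
    (hlam1_log : (fun n => max 1 ((S n).φmax f) * Real.sqrt (Real.log (S n).p / (S n).N))
      =o[atTop] lam1)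
    -- `d_2 > τ λ_2`, by a margin of larger order than `|G_max|^{1/2} r_{1N}`
    (hd2 : ∀ C : ℝ, ∀ᶠ n in atTop, ∀ m m' : Fin (S n).M, m ≠ m' →
      τ * lam2 n + C * (Real.sqrt (S n).Gmax * (S n).r1)
        < l2 (fun j : (S n).Act => (S n).ψstar j.1 m - (S n).ψstar j.1 m'))
    (hlam2_r : (fun n => Real.sqrt (S n).Gmax * (S n).r1) =o[atTop] lam2) :
    ∃ θor θhat : ∀ n, (S n).Ω → (S n).Coef,
      (∀ n j k, Measurable (fun ω => θor n ω j k)) ∧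
      (∀ n j k, Measurable (fun ω => θhat n ω j k)) ∧
      -- `θor` is the oracle estimator
      WithProbTendingToOne S (fun n ω => (S n).IsOracleFit f ω (θor n ω)) ∧
      WithProbTendingToOne S (fun n ω =>
        IsStrictLocalMinOver ((S n).objOracle f pen (lam1 n) ω) (S n).clusterSpace (θor n ω) ∧
          (S n).ZeroOffActive (θor n ω)) ∧
      IsBigOInProb S (fun n ω => frob ((S n).actRows (θor n ω) - (S n).actRows (S n).θstar))
        (fun n => Real.sqrt (S n).Gmax * (S n).r1) ∧
      -- `θhat` is a strictly local minimizer of the full objective and equals the oracle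
      WithProbTendingToOne S (fun n ω =>
        IsStrictLocalMinOver ((S n).objICR f pen (lam1 n) (lam2 n) ω) Set.univ (θhat n ω)) ∧
      WithProbTendingToOne S (fun n ω => θhat n ω = θor n ω) ∧
      -- selection consistency and clustering consistency
      WithProbTendingToOne S (fun n ω => ∀ j, θhat n ω j ≠ 0 ↔ (j : ℕ) < (S n).q) ∧
      WithProbTendingToOne S (fun n ω => ∀ k k',
        (S n).column (θhat n ω) k = (S n).column (θhat n ω) k' ↔
          (S n).cluster k = (S n).cluster k') := by
  have hmain := fun (ε : ℝ) (hε : 0 < ε) => exists_oracleConditions S f τ lam1 lam2 hlam1 hlam2 hf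
    hsizes hindep hdesign htrue hscore heig hsmooth hlocal hgrowth hd1 hlam1_r hlam1_log hd2
    hlam2_r hε
  -- Any deterministic consequence of the oracle conditions has probability tending to one;
  -- monotonicity of the outer measure makes measurability of P irrelevant.
  have key : ∀ P : ∀ n, (S n).Ω → Prop, (∀ n ω, 0 < lam1 n → 0 < lam2 n →
      (S n).OracleConditions f τ (lam1 n) (lam2 n) ω ((S n).oracle f ω) → P n ω) →
      WithProbTendingToOne S P := by
    intro P hP
    refine withProbTendingToOne_of_forall fun ε hε => ?_
    obtain ⟨B, -, hB⟩ := hmain ε hε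
    filter_upwards [hB] with n hn
    refine (measure_mono fun ω hω hcond => ?_).trans hn.2.2
    exact absurd (hP n ω hn.1 hn.2.1 hcond.1) hω
  refine ⟨fun n ω => (S n).oracle f ω, fun n ω => (S n).oracle f ω,
    fun n j k => Experiment.measurable_oracle hf j k,
    fun n j k => Experiment.measurable_oracle hf j k,
    key _ fun n ω _ _ h => h.isOracleFit,
    key _ fun n ω h1 h2 h => ⟨h.isStrictLocalMin_objOracle hpen h1 h2, h.zeroOff⟩, ?_,
    key _ fun n ω h1 h2 h => h.isStrictLocalMin_objICR hpen h1 h2,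
    key _ fun _ _ _ _ _ => rfl, key _ fun n ω h1 _ h j => ⟨fun hj => ?_, fun hj hzero => ?_⟩,
    key _ fun n ω _ h2 h k k' => ⟨fun hk => ?_, fun hk => h.mem k k' hk⟩⟩
  · intro ε hε
    obtain ⟨B, hB0, hB⟩ := hmain ε hε
    refine ⟨B, hB0, ?_⟩
    filter_upwards [hB] with n hn
    refine (measure_mono fun ω hω hcond => ?_).trans hn.2.2
    rw [Set.mem_ofPred_eq, abs_of_nonneg (by exact Real.sqrt_nonneg _)] at hω
    exact absurd hcond.2 (not_le.2 hω)
  · by_contra hq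
    exact hj (h.zeroOff j (not_lt.1 hq))
  -- A vanishing row would have norm zero, yet it exceeds τλ₁ > 0; the separation of clusters is
  -- used in the same way below.
  · have hs := h.signal j hj
    rw [show (S n).oracle f ω j = 0 from hzero, l2_zero] at hs
    exact absurd hs (not_lt.2 (mul_pos hτ h1).le)
  · by_contra hne
    have hs := h.separation k k' hne
    rw [show (S n).column ((S n).oracle f ω) k = (S n).column ((S n).oracle f ω) k' from hk,
      sub_self, l2_zero] at hs
    exact absurd hs (not_lt.2 (mul_pos hτ h2).le)
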